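/- Let $K$ be a perfect field with algebraic closure $\overline{K}$ and $G_K=\operatorname{Gal}(\overline{K}/K)$, let $N$ be a positive integer not divisible by the characteristic of $K$, and let $E$ be an elliptic curve over $K$. The $N$-torsion subgroup $E[N]$ of $E(\overline{K})$ is free of rank $2$ over $\mathbb{Z}/N\mathbb{Z}$, and $G_K$ acts on it $\mathbb{Z}/N\mathbb{Z}$-linearly; with respect to a basis of $E[N]$ this action is the mod $N$ Galois representation \[ \overline{\rho}_{E,N} : G_K \rightarrow \operatorname{GL}_2(\mathbb{Z}/N\mathbb{Z}). \] Let $\chi_N : G_K \rightarrow (\mathbb{Z}/N\mathbb{Z})^*$ be the mod $N$ cyclotomic character, defined by $\sigma(\zeta)=\zeta^{\chi_N(\sigma)}$ for every $\sigma\in G_K$ and every $N$-th root of unity $\zeta \in \overline{K}$. Then, for every choice of basis of $E[N]$, \[ \det \overline{\rho}_{E,N}=\chi_N . \] Suppose moreover that $K$ is a number field. A complex conjugation in $G_K$ is an element $\tau=\iota^{-1}\circ c\circ \iota$, where $\iota : \overline{K}\hookrightarrow \mathbb{C}$ is an embedding that extends a real embedding $K \hookrightarrow \mathbb{R}$ and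 $c$ is complex conjugation on $\mathbb{C}$. Then, for every elliptic curve $E$ over $K$ and every positive integer $N$, the representation $\overline{\rho}_{E,N}$ is odd: $\det \overline{\rho}_{E,N}(\tau)=-1$ for every complex conjugation $\tau\in G_K$. -/

import Mathlib

noncomputable section

namespace EllGalRep

open WeierstrassCurve

universe u

/-- Decidable equality on `K̄`, which the group law of Mathlib on the points of `E` needs. -/
instance algebraicClosureDecidableEq (K : Type u) [Field K] : DecidableEq (AlgebraicClosure K) :=
  Classical.decEq _

/-- The absolute Galois group `G_K = Gal(K̄ / K)`. -/
abbrev AbsGal (K : Type u) [Field K] : Type u :=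
  AlgebraicClosure K ≃ₐ[K] AlgebraicClosure K

/-- The group `E(K̄)` of points of `E` over the algebraic closure of `K`. -/
abbrev GeomPoint {K : Type u} [Field K] (E : WeierstrassCurve K) : Type u :=
  (E.baseChange (AlgebraicClosure K)).toAffine.Point

/-- The `N`-torsion subgroup `E[N]` of `E(K̄)`. -/
abbrev NTorsion {K : Type u} [Field K] (E : WeierstrassCurve K) (N : ℕ) : Type u :=
  AddSubgroup.torsionBy (GeomPoint E) (N : ℤ)

/-- `E[N]` as a module over `ℤ/Nℤ`. -/
instance nTorsionModule {K : Type u} [Field K] (E : WeierstrassCurve K) (N : ℕ) :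
    Module (ZMod N) (NTorsion E N) :=
  AddSubgroup.torsionBy.zmodModule

/-- The action of `σ ∈ G_K` on `E(K̄)`: it sends `(x, y)` to `(σ x, σ y)` and fixes the point
at infinity. -/
def galPoint {K : Type u} [Field K] (E : WeierstrassCurve K) (σ : AbsGal K) :
    GeomPoint E →+ GeomPoint E :=
  Affine.Point.map (W' := E) (σ : AlgebraicClosure K →ₐ[K] AlgebraicClosure K)

theorem galPoint_mem_torsionBy {K : Type u} [Field K] (E : WeierstrassCurve K) (N : ℕ)
    (σ : AbsGal K) (P : NTorsion E N) :
    galPoint E σ P.1 ∈ AddSubgroup.torsionBy (GeomPoint E) (N : ℤ) := by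
  have h : (N : ℤ) • (P.1 : GeomPoint E) = 0 := P.2
  change (N : ℤ) • galPoint E σ P.1 = 0
  rw [← map_zsmul, h, map_zero]

/-- The restriction of the action of `σ` to `E[N]`, a `ℤ/Nℤ`-linear map. -/
def galTorsion {K : Type u} [Field K] (E : WeierstrassCurve K) (N : ℕ) (σ : AbsGal K) :
    NTorsion E N →ₗ[ZMod N] NTorsion E N :=
  AddMonoidHom.toZModLinearMap N
    { toFun := fun P => ⟨galPoint E σ P.1, galPoint_mem_torsionBy E N σ P⟩
      map_zero' := Subtype.ext (map_zero _)
      map_add' := fun P Q => Subtype.ext (map_add (galPoint E σ) P.1 Q.1) }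

/-- The mod `N` Galois representation `ρ̄_{E,N} : G_K → Aut(E[N])`, `σ ↦ (P ↦ σ(P))`. -/
def modRep {K : Type u} [Field K] (E : WeierstrassCurve K) (N : ℕ) :
    AbsGal K →* LinearMap.GeneralLinearGroup (ZMod N) (NTorsion E N) :=
  MonoidHom.toHomUnits
    { toFun := galTorsion E N
      map_one' := LinearMap.ext fun P => Subtype.ext (Affine.Point.map_id P.1)
      map_mul' := fun σ τ => LinearMap.ext fun P => Subtype.ext
        (Affine.Point.map_map (W' := E) (τ : AlgebraicClosure K →ₐ[K] AlgebraicClosure K)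
          (σ : AlgebraicClosure K →ₐ[K] AlgebraicClosure K) P.1).symm }

/-- The mod `N` Galois representation `ρ̄_{E,N} : G_K → GL₂(ℤ/Nℤ)` written with respect to a basis
`b` of `E[N]`: the `j`-th column of the matrix of `σ` holds the coordinates of `σ (b j)`. -/
def modRepGL {K : Type u} [Field K] (E : WeierstrassCurve K) (N : ℕ)
    (b : Module.Basis (Fin 2) (ZMod N) (NTorsion E N)) :
    AbsGal K →* Matrix.GeneralLinearGroup (Fin 2) (ZMod N) :=
  (Units.map (LinearMap.toMatrixAlgEquiv b : _ →* Matrix (Fin 2) (Fin 2) (ZMod N))).comp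
    (modRep E N)

/-- The mod `N` cyclotomic character `χ_N : G_K → (ℤ/Nℤ)ˣ`, characterised by
`σ ζ = ζ ^ χ_N(σ)` for all `N`-th roots of unity `ζ ∈ K̄`. Here `N` is a positive integer not
divisible by the characteristic of `K`, that is, `N ≠ 0` in `K`. -/
def cycloChar (K : Type u) [Field K] (N : ℕ) [NeZero (N : K)] : AbsGal K →* (ZMod N)ˣ :=
  haveI : NeZero N := .of_neZero_natCast K
  (modularCyclotomicCharacter (AlgebraicClosure K)
    (HasEnoughRootsOfUnity.natCard_rootsOfUnity (AlgebraicClosure K) N)).comp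
    (MulSemiringAction.toRingAut (AbsGal K) (AlgebraicClosure K))

/-- `τ ∈ G_K` is a complex conjugation if there are a real embedding `ιr` of `K` and an embedding
`ι` of `K̄` in `ℂ` extending it such that `τ = ι⁻¹ ∘ c ∘ ι`, with `c` the conjugation of `ℂ`. -/
def IsComplexConj {K : Type u} [Field K] (τ : AbsGal K) : Prop :=
  ∃ (ιr : K →+* ℝ) (ι : AlgebraicClosure K →+* ℂ),
    (∀ x : K, ι (algebraMap K (AlgebraicClosure K) x) = (ιr x : ℂ)) ∧
    ∀ z : AlgebraicClosure K, ι (τ z) = starRingEnd ℂ (ι z)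

/-- A representation `ρ : G_K → GL₂(ℤ/Nℤ)` is odd if `det ρ(τ) = -1` for every complex
conjugation `τ ∈ G_K`. -/
def IsOddRep {K : Type u} [Field K] {N : ℕ}
    (ρ : AbsGal K →* Matrix.GeneralLinearGroup (Fin 2) (ZMod N)) : Prop :=
  ∀ τ : AbsGal K, IsComplexConj τ → Matrix.GeneralLinearGroup.det (ρ τ) = -1

end EllGalRep

end

/-! The Weil pairing e on E[N] is bilinear, alternating, nondegenerate and Galois equivariant, with
values in the N-th roots of unity. On a basis P, Q its value has order exactly N, and σ e(P, Q) =
e(σP, σQ) = e(P, Q)^det ρ(σ), so det ρ(σ) = χ(σ). Complex conjugation inverts roots of unity, so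
χ(τ) = -1.

The pairing comes from explicit functions. Products of Miller functions (a line over a vertical)
give f_P with divisor N(P) - N(0), called `weilFun`. Comparing divisors, f_P(X) f_Q(X - P) = c(P, Q)
f_{P+Q}(X) with c(P, Q) constant (`exists_weilFun_mul`). Associativity makes c a cocycle, so e(P, Q)
= c(P, Q) / c(Q, P) is bilinear for formal reasons; it is Galois equivariant because the f_P are
given by formulas over K.

Nondegeneracy is the substantial point. Weil reciprocity for Miller functions, an identity of
polynomials (`miller_reciprocity`), makes f_P additive modulo N-th powers, so f_P ∘ [N] = g^N. If
e(P, ·) = 1, then g is invariant under translation by E[N]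
(`translation_eq_self_of_weilPairing_eq_one`). The extension of the function field given by [N] is
Galois with group E[N]: its degree is N² by the parallelogram law for the degree of x ∘ [N], and it
is separable because [N] multiplies the invariant differential by N. Hence g = h ∘ [N] and f_P =
h^N, which forces P = 0. The same extension yields #E[N] = N², and with nondegeneracy a basis of two
elements.

Divisors are fractional ideals of the affine coordinate ring, a Dedekind domain whose units are the
constants; the order at infinity need not be recorded. -/

set_option linter.unusedSectionVars false

noncomputable section

namespace EllGalRep

open WeierstrassCurve

/-! ### Miller functions and Weil reciprocity for them. -/

section Miller

variable {Ω : Type*} [Field Ω] {W : Affine Ω}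

theorem evalEval_line_eq [DecidableEq Ω] {x₁ x₂ y₁ y₂ : Ω} (h₁ : W.Equation x₁ y₁)
    (h₂ : W.Equation x₂ y₂) (hxy : ¬(x₁ = x₂ ∧ y₁ = W.negY x₂ y₂)) (t : Ω) :
    let l := W.slope x₁ x₂ y₁ y₂
    (l * (t - x₁) + y₁) ^ 2 + W.a₁ * t * (l * (t - x₁) + y₁) + W.a₃ * (l * (t - x₁) + y₁)
      - (t ^ 3 + W.a₂ * t ^ 2 + W.a₄ * t + W.a₆) =
      -((t - x₁) * (t - x₂) * (t - W.addX x₁ x₂ l)) := by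
  intro l
  have h := congrArg (Polynomial.eval t) (Affine.addPolynomial_slope h₁ h₂ hxy)
  rw [Affine.addPolynomial_eq, Cubic.toPoly] at h
  simp only [Polynomial.eval_neg, Polynomial.eval_add, Polynomial.eval_mul, Polynomial.eval_C,
    Polynomial.eval_pow, Polynomial.eval_X, Polynomial.eval_sub] at h
  linear_combination h

/-- The coefficients of the cubic cutting out the intersection of the curve with the line through
two points. -/
theorem line_vieta [DecidableEq Ω] {x₁ x₂ y₁ y₂ : Ω} (h₁ : W.Equation x₁ y₁)
    (h₂ : W.Equation x₂ y₂) (hxy : ¬(x₁ = x₂ ∧ y₁ = W.negY x₂ y₂)) {l m c : Ω}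
    (hl : l = W.slope x₁ x₂ y₁ y₂) (hm : m = y₁ - l * x₁) (hc : c = W.addX x₁ x₂ l) :
    x₁ + x₂ + c = l ^ 2 + W.a₁ * l - W.a₂ ∧
    x₁ * x₂ + x₂ * c + c * x₁ = W.a₄ - 2 * l * m - W.a₁ * m - W.a₃ * l ∧
    x₁ * x₂ * c = m ^ 2 + W.a₃ * m - W.a₆ := by
  have h := Affine.addPolynomial_slope h₁ h₂ hxy
  rw [← hl, ← hc, Affine.addPolynomial_eq, neg_inj, Cubic.prod_X_sub_C_eq] at h
  have h := (Cubic.toPoly_injective _ _).mp h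
  have hb := congrArg Cubic.b h
  have hc' := congrArg Cubic.c h
  have hd := congrArg Cubic.d h
  simp only at hb hc' hd
  subst hm
  refine ⟨?_, ?_, ?_⟩
  · linear_combination hb
  · linear_combination -hc'
  · linear_combination hd

/-- The function with divisor `(A) + (B) - (A + B) - (0)`, evaluated at `Z`. -/
def miller [DecidableEq Ω] : W.Point → W.Point → W.Point → Ω
  | .some x₁ y₁ _, .some x₂ y₂ _, .some x y _ =>
    if x₁ = x₂ ∧ y₁ = W.negY x₂ y₂ then x - x₁
    else (y - (W.slope x₁ x₂ y₁ y₂ * (x - x₁) + y₁)) / (x - W.addX x₁ x₂ (W.slope x₁ x₂ y₁ y₂))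
  -- The value 1 at Z = 0 is the leading coefficient of the function at infinity; with this
  -- normalisation reciprocity holds up to sign even when A, B or A + B is the origin.
  | _, _, _ => 1

variable [DecidableEq Ω]

@[simp] theorem miller_zero_left (B Z : W.Point) : miller 0 B Z = 1 := by
  cases B <;> cases Z <;> rfl

@[simp] theorem miller_zero_mid (A Z : W.Point) : miller A 0 Z = 1 := by
  cases A <;> cases Z <;> rfl

@[simp] theorem miller_zero_right (A B : W.Point) : miller A B 0 = 1 := by
  cases A <;> cases B <;> rfl

theorem miller_some_of_ne {x₁ y₁ x₂ y₂ x y : Ω} (h₁ : W.Nonsingular x₁ y₁)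
    (h₂ : W.Nonsingular x₂ y₂) (h : W.Nonsingular x y)
    (hxy : ¬(x₁ = x₂ ∧ y₁ = W.negY x₂ y₂)) :
    miller (.some x₁ y₁ h₁) (.some x₂ y₂ h₂) (.some x y h) =
      (y - (W.slope x₁ x₂ y₁ y₂ * (x - x₁) + y₁)) /
        (x - W.addX x₁ x₂ (W.slope x₁ x₂ y₁ y₂)) :=
  if_neg hxy

theorem miller_some_of_eq {x₁ y₁ x₂ y₂ x y : Ω} (h₁ : W.Nonsingular x₁ y₁)
    (h₂ : W.Nonsingular x₂ y₂) (h : W.Nonsingular x y)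
    (hxy : x₁ = x₂ ∧ y₁ = W.negY x₂ y₂) :
    miller (.some x₁ y₁ h₁) (.some x₂ y₂ h₂) (.some x y h) = x - x₁ :=
  if_pos hxy

/-- `A` and `B` have different `x`-coordinates, in `ℙ¹`. -/
def XNe (A B : W.Point) : Prop := A ≠ B ∧ A ≠ -B

omit [DecidableEq Ω] in
theorem XNe.x_ne {x₁ y₁ x₂ y₂ : Ω} {h₁ : W.Nonsingular x₁ y₁} {h₂ : W.Nonsingular x₂ y₂}
    (h : XNe (Affine.Point.some x₁ y₁ h₁) (.some x₂ y₂ h₂)) : x₁ ≠ x₂ := fun he =>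
  (Affine.Point.X_eq_iff.mp he).elim h.1 h.2

omit [DecidableEq Ω] in
theorem XNe.symm {A B : W.Point} (h : XNe A B) : XNe B A :=
  ⟨h.1.symm, fun he => h.2 (by rw [he, neg_neg])⟩

/-- This is the norm of the line down to functions of x. It serves to trade the value at a point for
the value at its negative. -/
theorem line_mul_line_neg {x₁ x₂ y₁ y₂ : Ω} (h₁ : W.Equation x₁ y₁)
    (h₂ : W.Equation x₂ y₂) (hxy : ¬(x₁ = x₂ ∧ y₁ = W.negY x₂ y₂)) {x y : Ω}
    (h : W.Equation x y) :
    (y - (W.slope x₁ x₂ y₁ y₂ * (x - x₁) + y₁)) *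
      (W.negY x y - (W.slope x₁ x₂ y₁ y₂ * (x - x₁) + y₁)) =
      -((x - x₁) * (x - x₂) * (x - W.addX x₁ x₂ (W.slope x₁ x₂ y₁ y₂))) := by
  have := evalEval_line_eq h₁ h₂ hxy x
  rw [← this, Affine.negY]
  linear_combination -((Affine.equation_iff _ _).mp h)

theorem miller_ne_zero {A B Z : W.Point} (hA : XNe Z A) (hB : XNe Z B) (hAB : XNe Z (A + B)) :
    miller A B Z ≠ 0 := by
  rcases A with _ | ⟨x₁, y₁, h₁⟩
  · exact (miller_zero_left B Z).trans_ne one_ne_zero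
  rcases B with _ | ⟨x₂, y₂, h₂⟩
  · exact (miller_zero_mid _ Z).trans_ne one_ne_zero
  rcases Z with _ | ⟨x, y, h⟩
  · exact (miller_zero_right _ _).trans_ne one_ne_zero
  by_cases hxy : x₁ = x₂ ∧ y₁ = W.negY x₂ y₂
  · rw [miller_some_of_eq _ _ _ hxy]
    exact sub_ne_zero.mpr hA.x_ne
  · rw [miller_some_of_ne _ _ _ hxy]
    rw [Affine.Point.add_some hxy] at hAB
    have h0 := line_mul_line_neg h₁.1 h₂.1 hxy h.1
    refine div_ne_zero (left_ne_zero_of_mul (h0.trans_ne ?_)) (sub_ne_zero.mpr hAB.x_ne)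
    exact neg_ne_zero.mpr (mul_ne_zero (mul_ne_zero (sub_ne_zero.mpr hA.x_ne)
      (sub_ne_zero.mpr hB.x_ne)) (sub_ne_zero.mpr hAB.x_ne))

/-- Weil reciprocity for two lines. -/
theorem line_reciprocity {a₁ b₁ a₂ b₂ x₁ y₁ x₂ y₂ : Ω} (hA : W.Equation a₁ b₁)
    (hB : W.Equation a₂ b₂) (hAB : ¬(a₁ = a₂ ∧ b₁ = W.negY a₂ b₂)) (hX : W.Equation x₁ y₁)
    (hY : W.Equation x₂ y₂) (hXY : ¬(x₁ = x₂ ∧ y₁ = W.negY x₂ y₂)) {l m : Ω}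
    (hl : l = W.slope a₁ a₂ b₁ b₂) (hm : m = W.slope x₁ x₂ y₁ y₂) :
    let f := fun t : Ω => (m * (t - x₁) + y₁) - (l * (t - a₁) + b₁)
    f x₁ * f x₂ * f (W.addX x₁ x₂ m) = f a₁ * f a₂ * f (W.addX a₁ a₂ l) := by
  intro f
  obtain ⟨p1, p2, p3⟩ := line_vieta hA hB hAB hl rfl rfl
  obtain ⟨q1, q2, q3⟩ := line_vieta hX hY hXY hm rfl rfl
  generalize W.addX a₁ a₂ l = a₃ at *
  generalize W.addX x₁ x₂ m = x₃ at *
  simp only [f]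
  generalize hn : y₁ - m * x₁ = n at *
  generalize hk : b₁ - l * a₁ = k at *
  obtain rfl : y₁ = n + m * x₁ := by rw [← hn]; ring
  obtain rfl : b₁ = k + l * a₁ := by rw [← hk]; ring
  -- If the lines meet above t₀, each side is -(m - l) ^ 3 times one of the two cubics at t₀, and
  -- both cubics equal there minus the Weierstrass polynomial at the common point. Expanded by
  -- Vieta, the argument also covers parallel lines.
  linear_combination (m - l) ^ 3 * (q3 - p3) + (m - l) ^ 2 * (n - k) * (q2 - p2) +
    (m - l) * (n - k) ^ 2 * (q1 - p1)

theorem line_right {x₁ x₂ y₁ y₂ : Ω} (h₁ : W.Equation x₁ y₁)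
    (h₂ : W.Equation x₂ y₂) (hxy : ¬(x₁ = x₂ ∧ y₁ = W.negY x₂ y₂)) :
    W.slope x₁ x₂ y₁ y₂ * (x₂ - x₁) + y₁ = y₂ := by
  by_cases hx : x₁ = x₂
  · have hy := Affine.Y_eq_of_Y_ne h₁ h₂ hx fun h => hxy ⟨hx, h⟩
    rw [hx, hy, sub_self, mul_zero, zero_add]
  · rw [Affine.slope_of_X_ne hx]
    have := sub_ne_zero.mpr hx
    field_simp
    ring

/-- Weil reciprocity f(div g) = g(div f), for f with divisor (A) + (B) - (A + B) - (0) and g with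
divisor (X) + (Y) - (X + Y) - (0). Both divisors involve the origin, and the local contribution
there is the sign ε. -/
theorem miller_reciprocity {A B X Y : W.Point} (hX : X ≠ 0) (hY : Y ≠ 0) (hXY : X + Y ≠ 0)
    (hXA : XNe X A) (hXB : XNe X B) (hXAB : XNe X (A + B))
    (hYA : XNe Y A) (hYB : XNe Y B) (hYAB : XNe Y (A + B))
    (hZA : XNe (X + Y) A) (hZB : XNe (X + Y) B) (hZAB : XNe (X + Y) (A + B)) :
    ∃ ε : Ω, ε ^ 2 = 1 ∧ miller A B (X + Y) * miller X Y A * miller X Y B =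
      ε * (miller A B X * miller A B Y * miller X Y (A + B)) := by
  rcases A with _ | ⟨a₁, b₁, hA⟩
  · refine ⟨1, one_pow 2, ?_⟩
    change miller 0 B _ * miller X Y 0 * _ = 1 * (miller 0 B _ * miller 0 B _ * miller X Y (0 + B))
    simp
  rcases B with _ | ⟨a₂, b₂, hB⟩
  · refine ⟨1, one_pow 2, ?_⟩
    change miller _ 0 _ * _ * miller X Y 0 = 1 * (miller _ 0 _ * miller _ 0 _ * miller X Y (_ + 0))
    simp
  rcases X with _ | ⟨x₁, y₁, h₁⟩
  · exact absurd rfl hX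
  rcases Y with _ | ⟨x₂, y₂, h₂⟩
  · exact absurd rfl hY
  have hxy : ¬(x₁ = x₂ ∧ y₁ = W.negY x₂ y₂) := fun h => hXY (Affine.Point.add_of_Y_eq h.1 h.2)
  rw [Affine.Point.add_some hxy] at hZA hZB hZAB ⊢
  have e1 := line_mul_line_neg h₁.1 h₂.1 hxy hA.1
  have n1 := sub_ne_zero.mpr hZA.x_ne
  have n2 := sub_ne_zero.mpr hZB.x_ne
  have m1 := sub_ne_zero.mpr hXA.x_ne
  have m2 := sub_ne_zero.mpr hYA.x_ne
  by_cases hab : a₁ = a₂ ∧ b₁ = W.negY a₂ b₂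
  · refine ⟨1, one_pow 2, ?_⟩
    rw [Affine.Point.add_of_Y_eq hab.1 hab.2, miller_zero_right, miller_some_of_eq _ _ _ hab,
      miller_some_of_eq _ _ _ hab, miller_some_of_eq _ _ _ hab, miller_some_of_ne _ _ _ hxy,
      miller_some_of_ne _ _ _ hxy]
    obtain ⟨rfl, hb⟩ := hab
    have hb' : b₂ = W.negY a₁ b₁ := by rw [hb, Affine.negY_negY]
    rw [← hb'] at e1
    clear hZA hZB hZAB
    generalize W.addX x₁ x₂ (W.slope x₁ x₂ y₁ y₂) = x₃ at *
    have n1' : a₁ - x₃ ≠ 0 := by rw [← neg_ne_zero, neg_sub]; exact n1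
    field_simp
    linear_combination (x₃ - a₁) * e1
  · refine ⟨-1, by ring, ?_⟩
    rw [Affine.Point.add_some hab] at hXAB hYAB hZAB ⊢
    have n3 := sub_ne_zero.mpr hZAB.x_ne
    have m3 := sub_ne_zero.mpr hXAB.x_ne
    have m4 := sub_ne_zero.mpr hYAB.x_ne
    -- The identity `r` involves the third intersection points -(X + Y) and -(A + B), the Miller
    -- values involve X + Y and A + B; `e3` and `e4` pass from one to the other.
    have r := line_reciprocity hA.1 hB.1 hab h₁.1 h₂.1 hxy rfl rfl
    have e3 := line_mul_line_neg hA.1 hB.1 hab (Affine.nonsingular_add h₁ h₂ hxy).1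
    have e4 := line_mul_line_neg h₁.1 h₂.1 hxy (Affine.nonsingular_add hA hB hab).1
    rw [miller_some_of_ne _ _ _ hab, miller_some_of_ne _ _ _ hab, miller_some_of_ne _ _ _ hab,
      miller_some_of_ne _ _ _ hxy, miller_some_of_ne _ _ _ hxy, miller_some_of_ne _ _ _ hxy]
    have hB' := line_right hA.1 hB.1 hab
    have hY' := line_right h₁.1 h₂.1 hxy
    have f3 : W.negY (W.addX x₁ x₂ (W.slope x₁ x₂ y₁ y₂))
        (W.addY x₁ x₂ y₁ (W.slope x₁ x₂ y₁ y₂)) = W.slope x₁ x₂ y₁ y₂ *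
          (W.addX x₁ x₂ (W.slope x₁ x₂ y₁ y₂) - x₁) + y₁ := by
      rw [Affine.addY, Affine.negY_negY, Affine.negAddY]
    have f4 : W.negY (W.addX a₁ a₂ (W.slope a₁ a₂ b₁ b₂))
        (W.addY a₁ a₂ b₁ (W.slope a₁ a₂ b₁ b₂)) = W.slope a₁ a₂ b₁ b₂ *
          (W.addX a₁ a₂ (W.slope a₁ a₂ b₁ b₂) - a₁) + b₁ := by
      rw [Affine.addY, Affine.negY_negY, Affine.negAddY]
    rw [f3] at e3
    rw [f4] at e4
    simp only [sub_self, mul_zero, zero_add] at r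
    rw [hB', hY'] at r
    clear hZA hZB hZAB hXAB hYAB
    generalize W.addY x₁ x₂ y₁ (W.slope x₁ x₂ y₁ y₂) = y₃ at *
    generalize W.addY a₁ a₂ b₁ (W.slope a₁ a₂ b₁ b₂) = b₃ at *
    generalize W.addX x₁ x₂ (W.slope x₁ x₂ y₁ y₂) = x₃ at *
    generalize W.addX a₁ a₂ (W.slope a₁ a₂ b₁ b₂) = a₃ at *
    generalize W.slope x₁ x₂ y₁ y₂ = m at *
    generalize W.slope a₁ a₂ b₁ b₂ = l at *
    generalize hu : m * (x₃ - x₁) + y₁ - (l * (x₃ - a₁) + b₁) = u at *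
    generalize hv : m * (a₃ - x₁) + y₁ - (l * (a₃ - a₁) + b₁) = v at *
    have hv' : l * (a₃ - a₁) + b₁ - (m * (a₃ - x₁) + y₁) = -v := by rw [← hv]; ring
    have hq1 : m * (a₁ - x₁) + y₁ - b₁ = -(b₁ - (m * (a₁ - x₁) + y₁)) := by ring
    have hq2 : m * (a₂ - x₁) + y₁ - b₂ = -(b₂ - (m * (a₂ - x₁) + y₁)) := by ring
    rw [hv'] at e4
    rw [hq1, hq2] at r
    generalize y₃ - (l * (x₃ - a₁) + b₁) = p at *
    generalize b₃ - (m * (a₃ - x₁) + y₁) = q at *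
    generalize y₁ - (l * (x₁ - a₁) + b₁) = p₁ at *
    generalize y₂ - (l * (x₂ - a₁) + b₁) = p₂ at *
    generalize b₁ - (m * (a₁ - x₁) + y₁) = q₁ at *
    generalize b₂ - (m * (a₂ - x₁) + y₁) = q₂ at *
    have n1' : a₁ - x₃ ≠ 0 := by rw [← neg_ne_zero, neg_sub]; exact n1
    have n2' : a₂ - x₃ ≠ 0 := by rw [← neg_ne_zero, neg_sub]; exact n2
    have n3' : a₃ - x₃ ≠ 0 := by rw [← neg_ne_zero, neg_sub]; exact n3
    have m3' : a₃ - x₁ ≠ 0 := by rw [← neg_ne_zero, neg_sub]; exact m3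
    have m4' : a₃ - x₂ ≠ 0 := by rw [← neg_ne_zero, neg_sub]; exact m4
    have hu0 : u ≠ 0 := right_ne_zero_of_mul (e3.trans_ne
      (neg_ne_zero.mpr (mul_ne_zero (mul_ne_zero n1 n2) n3)))
    have hv0 : -v ≠ 0 := right_ne_zero_of_mul (e4.trans_ne
      (neg_ne_zero.mpr (mul_ne_zero (mul_ne_zero m3' m4') n3')))
    have hv0 : v ≠ 0 := neg_ne_zero.mp hv0
    rw [div_mul_div_comm, div_mul_div_comm, div_mul_div_comm, div_mul_div_comm, neg_one_mul,
      ← neg_div, div_eq_div_iff (mul_ne_zero (mul_ne_zero n3 n1') n2')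
        (mul_ne_zero (mul_ne_zero m3 m4) n3')]
    refine mul_left_cancel₀ (mul_ne_zero hu0 hv0) ?_
    linear_combination (v * q₁ * q₂ * ((x₁ - a₃) * (x₂ - a₃) * (a₃ - x₃))) * e3 -
      (u * p₁ * p₂ * ((x₃ - a₃) * (a₁ - x₃) * (a₂ - x₃))) * e4 +
      ((x₃ - a₁) * (x₃ - a₂) * (x₃ - a₃) * (a₃ - x₁) * (a₃ - x₂) * (a₃ - x₃)) * r

/-- Up to sign, `miller` is symmetric in its first two arguments and the negative of the third. -/
theorem miller_comm_third {A X Y : W.Point} (hX : X ≠ 0) (hY : Y ≠ 0) (hXY : XNe X Y)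
    (hXA : XNe X A) (hYA : XNe Y A) (hZA : XNe (X + Y) A) (hZX : XNe X (A - Y)) :
    ∃ ε : Ω, ε ^ 2 = 1 ∧ miller X Y A = ε * miller A (-Y) X := by
  rcases A with _ | ⟨a, b, hA⟩
  · refine ⟨1, one_pow 2, ?_⟩
    change miller X Y 0 = 1 * miller 0 _ X
    simp
  rcases X with _ | ⟨x₁, y₁, h₁⟩
  · exact absurd rfl hX
  rcases Y with _ | ⟨x₂, y₂, h₂⟩
  · exact absurd rfl hY
  have hx := hXY.x_ne
  have hax := hYA.symm.x_ne
  have hxy : ¬(x₁ = x₂ ∧ y₁ = W.negY x₂ y₂) := fun h => hx h.1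
  have hay : ¬(a = x₂ ∧ b = W.negY x₂ (W.negY x₂ y₂)) := fun h => hax h.1
  have hY' := (Affine.nonsingular_neg (W' := W) x₂ y₂).mpr h₂
  rw [sub_eq_add_neg, Affine.Point.neg_some, Affine.Point.add_some hay] at hZX
  rw [Affine.Point.add_some hxy] at hZA
  have e1 := line_mul_line_neg h₁.1 h₂.1 hxy hA.1
  have e2 := line_mul_line_neg hA.1 hY'.1 hay h₁.1
  rw [Affine.Point.neg_some, miller_some_of_ne _ _ _ hxy, miller_some_of_ne _ _ _ hay]
  have n1 := sub_ne_zero.mpr hZA.symm.x_ne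
  have n2 := sub_ne_zero.mpr hZX.x_ne
  have hax₁ := sub_ne_zero.mpr hXA.x_ne
  -- Both sides are the collinearity determinant of X, Y, -A, the second one computed from the
  -- negated points.
  have h0 : (x₁ - x₂) * (W.negY a b - (W.slope x₁ x₂ y₁ y₂ * (a - x₁) + y₁)) =
      (a - x₂) * (W.negY x₁ y₁ - (W.slope a x₂ b (W.negY x₂ y₂) * (x₁ - a) + b)) := by
    rw [Affine.slope_of_X_ne hx, Affine.slope_of_X_ne hax, Affine.negY, Affine.negY, Affine.negY]
    have := sub_ne_zero.mpr hx
    have := sub_ne_zero.mpr hax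
    field_simp
    ring
  clear hZX hZA
  have hx := sub_ne_zero.mpr hx
  have hax := sub_ne_zero.mpr hax
  generalize W.addX x₁ x₂ (W.slope x₁ x₂ y₁ y₂) = x₃ at *
  generalize W.addX a x₂ (W.slope a x₂ b (W.negY x₂ y₂)) = a₃ at *
  generalize W.negY a b - (W.slope x₁ x₂ y₁ y₂ * (a - x₁) + y₁) = q at *
  generalize W.negY x₁ y₁ - (W.slope a x₂ b (W.negY x₂ y₂) * (x₁ - a) + b) = p at *
  generalize b - (W.slope x₁ x₂ y₁ y₂ * (a - x₁) + y₁) = q' at *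
  generalize y₁ - (W.slope a x₂ b (W.negY x₂ y₂) * (x₁ - a) + b) = p' at *
  have hp : p ≠ 0 := right_ne_zero_of_mul (e2.trans_ne
    (neg_ne_zero.mpr (mul_ne_zero (mul_ne_zero hax₁ hx) n2)))
  refine ⟨-1, by ring, ?_⟩
  rw [neg_one_mul, ← neg_div, div_eq_div_iff n1 n2]
  refine mul_left_cancel₀ (mul_ne_zero hp hax) ?_
  linear_combination (-q' * (x₁ - a₃)) * h0 + ((x₁ - x₂) * (x₁ - a₃)) * e1 +
    ((a - x₃) * (a - x₂)) * e2

end Miller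

/-- Miller functions are rational formulas in the coefficients of the curve. Constants,
translations, pullbacks under [n] and Galois conjugations all enter through this compatibility. -/
theorem miller_map {K S F L : Type*} [Field K] [Field S] [Field F] [Field L] [Algebra K S]
    [Algebra K F] [Algebra K L] [Algebra S F] [Algebra S L] [IsScalarTower K S F]
    [IsScalarTower K S L] [DecidableEq F] [DecidableEq L] {E : WeierstrassCurve K} (f : F →ₐ[S] L)
    (A B Z : (E.baseChange F).toAffine.Point) :
    miller (Affine.Point.map (W' := E) f A) (Affine.Point.map (W' := E) f B)
      (Affine.Point.map (W' := E) f Z) = f (miller A B Z) := by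
  rcases A with _ | ⟨x₁, y₁, h₁⟩
  · exact (miller_zero_left _ _).trans (map_one f).symm
  rcases B with _ | ⟨x₂, y₂, h₂⟩
  · exact (miller_zero_mid _ _).trans (map_one f).symm
  rcases Z with _ | ⟨x, y, h⟩
  · exact (miller_zero_right _ _).trans (map_one f).symm
  by_cases hxy : x₁ = x₂ ∧ y₁ = (E.baseChange F).toAffine.negY x₂ y₂
  · rw [miller_some_of_eq _ _ _ hxy]
    refine (miller_some_of_eq _ _ _ ⟨congrArg f hxy.1, ?_⟩).trans (map_sub f _ _).symm
    rw [Affine.baseChange_negY, hxy.2]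
  · rw [miller_some_of_ne _ _ _ hxy]
    refine (miller_some_of_ne _ _ _ fun h' => hxy ⟨f.injective h'.1, f.injective ?_⟩).trans ?_
    · exact h'.2.trans (Affine.baseChange_negY f x₂ y₂)
    · simp only [AlgHom.toRingHom_eq_coe, RingHom.coe_coe]
      rw [Affine.baseChange_slope, Affine.baseChange_addX]
      simp only [map_div₀, map_sub, map_add, map_mul]

/-! ### Additivity of the invariant differential. -/

section LogDerivative

variable {Ω : Type*} [Field Ω] {W : Affine Ω} (D : Derivation ℤ Ω Ω)

/-- `t` is the value of the derivation `D` on the invariant differential at the point `A`. -/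
def LogDeriv : W.Point → Ω → Prop
  | .zero, t => t = 0
  | .some x y _, t => D x = t * (2 * y + W.a₁ * x + W.a₃) ∧
      D y = t * (3 * x ^ 2 + 2 * W.a₂ * x + W.a₄ - W.a₁ * y)

variable {D}

theorem LogDeriv.unique {A : W.Point} {s t : Ω} (hs : LogDeriv D A s) (ht : LogDeriv D A t) :
    s = t := by
  rcases A with _ | ⟨x, y, h⟩
  · exact Eq.trans hs (Eq.symm ht)
  · obtain ⟨s1, s2⟩ := hs
    obtain ⟨t1, t2⟩ := ht
    rcases ((Affine.nonsingular_iff' _ _).mp h).2 with hx | hy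
    · refine mul_right_cancel₀ hx ?_
      linear_combination s2 - t2
    · refine mul_right_cancel₀ hy ?_
      linear_combination t1 - s1

variable (h₁ : D W.a₁ = 0) (h₂ : D W.a₂ = 0) (h₃ : D W.a₃ = 0) (h₄ : D W.a₄ = 0)
  (h₆ : D W.a₆ = 0)

include h₁ h₃ in
theorem LogDeriv.neg {A : W.Point} {t : Ω} (ht : LogDeriv D A t) : LogDeriv D (-A) (-t) := by
  rcases A with _ | ⟨x, y, h⟩
  · exact neg_eq_zero.mpr ht
  · obtain ⟨t1, t2⟩ := ht
    refine ⟨?_, ?_⟩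
    · rw [t1, Affine.negY]
      ring
    · simp only [Affine.negY, map_sub, map_neg, Derivation.leibniz, smul_eq_mul, h₁, h₃]
      rw [t1, t2]
      ring

include h₁ h₂ h₃ h₄ h₆ in
-- Differentiating the Weierstrass equation shows that the two quotients defining the invariant
-- differential agree, and nonsingularity makes one of the denominators nonzero.
theorem exists_logDeriv (A : W.Point) : ∃ t, LogDeriv D A t := by
  rcases A with _ | ⟨x, y, h⟩
  · exact ⟨0, rfl⟩
  · have he : D x * (3 * x ^ 2 + 2 * W.a₂ * x + W.a₄ - W.a₁ * y) =
        D y * (2 * y + W.a₁ * x + W.a₃) := by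
      have := congrArg D ((Affine.equation_iff _ _).mp h.1)
      simp only [map_add, Derivation.leibniz, Derivation.leibniz_pow, smul_eq_mul, h₁, h₂, h₃, h₄,
        h₆, nsmul_eq_mul] at this
      push_cast at this
      linear_combination -this
    rcases ((Affine.nonsingular_iff' _ _).mp h).2 with hx | hy
    · have hx' : 3 * x ^ 2 + 2 * W.a₂ * x + W.a₄ - W.a₁ * y ≠ 0 := by
        rw [← neg_ne_zero, neg_sub]; exact hx
      exact ⟨D y / (3 * x ^ 2 + 2 * W.a₂ * x + W.a₄ - W.a₁ * y),
        by rw [div_mul_eq_mul_div, eq_div_iff hx', he], by rw [div_mul_cancel₀ _ hx']⟩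
    · exact ⟨D x / (2 * y + W.a₁ * x + W.a₃), by rw [div_mul_cancel₀ _ hy],
        by rw [div_mul_eq_mul_div, eq_div_iff hy, he]⟩

include h₁ h₂ h₃ h₄ in
-- Differentiating the relation that defines the slope gives the same expression for tangents and
-- chords, so `LogDeriv.add` need not separate them.
theorem derivation_slope [DecidableEq Ω] {x₁ x₂ y₁ y₂ : Ω} {A : W.Nonsingular x₁ y₁}
    {B : W.Nonsingular x₂ y₂} (hxy : ¬(x₁ = x₂ ∧ y₁ = W.negY x₂ y₂)) {s t : Ω}
    (hs : LogDeriv D (.some x₁ y₁ A) s) (ht : LogDeriv D (.some x₂ y₂ B) t) :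
    D (W.slope x₁ x₂ y₁ y₂) = s * (x₁ - W.addX x₁ x₂ (W.slope x₁ x₂ y₁ y₂)) +
      t * (x₂ - W.addX x₁ x₂ (W.slope x₁ x₂ y₁ y₂)) := by
  by_cases hx : x₁ = x₂
  · subst hx
    obtain rfl := Affine.Y_eq_of_Y_ne A.1 B.1 rfl fun h => hxy ⟨rfl, h⟩
    obtain rfl := hs.unique ht
    have hy : y₁ ≠ W.negY x₁ y₁ := fun h => hxy ⟨rfl, h⟩
    have hy' := sub_ne_zero.mpr hy
    have hl : W.slope x₁ x₁ y₁ y₁ * (y₁ - W.negY x₁ y₁) =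
        3 * x₁ ^ 2 + 2 * W.a₂ * x₁ + W.a₄ - W.a₁ * y₁ := by
      rw [Affine.slope_of_Y_ne rfl hy, div_mul_cancel₀ _ hy']
    have hD := congrArg D hl
    obtain ⟨s1, s2⟩ := hs
    simp only [Affine.negY, map_add, map_sub, map_neg, Derivation.leibniz, Derivation.leibniz_pow,
      smul_eq_mul, nsmul_eq_mul, h₁, h₂, h₃, h₄, s1, s2, Affine.addX] at hD hl hy' ⊢
    have d2 : D (2 : Ω) = 0 := by simpa using D.map_natCast 2
    have d3 : D (3 : Ω) = 0 := by simpa using D.map_natCast 3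
    rw [d2, d3] at hD
    push_cast at hD
    refine mul_right_cancel₀ hy' ?_
    generalize W.slope x₁ x₁ y₁ y₁ = l at *
    linear_combination hD + (2 * l * s + W.a₁ * s) * hl
  · have hx' := sub_ne_zero.mpr hx
    have hl : W.slope x₁ x₂ y₁ y₂ * (x₁ - x₂) = y₁ - y₂ := by
      rw [Affine.slope_of_X_ne hx, div_mul_cancel₀ _ hx']
    obtain ⟨p1, p2, p3⟩ := line_vieta A.1 B.1 hxy rfl rfl rfl
    have hD := congrArg D hl
    obtain ⟨s1, s2⟩ := hs
    obtain ⟨t1, t2⟩ := ht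
    simp only [map_sub, Derivation.leibniz, smul_eq_mul, s1, s2, t1, t2] at hD
    refine mul_right_cancel₀ hx' ?_
    generalize W.addX x₁ x₂ (W.slope x₁ x₂ y₁ y₂) = x₃ at *
    generalize W.slope x₁ x₂ y₁ y₂ = l at *
    obtain rfl : y₂ = y₁ - l * (x₁ - x₂) := by rw [hl]; ring
    linear_combination hD + (2 * x₁ * s - 2 * x₂ * t) * p1 + (t - s) * p2

include h₁ h₂ h₃ h₄ in
/-- The invariant differential is additive. -/
theorem LogDeriv.add [DecidableEq Ω] {A B : W.Point} {s t : Ω} (hs : LogDeriv D A s)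
    (ht : LogDeriv D B t) : LogDeriv D (A + B) (s + t) := by
  rcases A with _ | ⟨x₁, y₁, A⟩
  · obtain rfl : s = 0 := hs
    rw [zero_add]
    exact ht
  rcases B with _ | ⟨x₂, y₂, B⟩
  · obtain rfl : t = 0 := ht
    rw [add_zero]
    exact hs
  by_cases hxy : x₁ = x₂ ∧ y₁ = W.negY x₂ y₂
  · rw [Affine.Point.add_of_Y_eq hxy.1 hxy.2]
    obtain ⟨rfl, rfl⟩ := hxy
    exact (hs.unique (ht.neg h₁ h₃)).symm ▸ neg_add_cancel t
  · have hD := derivation_slope h₁ h₂ h₃ h₄ hxy hs ht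
    obtain ⟨p1, p2, p3⟩ := line_vieta A.1 B.1 hxy rfl rfl rfl
    -- The third intersection point -(A + B) lies on the line itself, so its coordinates are easier
    -- to differentiate.
    have key : LogDeriv D (-(.some x₁ y₁ A + .some x₂ y₂ B)) (-(s + t)) := by
      rw [Affine.Point.add_some hxy, Affine.Point.neg_some]
      obtain ⟨s1, s2⟩ := hs
      obtain ⟨t1, t2⟩ := ht
      have hr := line_right A.1 B.1 hxy
      have hc : D (W.addX x₁ x₂ (W.slope x₁ x₂ y₁ y₂)) = -(s + t) *
          (2 * W.negAddY x₁ x₂ y₁ (W.slope x₁ x₂ y₁ y₂) +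
            W.a₁ * W.addX x₁ x₂ (W.slope x₁ x₂ y₁ y₂) + W.a₃) := by
        have : D (W.addX x₁ x₂ (W.slope x₁ x₂ y₁ y₂)) = (2 * W.slope x₁ x₂ y₁ y₂ + W.a₁) *
            D (W.slope x₁ x₂ y₁ y₂) - D x₁ - D x₂ := by
          simp only [Affine.addX, map_sub, map_add, Derivation.leibniz, Derivation.leibniz_pow,
            smul_eq_mul, nsmul_eq_mul, h₁, h₂]
          push_cast
          ring
        rw [this, hD, s1, t1, Affine.negAddY]
        generalize W.addX x₁ x₂ (W.slope x₁ x₂ y₁ y₂) = x₃ at *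
        generalize W.slope x₁ x₂ y₁ y₂ = l at *
        subst hr
        ring
      simp only [Affine.addY, Affine.negY_negY]
      refine ⟨hc, ?_⟩
      have : D (W.negAddY x₁ x₂ y₁ (W.slope x₁ x₂ y₁ y₂)) = D (W.slope x₁ x₂ y₁ y₂) *
          (W.addX x₁ x₂ (W.slope x₁ x₂ y₁ y₂) - x₁) + W.slope x₁ x₂ y₁ y₂ *
          (D (W.addX x₁ x₂ (W.slope x₁ x₂ y₁ y₂)) - D x₁) + D y₁ := by
        simp only [Affine.negAddY, map_sub, map_add, Derivation.leibniz, smul_eq_mul]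
        ring
      rw [this, hD, hc, s1, s2, Affine.negAddY]
      generalize W.addX x₁ x₂ (W.slope x₁ x₂ y₁ y₂) = x₃ at *
      generalize W.slope x₁ x₂ y₁ y₂ = l at *
      subst hr
      linear_combination (2 * x₁ * s + 2 * x₃ * (s + t)) * p1 - (2 * s + t) * p2
    have := key.neg h₁ h₃
    rwa [neg_neg, neg_neg] at this

include h₁ h₂ h₃ h₄ in
-- The form [n]^*ω = nω of additivity, from which separability of [n] will follow.
theorem LogDeriv.nsmul [DecidableEq Ω] {A : W.Point} {t : Ω} (ht : LogDeriv D A t) (n : ℕ) :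
    LogDeriv D (n • A) (n * t) := by
  induction n with
  | zero => rw [zero_smul, Nat.cast_zero, zero_mul]; rfl
  | succ n ih =>
    rw [succ_nsmul, Nat.cast_succ, add_mul, one_mul]
    exact ih.add h₁ h₂ h₃ h₄ ht

end LogDerivative

/-! ### The degree n² of the x-coordinate of a multiple of a generic point. -/

section Degree

open Polynomial

/-- The symmetric functions of x(P + Q) and x(P - Q) do not change when P or Q is negated, hence are
rational in x(P) and x(Q); degrees can thus be computed without y. -/
theorem exists_add_sub_some {Ω : Type*} [Field Ω] [DecidableEq Ω] {W : Affine Ω}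
    {x₁ y₁ x₂ y₂ : Ω} (h₁ : W.Nonsingular x₁ y₁) (h₂ : W.Nonsingular x₂ y₂) (hx : x₁ ≠ x₂) :
    ∃ (u v : Ω) (y : Ω) (h : W.Nonsingular u y) (z : Ω) (h' : W.Nonsingular v z),
      Affine.Point.some x₁ y₁ h₁ + .some x₂ y₂ h₂ = .some u y h ∧
      Affine.Point.some x₁ y₁ h₁ - .some x₂ y₂ h₂ = .some v z h' ∧
      (x₁ - x₂) ^ 2 * (u + v) = 2 * (x₁ * x₂) * (x₁ + x₂) + W.b₂ * (x₁ * x₂) +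
        W.b₄ * (x₁ + x₂) + W.b₆ ∧
      (x₁ - x₂) ^ 2 * (u * v) = (x₁ * x₂) ^ 2 - W.b₄ * (x₁ * x₂) - W.b₆ * (x₁ + x₂) - W.b₈ := by
  have hxy : ¬(x₁ = x₂ ∧ y₁ = W.negY x₂ y₂) := fun h => hx h.1
  have hxy' : ¬(x₁ = x₂ ∧ y₁ = W.negY x₂ (W.negY x₂ y₂)) := fun h => hx h.1
  have h₂' := (Affine.nonsingular_neg (W' := W) x₂ y₂).mpr h₂
  refine ⟨_, _, _, Affine.nonsingular_add h₁ h₂ hxy, _, Affine.nonsingular_add h₁ h₂' hxy',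
    Affine.Point.add_some hxy, ?_, ?_⟩
  · rw [sub_eq_add_neg, Affine.Point.neg_some, Affine.Point.add_some hxy']
  have hd := sub_ne_zero.mpr hx
  have e₁ := (Affine.equation_iff _ _).mp h₁.1
  have e₂ := (Affine.equation_iff _ _).mp h₂.1
  simp only [Affine.addX, Affine.slope_of_X_ne hx, Affine.negY, b₂, b₄, b₆, b₈]
  generalize hu : (y₁ - y₂) / (x₁ - x₂) = l
  generalize hv : (y₁ - (-y₂ - W.a₁ * x₂ - W.a₃)) / (x₁ - x₂) = m
  have hu' : l * (x₁ - x₂) = y₁ - y₂ := by rw [← hu, div_mul_cancel₀ _ hd]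
  have hv' : m * (x₁ - x₂) = y₁ + y₂ + W.a₁ * x₂ + W.a₃ := by
    rw [← hv, div_mul_cancel₀ _ hd]; ring
  have hg : l * m * (x₁ - x₂) = x₁ ^ 2 + x₁ * x₂ + x₂ ^ 2 + W.a₂ * (x₁ + x₂) + W.a₄ -
      W.a₁ * y₁ := by
    refine mul_right_cancel₀ hd ?_
    linear_combination (m * (x₁ - x₂)) * hu' + (y₁ - y₂) * hv' + e₁ - e₂
  have hs : (l + m) * (x₁ - x₂) = 2 * y₁ + W.a₁ * x₂ + W.a₃ := by
    linear_combination hu' + hv'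
  generalize hp : l * m = p at *
  generalize hq : l + m = q at *
  constructor
  · have : (l ^ 2 + W.a₁ * l - W.a₂ - x₁ - x₂ + (m ^ 2 + W.a₁ * m - W.a₂ - x₁ - x₂)) =
        q ^ 2 - 2 * p + W.a₁ * q - 2 * (W.a₂ + x₁ + x₂) := by rw [← hp, ← hq]; ring
    rw [this]
    linear_combination (q * (x₁ - x₂) + 2 * y₁ + W.a₁ * x₂ + W.a₃ + W.a₁ * (x₁ - x₂)) * hs -
      2 * (x₁ - x₂) * hg + 4 * e₁
  · have : ((l ^ 2 + W.a₁ * l - W.a₂ - x₁ - x₂) * (m ^ 2 + W.a₁ * m - W.a₂ - x₁ - x₂)) =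
        p ^ 2 + W.a₁ * p * q - (W.a₂ + x₁ + x₂) * (q ^ 2 - 2 * p) + W.a₁ ^ 2 * p -
          W.a₁ * (W.a₂ + x₁ + x₂) * q + (W.a₂ + x₁ + x₂) ^ 2 := by rw [← hp, ← hq]; ring
    rw [this]
    generalize hG : x₁ ^ 2 + x₁ * x₂ + x₂ ^ 2 + W.a₂ * (x₁ + x₂) + W.a₄ - W.a₁ * y₁ = G at *
    generalize hw : 2 * y₁ + W.a₁ * x₂ + W.a₃ = w at *
    have k : (x₁ - x₂) ^ 2 * (p ^ 2 + W.a₁ * p * q - (W.a₂ + x₁ + x₂) * (q ^ 2 - 2 * p) +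
        W.a₁ ^ 2 * p - W.a₁ * (W.a₂ + x₁ + x₂) * q + (W.a₂ + x₁ + x₂) ^ 2) =
        G ^ 2 + W.a₁ * G * w - (W.a₂ + x₁ + x₂) * (w ^ 2 - 2 * (x₁ - x₂) * G) +
        W.a₁ ^ 2 * G * (x₁ - x₂) - W.a₁ * (W.a₂ + x₁ + x₂) * (x₁ - x₂) * w +
        (W.a₂ + x₁ + x₂) ^ 2 * (x₁ - x₂) ^ 2 := by
      rw [← hg, ← hs]; ring
    rw [k, ← hG, ← hw]
    linear_combination (-W.a₁ ^ 2 - 4 * (W.a₂ + x₁ + x₂)) * e₁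

theorem exists_add_self_some {Ω : Type*} [Field Ω] [DecidableEq Ω] {W : Affine Ω}
    {x y : Ω} (h : W.Nonsingular x y)
    (hx : 4 * x ^ 3 + W.b₂ * x ^ 2 + 2 * W.b₄ * x + W.b₆ ≠ 0) :
    ∃ (u z : Ω) (h' : W.Nonsingular u z),
      Affine.Point.some x y h + .some x y h = .some u z h' ∧
      u * (4 * x ^ 3 + W.b₂ * x ^ 2 + 2 * W.b₄ * x + W.b₆) =
        x ^ 4 - W.b₄ * x ^ 2 - 2 * W.b₆ * x - W.b₈ := by
  have e := (Affine.equation_iff _ _).mp h.1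
  have hsq : 4 * x ^ 3 + W.b₂ * x ^ 2 + 2 * W.b₄ * x + W.b₆ = (y - W.negY x y) ^ 2 := by
    simp only [Affine.negY, b₂, b₄, b₆]
    linear_combination -4 * e
  have hy : y ≠ W.negY x y := fun h0 => hx (by rw [hsq, ← h0, sub_self, zero_pow two_ne_zero])
  have hxy : ¬(x = x ∧ y = W.negY x y) := fun h => hy h.2
  refine ⟨_, _, Affine.nonsingular_add h h hxy, Affine.Point.add_some hxy, ?_⟩
  have hy' := sub_ne_zero.mpr hy
  have hl : W.slope x x y y * (y - W.negY x y) =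
      3 * x ^ 2 + 2 * W.a₂ * x + W.a₄ - W.a₁ * y := by
    rw [Affine.slope_of_Y_ne rfl hy, div_mul_cancel₀ _ hy']
  rw [hsq]
  simp only [Affine.addX, b₄, b₆, b₈]
  generalize W.slope x x y y = l at *
  simp only [Affine.negY] at *
  linear_combination (l * (y - (-y - W.a₁ * x - W.a₃)) +
    (3 * x ^ 2 + 2 * W.a₂ * x + W.a₄ - W.a₁ * y) + W.a₁ * (y - (-y - W.a₁ * x - W.a₃))) * hl +
    (-W.a₁ ^ 2 - 4 * (W.a₂ + 2 * x)) * e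

/-- The supremum of the degrees of three polynomials. -/
def TripleDegree {F : Type*} [Field F] (f g h : F[X]) (n : ℕ) : Prop :=
  (f.natDegree ≤ n ∧ g.natDegree ≤ n ∧ h.natDegree ≤ n) ∧
    (f.coeff n ≠ 0 ∨ g.coeff n ≠ 0 ∨ h.coeff n ≠ 0)

theorem TripleDegree.unique {F : Type*} [Field F] {f g h : F[X]} {m n : ℕ}
    (hm : TripleDegree f g h m) (hn : TripleDegree f g h n) : m = n := by
  have aux : ∀ {m n : ℕ}, TripleDegree f g h m → TripleDegree f g h n → m ≤ n := by
    rintro m n ⟨-, h1⟩ ⟨⟨h2, h3, h4⟩, -⟩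
    rcases h1 with h1 | h1 | h1
    · exact (le_natDegree_of_ne_zero h1).trans h2
    · exact (le_natDegree_of_ne_zero h1).trans h3
    · exact (le_natDegree_of_ne_zero h1).trans h4
  exact (aux hm hn).antisymm (aux hn hm)

theorem exists_bezout_of_no_common_root {F : Type*} [Field F] [IsAlgClosed F] {f g h : F[X]}
    (H : ∀ t, f.eval t = 0 → g.eval t = 0 → h.eval t ≠ 0) :
    ∃ u v w, u * f + v * g + w * h = 1 := by
  obtain ⟨d, hd⟩ := (IsPrincipalIdealRing.principal (Ideal.span {f, g, h})).principal
  have hmem : ∀ p ∈ ({f, g, h} : Set F[X]), d ∣ p := fun p hp =>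
    Ideal.mem_span_singleton.mp (by
      rw [← Ideal.submodule_span_eq, ← hd]; exact Ideal.subset_span hp)
  have hf := hmem f (by simp)
  have hg := hmem g (by simp)
  have hh := hmem h (by simp)
  have hu : IsUnit d := by
    by_contra hu
    have : ∃ t, d.eval t = 0 := by
      by_cases h0 : d.degree = 0
      · exact absurd (isUnit_iff_degree_eq_zero.mpr h0) hu
      · exact IsAlgClosed.exists_root d h0
    obtain ⟨t, ht⟩ := this
    exact H t (eval_eq_zero_of_dvd_of_eval_eq_zero hf ht)
      (eval_eq_zero_of_dvd_of_eval_eq_zero hg ht) (eval_eq_zero_of_dvd_of_eval_eq_zero hh ht)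
  have h1 : (1 : F[X]) ∈ Ideal.span {f, g, h} := by
    rw [hd, Ideal.submodule_span_eq, Ideal.span_singleton_eq_top.mpr hu]; trivial
  rw [Ideal.mem_span_insert] at h1
  obtain ⟨u, z, hz, h1⟩ := h1
  obtain ⟨v, w, h2⟩ := Ideal.mem_span_pair.mp hz
  exact ⟨u, v, w, by rw [h1, ← h2, add_assoc]⟩

/-- Two proportional primitive triples of polynomials have the same degree. -/
theorem TripleDegree.eq_of_proportional {F : Type*} [Field F] [IsAlgClosed F]
    {f g h f' g' h' : F[X]} {m n : ℕ} (hm : TripleDegree f g h m) (hn : TripleDegree f' g' h' n)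
    (H : ∀ t, f.eval t = 0 → g.eval t = 0 → h.eval t ≠ 0)
    (H' : ∀ t, f'.eval t = 0 → g'.eval t = 0 → h'.eval t ≠ 0) (hh : h' ≠ 0)
    (e₁ : f * h' = h * f') (e₂ : g * h' = h * g') : m = n := by
  obtain ⟨u, v, w, b⟩ := exists_bezout_of_no_common_root H
  obtain ⟨u', v', w', b'⟩ := exists_bezout_of_no_common_root H'
  -- By the Bezout relations h and h' divide each other, so the two triples differ by a nonzero
  -- constant.
  have d1 : h' ∣ h := ⟨u' * f + v' * g + w' * h, by
    linear_combination (-h) * b' - u' * e₁ - v' * e₂⟩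
  have d2 : h ∣ h' := ⟨u * f' + v * g' + w * h', by
    linear_combination (-h') * b + u * e₁ + v * e₂⟩
  obtain ⟨c, hc⟩ := associated_of_dvd_dvd d1 d2
  obtain ⟨k, hk, hk'⟩ := Polynomial.isUnit_iff.mp c.isUnit
  have hf : f = C k * f' := mul_right_cancel₀ hh (by rw [e₁, ← hc, hk']; ring)
  have hg : g = C k * g' := mul_right_cancel₀ hh (by rw [e₂, ← hc, hk']; ring)
  have hh : h = C k * h' := by rw [← hc, hk', mul_comm]
  have hk0 := hk.ne_zero
  refine hm.unique ?_
  subst hf hg hh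
  obtain ⟨⟨h1, h2, h3⟩, h4⟩ := hn
  refine ⟨⟨?_, ?_, ?_⟩, ?_⟩
  · rwa [natDegree_C_mul hk0]
  · rwa [natDegree_C_mul hk0]
  · rwa [natDegree_C_mul hk0]
  · simpa [coeff_C_mul, hk0] using h4

theorem coeff_max_natDegree_ne_zero {F : Type*} [Field F] {a b : F[X]} (h : b ≠ 0) :
    a.coeff (max a.natDegree b.natDegree) ≠ 0 ∨ b.coeff (max a.natDegree b.natDegree) ≠ 0 := by
  rcases le_or_gt a.natDegree b.natDegree with hab | hab
  · rw [max_eq_right hab]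
    exact Or.inr (leadingCoeff_ne_zero.mpr h)
  · rw [max_eq_left hab.le]
    refine Or.inl (leadingCoeff_ne_zero.mpr ?_)
    rintro rfl
    simp at hab

/-- The triple consists of the coefficients of (pT + q)(rT + s), and the top coefficients in X
multiply in the domain F[T], so degrees add. -/
theorem TripleDegree.of_mul {F : Type*} [Field F] {p q r s : F[X]} (hq : q ≠ 0) (hs : s ≠ 0) :
    TripleDegree (p * r) (p * s + q * r) (q * s)
      (max p.natDegree q.natDegree + max r.natDegree s.natDegree) := by
  have h1 := coeff_max_natDegree_ne_zero (a := p) hq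
  have h2 := coeff_max_natDegree_ne_zero (a := r) hs
  have l1 := le_max_left p.natDegree q.natDegree
  have l2 := le_max_right p.natDegree q.natDegree
  have l3 := le_max_left r.natDegree s.natDegree
  have l4 := le_max_right r.natDegree s.natDegree
  generalize max p.natDegree q.natDegree = m at *
  generalize max r.natDegree s.natDegree = n at *
  refine ⟨⟨natDegree_mul_le_of_le l1 l3, ?_, natDegree_mul_le_of_le l2 l4⟩, ?_⟩
  · exact (natDegree_add_le _ _).trans (max_le (natDegree_mul_le_of_le l1 l4)
      (natDegree_mul_le_of_le l2 l3))
  · rw [coeff_add, coeff_mul_add_eq_of_natDegree_le l1 l3, coeff_mul_add_eq_of_natDegree_le l1 l4,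
      coeff_mul_add_eq_of_natDegree_le l2 l3, coeff_mul_add_eq_of_natDegree_le l2 l4]
    by_contra! h
    obtain ⟨h3, h4, h5⟩ := h
    rcases h1 with h1 | h1
    · have hr := (mul_eq_zero.mp h3).resolve_left h1
      rw [hr, mul_zero, add_zero] at h4
      exact h2.elim (fun h => h hr) fun h => h ((mul_eq_zero.mp h4).resolve_left h1)
    · have hs := (mul_eq_zero.mp h5).resolve_left h1
      rw [hs, mul_zero, zero_add] at h4
      exact h2.elim (fun h => h ((mul_eq_zero.mp h4).resolve_left h1)) fun h => h hs

theorem eval_addSubMap {R : Type*} [CommRing R] (W : WeierstrassCurve R) (s t u : R) :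
    (fun i => (addSubMap W i).eval ![s, t, u]) =
      ![s ^ 2 - W.b₄ * s * u - W.b₆ * t * u - W.b₈ * u ^ 2,
        2 * t * s + W.b₂ * s * u + W.b₄ * t * u + W.b₆ * u ^ 2, t ^ 2 - 4 * s * u] := by
  funext i
  fin_cases i <;> simp [addSubMap]

/-- Numerator and denominator of the duplication formula are the addition-subtraction forms at P =
Q, where the third form vanishes; on an elliptic curve the three have no common nontrivial zero. -/
theorem addSub_no_common_zero {F : Type*} [Field F] (W : WeierstrassCurve F) [W.IsElliptic]
    {x : F} (h₁ : x ^ 4 - W.b₄ * x ^ 2 - 2 * W.b₆ * x - W.b₈ = 0)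
    (h₂ : 4 * x ^ 3 + W.b₂ * x ^ 2 + 2 * W.b₄ * x + W.b₆ = 0) : False := by
  refine addSubMap_ne_zero W (x := ![x ^ 2, 2 * x, 1]) (fun h => ?_) ?_
  · simpa using congrFun h 2
  · rw [eval_addSubMap]
    funext i
    fin_cases i
    · simp
      linear_combination h₁
    · simp
      linear_combination h₂
    · simp
      ring

/-- The three forms expressing `x(P + Q)` and `x(P - Q)`, with `x(P) = a / b` and `x(Q) = X`. -/
theorem TripleDegree.addSub {F : Type*} [Field F] (W : WeierstrassCurve F) {a b : F[X]}
    (hb : b ≠ 0) :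
    TripleDegree ((a * X) ^ 2 - C W.b₄ * (a * X) * b - C W.b₆ * (a + X * b) * b - C W.b₈ * b ^ 2)
      (2 * (a * X) * (a + X * b) + C W.b₂ * (a * X) * b + C W.b₄ * (a + X * b) * b +
        C W.b₆ * b ^ 2) ((a - X * b) ^ 2) (2 * max a.natDegree b.natDegree + 2) := by
  have h1 := coeff_max_natDegree_ne_zero (a := a) hb
  have l1 := le_max_left a.natDegree b.natDegree
  have l2 := le_max_right a.natDegree b.natDegree
  generalize max a.natDegree b.natDegree = m at *
  have hX : (X : F[X]).natDegree ≤ 1 := natDegree_X_le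
  have l3 : (a * X).natDegree ≤ m + 1 := natDegree_mul_le_of_le l1 hX
  have l4 : (X * b).natDegree ≤ m + 1 := (natDegree_mul_le_of_le hX l2).trans (by omega)
  have l5 : (a + X * b).natDegree ≤ m + 1 :=
    (natDegree_add_le _ _).trans (max_le (l1.trans (by omega)) l4)
  have l6 : (a - X * b).natDegree ≤ m + 1 :=
    (natDegree_sub_le _ _).trans (max_le (l1.trans (by omega)) l4)
  have k1 : ∀ (c : F) (f : F[X]), f.natDegree ≤ m + 1 → (C c * f * b).natDegree ≤ 2 * m + 1 :=
    fun c f hf => (natDegree_mul_le_of_le ((natDegree_C_mul_le c f).trans hf) l2).trans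
      (by omega)
  have k2 : ∀ c : F, (C c * b ^ 2).natDegree ≤ 2 * m + 1 := fun c =>
    (natDegree_C_mul_le c _).trans ((natDegree_pow_le_of_le 2 l2).trans (by omega))
  have k3 : ((a * X) ^ 2).natDegree ≤ 2 * m + 2 := natDegree_pow_le_of_le 2 l3
  have k4 : (2 * (a * X) * (a + X * b)).natDegree ≤ 2 * m + 2 :=
    (natDegree_mul_le_of_le ((natDegree_C_mul_le 2 (a * X)).trans l3) l5).trans (by omega)
  have lift : ∀ {f : F[X]}, f.natDegree ≤ 2 * m + 1 → f.natDegree ≤ 2 * m + 2 :=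
    fun h => h.trans (by omega)
  have hadd : ∀ {f g : F[X]}, f.natDegree ≤ 2 * m + 2 → g.natDegree ≤ 2 * m + 2 →
      (f + g).natDegree ≤ 2 * m + 2 := fun hf hg => (natDegree_add_le _ _).trans (max_le hf hg)
  have hsub : ∀ {f g : F[X]}, f.natDegree ≤ 2 * m + 2 → g.natDegree ≤ 2 * m + 2 →
      (f - g).natDegree ≤ 2 * m + 2 := fun hf hg => (natDegree_sub_le _ _).trans (max_le hf hg)
  have hc : ∀ {f : F[X]}, f.natDegree ≤ 2 * m + 1 → f.coeff (2 * m + 2) = 0 := fun h =>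
    coeff_eq_zero_of_natDegree_lt (by omega)
  refine ⟨⟨hsub (hsub (hsub k3 (lift (k1 _ _ l3))) (lift (k1 _ _ l5))) (lift (k2 _)),
    hadd (hadd (hadd k4 (lift (k1 _ _ l3))) (lift (k1 _ _ l5))) (lift (k2 _)),
    natDegree_pow_le_of_le 2 l6⟩, ?_⟩
  rcases h1 with h1 | h1
  · left
    rw [coeff_sub, coeff_sub, coeff_sub, hc (k1 _ _ l3), hc (k1 _ _ l5), hc (k2 _), sub_zero,
      sub_zero, sub_zero, show 2 * m + 2 = 2 * (m + 1) by ring, coeff_pow_of_natDegree_le l3,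
      coeff_mul_X]
    exact pow_ne_zero 2 h1
  · right; right
    rw [show 2 * m + 2 = 2 * (m + 1) by ring, coeff_pow_of_natDegree_le l6, coeff_sub,
      coeff_X_mul, coeff_eq_zero_of_natDegree_lt (by omega : a.natDegree < m + 1), zero_sub]
    exact pow_ne_zero 2 (neg_ne_zero.mpr h1)

theorem exists_reduced_fraction {F L : Type*} [Field F] [Field L] [Algebra F L] {x₀ : L}
    (hx₀ : Transcendental F x₀) (p q : F[X]) (hq : q ≠ 0) :
    ∃ a b : F[X], IsCoprime a b ∧ b ≠ 0 ∧ aeval x₀ p / aeval x₀ q = aeval x₀ a / aeval x₀ b := by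
  classical
  let _ := EuclideanDomain.gcdMonoid F[X]
  obtain ⟨a, b, hp, hq', hu⟩ := extract_gcd p q
  have hg : GCDMonoid.gcd p q ≠ 0 := fun h => hq (by rw [hq', h, zero_mul])
  have hb : b ≠ 0 := fun h => hq (by rw [hq', h, mul_zero])
  have hinj := transcendental_iff_injective.mp hx₀
  refine ⟨a, b, (gcd_isUnit_iff a b).mp hu, hb, ?_⟩
  have h0 : aeval x₀ (GCDMonoid.gcd p q) ≠ 0 := (map_ne_zero_iff _ hinj).mpr hg
  have hp' := congrArg (aeval x₀) hp
  have hq'' := congrArg (aeval x₀) hq'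
  rw [map_mul] at hp' hq''
  rw [hp', hq'', mul_div_mul_left _ _ h0]

/-- `P` is an affine point whose `x`-coordinate is a rational function of degree `n` in `x₀`. -/
def HasXDegree {F L : Type*} [Field F] [Field L] [Algebra F L] {W : Affine L} (x₀ : L)
    (P : W.Point) (n : ℕ) : Prop :=
  ∃ a b : F[X], IsCoprime a b ∧ b ≠ 0 ∧ max a.natDegree b.natDegree = n ∧
    ∃ y h, P = .some (aeval x₀ a / aeval x₀ b) y h

section

variable {F L : Type*} [Field F] [IsAlgClosed F] [Field L] [Algebra F L] [DecidableEq L]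
  {W : Affine L} (V : WeierstrassCurve F) [V.IsElliptic] (h₂ : W.b₂ = algebraMap F L V.b₂)
  (h₄ : W.b₄ = algebraMap F L V.b₄) (h₆ : W.b₆ = algebraMap F L V.b₆)
  (h₈ : W.b₈ = algebraMap F L V.b₈) {x₀ y₀ : L} (hx₀ : Transcendental F x₀)
  (hQ : W.Nonsingular x₀ y₀)

include h₂ h₄ h₆ h₈ hx₀ in
-- The parallelogram law for degrees, with Q of degree 1. The symmetric functions of x(P + Q) and
-- x(P - Q) yield two proportional primitive triples, one of degree k + n and one of degree 2m + 2.
theorem HasXDegree.add_sub {P : W.Point} {m n : ℕ} (hm : 2 ≤ m) (hP : HasXDegree (F := F) x₀ P m)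
    (hPQ : HasXDegree (F := F) x₀ (P - .some x₀ y₀ hQ) n) :
    ∃ k, k + n = 2 * m + 2 ∧ HasXDegree (F := F) x₀ (P + .some x₀ y₀ hQ) k := by
  obtain ⟨a, b, hab, hb, hmax, y₁, hP₁, rfl⟩ := hP
  obtain ⟨r, s, hrs, hs, hmax', z₁, hM₁, hM⟩ := hPQ
  have hinj := transcendental_iff_injective.mp hx₀
  have hb0 : aeval x₀ b ≠ 0 := (map_ne_zero_iff _ hinj).mpr hb
  have hs0 : aeval x₀ s ≠ 0 := (map_ne_zero_iff _ hinj).mpr hs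
  -- x(P) ≠ x(Q), because x(Q) has degree 1 and x(P) has degree m ≥ 2.
  have hne : a - X * b ≠ 0 := by
    intro h
    rw [sub_eq_zero] at h
    subst h
    have hu : IsUnit b := hab.isUnit_of_dvd' (dvd_mul_left b X) dvd_rfl
    have hd := natDegree_eq_zero_of_isUnit hu
    have := natDegree_mul_le (p := (X : F[X])) (q := b)
    rw [natDegree_X] at this
    omega
  have hne' : aeval x₀ (a - X * b) ≠ 0 := (map_ne_zero_iff _ hinj).mpr hne
  have hx : aeval x₀ a / aeval x₀ b ≠ x₀ := by
    intro h
    rw [div_eq_iff hb0] at h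
    exact hne' (by rw [map_sub, map_mul, aeval_X, h, sub_self])
  obtain ⟨u, v, y, hu, z, hv, e1, e2, e3, e4⟩ := exists_add_sub_some hP₁ hQ hx
  rw [e1]
  rw [e2, Affine.Point.some.injEq] at hM
  obtain ⟨rfl, -⟩ := hM
  rw [h₂, h₄, h₆] at e3
  rw [h₄, h₆, h₈] at e4
  have hD : (aeval x₀ a / aeval x₀ b - x₀) ^ 2 * aeval x₀ b ^ 2 =
      aeval x₀ ((a - X * b) ^ 2) := by
    simp only [map_pow, map_sub, map_mul, aeval_X]
    field_simp
  have hS : (aeval x₀ a / aeval x₀ b - x₀) ^ 2 * aeval x₀ b ^ 2 *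
      (u + aeval x₀ r / aeval x₀ s) = aeval x₀ (2 * (a * X) * (a + X * b) + C V.b₂ * (a * X) * b +
        C V.b₄ * (a + X * b) * b + C V.b₆ * b ^ 2) := by
    rw [mul_right_comm, e3]
    simp only [map_pow, map_add, map_mul, aeval_X, aeval_C, map_ofNat]
    field_simp
  have hT : (aeval x₀ a / aeval x₀ b - x₀) ^ 2 * aeval x₀ b ^ 2 *
      (u * (aeval x₀ r / aeval x₀ s)) = aeval x₀ ((a * X) ^ 2 - C V.b₄ * (a * X) * b -
        C V.b₆ * (a + X * b) * b - C V.b₈ * b ^ 2) := by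
    rw [mul_right_comm, e4]
    simp only [map_pow, map_add, map_sub, map_mul, aeval_X, aeval_C]
    field_simp
  rw [hD] at hS hT
  have hD2 : (a - X * b) ^ 2 ≠ 0 := pow_ne_zero 2 hne
  have hD2' : aeval x₀ ((a - X * b) ^ 2) ≠ 0 := (map_ne_zero_iff _ hinj).mpr hD2
  obtain ⟨p, q, hpq, hq, hu'⟩ := exists_reduced_fraction hx₀
    ((2 * (a * X) * (a + X * b) + C V.b₂ * (a * X) * b + C V.b₄ * (a + X * b) * b +
      C V.b₆ * b ^ 2) * s - (a - X * b) ^ 2 * r) ((a - X * b) ^ 2 * s) (mul_ne_zero hD2 hs)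
  have hq0 : aeval x₀ q ≠ 0 := (map_ne_zero_iff _ hinj).mpr hq
  have hu'' : u = aeval x₀ p / aeval x₀ q := by
    rw [← hu', map_sub, map_mul, ← hS, map_mul, map_mul]
    field_simp
    ring
  subst hu''
  refine ⟨max p.natDegree q.natDegree, ?_, p, q, hpq, hq, rfl, y, hu, rfl⟩
  rw [← hmax, ← hmax']
  have hroot : ∀ {f g : F[X]}, IsCoprime f g → ∀ t, f.eval t = 0 → g.eval t ≠ 0 := by
    rintro f g ⟨α, β, h⟩ t hf hg
    have := congrArg (eval t) h
    rw [eval_add, eval_mul, eval_mul, hf, hg, mul_zero, mul_zero, add_zero, eval_one] at this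
    exact zero_ne_one this
  refine (TripleDegree.of_mul (p := p) (r := r) hq hs).eq_of_proportional
    (TripleDegree.addSub V (a := a) hb) ?_ ?_ hD2 ?_ ?_
  · intro t t1 t2 t3
    simp only [eval_mul, eval_add] at t1 t2 t3
    have n1 := hroot hpq t
    have n2 := hroot hrs t
    rcases mul_eq_zero.mp t1 with hp0 | hr0
    · have hs' := (mul_eq_zero.mp t3).resolve_left (n1 hp0)
      rw [hs', mul_zero, zero_add] at t2
      exact n2 ((mul_eq_zero.mp t2).resolve_left (n1 hp0)) hs'
    · have hq' := (mul_eq_zero.mp t3).resolve_right (n2 hr0)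
      rw [hq', zero_mul, add_zero] at t2
      exact n1 ((mul_eq_zero.mp t2).resolve_right (n2 hr0)) hq'
  · intro t t1 t2 t3
    simp only [eval_mul, eval_add, eval_sub, eval_pow, eval_C, eval_X, eval_ofNat] at t1 t2 t3
    -- At a common zero t the values of x(P) and x(Q) coincide, and the other two forms become b(t)²
    -- times the duplication polynomials.
    have ha : a.eval t = t * b.eval t := by
      rw [← sub_eq_zero]; exact pow_eq_zero_iff two_ne_zero |>.mp t3
    have hbt : b.eval t ≠ 0 := fun h => hroot hab t (by rw [ha, h, mul_zero]) h
    rw [ha] at t1 t2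
    refine addSub_no_common_zero V (x := t) ?_ ?_
    · refine (mul_eq_zero.mp (?_ : eval t b ^ 2 * _ = 0)).resolve_left (pow_ne_zero 2 hbt)
      linear_combination t1
    · refine (mul_eq_zero.mp (?_ : eval t b ^ 2 * _ = 0)).resolve_left (pow_ne_zero 2 hbt)
      linear_combination t2
  · apply hinj
    rw [map_mul, map_mul _ (q * s), ← hT, map_mul, map_mul]
    field_simp
  · apply hinj
    rw [map_mul, map_mul _ (q * s), ← hS, map_mul, map_add, map_mul, map_mul]
    field_simp

include h₂ h₄ h₆ h₈ hx₀ in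
theorem hasXDegree_two_nsmul : HasXDegree (F := F) x₀ ((2 : ℕ) • Affine.Point.some x₀ y₀ hQ) 4 := by
  have hinj := transcendental_iff_injective.mp hx₀
  have hcop : IsCoprime (X ^ 4 - C V.b₄ * X ^ 2 - C 2 * C V.b₆ * X - C V.b₈)
      (C 4 * X ^ 3 + C V.b₂ * X ^ 2 + C 2 * C V.b₄ * X + C V.b₆) := by
    obtain ⟨u, v, w, h⟩ := exists_bezout_of_no_common_root
      (f := X ^ 4 - C V.b₄ * X ^ 2 - C 2 * C V.b₆ * X - C V.b₈)
      (g := C 4 * X ^ 3 + C V.b₂ * X ^ 2 + C 2 * C V.b₄ * X + C V.b₆) (h := 0) (by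
        intro t t1 t2
        simp only [eval_mul, eval_add, eval_sub, eval_pow, eval_C, eval_X] at t1 t2
        exact (addSub_no_common_zero V t1 t2).elim)
    exact ⟨u, v, by rw [← h, mul_zero, add_zero]⟩
  have hd : (X ^ 4 - C V.b₄ * X ^ 2 - C 2 * C V.b₆ * X - C V.b₈ : F[X]).natDegree = 4 := by
    rw [← C_mul]
    compute_degree!
  have hd' : (C 4 * X ^ 3 + C V.b₂ * X ^ 2 + C 2 * C V.b₄ * X + C V.b₆ : F[X]).natDegree ≤ 3 := by
    rw [← C_mul]
    compute_degree
  have hne : (C 4 * X ^ 3 + C V.b₂ * X ^ 2 + C 2 * C V.b₄ * X + C V.b₆ : F[X]) ≠ 0 := by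
    intro h
    rw [h, isCoprime_zero_right] at hcop
    have := natDegree_eq_zero_of_isUnit hcop
    omega
  have hne' := (map_ne_zero_iff (aeval x₀) hinj).mpr hne
  have hx : 4 * x₀ ^ 3 + W.b₂ * x₀ ^ 2 + 2 * W.b₄ * x₀ + W.b₆ ≠ 0 := by
    rw [h₂, h₄, h₆]
    simpa [map_ofNat (algebraMap F L)] using hne'
  obtain ⟨u, z, h, e1, e2⟩ := exists_add_self_some hQ hx
  refine ⟨_, _, hcop, hne, ?_, z, ?_⟩
  · rw [hd]
    omega
  · obtain rfl : u = aeval x₀ (X ^ 4 - C V.b₄ * X ^ 2 - C 2 * C V.b₆ * X - C V.b₈) /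
        aeval x₀ (C 4 * X ^ 3 + C V.b₂ * X ^ 2 + C 2 * C V.b₄ * X + C V.b₆) := by
      rw [eq_div_iff hne']
      rw [h₂, h₄, h₆, h₈] at e2
      simpa [map_ofNat (algebraMap F L)] using e2
    exact ⟨h, by rw [two_nsmul, e1]⟩

include h₂ h₄ h₆ h₈ hx₀ in
/-- The `x`-coordinate of `n • η` has degree `n ^ 2`, for a point `η` with transcendental
`x`-coordinate. -/
theorem hasXDegree_nsmul {n : ℕ} (hn : n ≠ 0) :
    HasXDegree (F := F) x₀ (n • Affine.Point.some x₀ y₀ hQ) (n ^ 2) := by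
  suffices H : ∀ n : ℕ, HasXDegree (F := F) x₀ ((n + 1) • Affine.Point.some x₀ y₀ hQ)
      ((n + 1) ^ 2) ∧ HasXDegree (F := F) x₀ ((n + 2) • Affine.Point.some x₀ y₀ hQ)
      ((n + 2) ^ 2) by
    obtain ⟨m, rfl⟩ := Nat.exists_eq_succ_of_ne_zero hn
    exact (H m).1
  intro n
  induction n with
  | zero =>
    refine ⟨⟨X, 1, isCoprime_one_right, one_ne_zero, by simp, y₀, ?_⟩,
      hasXDegree_two_nsmul V h₂ h₄ h₆ h₈ hx₀ hQ⟩
    simp [hQ]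
  | succ n ih =>
    refine ⟨ih.2, ?_⟩
    -- The recursion rests on (n + 3)² + (n + 1)² = 2(n + 2)² + 2.
    obtain ⟨k, hk, h⟩ := HasXDegree.add_sub V h₂ h₄ h₆ h₈ hx₀ hQ
      (by have := Nat.pow_le_pow_left (show 2 ≤ n + 2 by omega) 2; omega) ih.2
      (n := (n + 1) ^ 2) (by
        rw [show n + 2 = (n + 1) + 1 by ring, succ_nsmul _ (n + 1), add_sub_cancel_right]
        exact ih.1)
    rw [← succ_nsmul] at h
    convert h using 1
    nlinarith

end

end Degree

/-! ### The coordinate ring and the function field. -/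

section FunctionField

open Polynomial

/-- The coordinate ring of `E` over `F`. -/
abbrev CoordRing {K : Type*} (F : Type*) [Field K] [Field F] [Algebra K F]
    (E : WeierstrassCurve K) := (E.baseChange F).toAffine.CoordinateRing

instance {K F : Type*} [Field K] [Field F] [Algebra K F] (E : WeierstrassCurve K) :
    Module.Finite F[X] (CoordRing F E) :=
  .of_basis (Affine.CoordinateRing.basis _)

instance {K F : Type*} [Field K] [Field F] [Algebra K F] (E : WeierstrassCurve K) [E.IsElliptic] :
    (E.baseChange F).IsElliptic :=
  inferInstanceAs (E.map (algebraMap K F)).IsElliptic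

variable {K F : Type*} [Field K] [Field F] [Algebra K F] (E : WeierstrassCurve K)
  (L : Type*) [Field L] [Algebra K L] [Algebra F L] [IsScalarTower K F L]
  [Algebra (CoordRing F E) L] [IsFractionRing (CoordRing F E) L]
  [IsScalarTower F (CoordRing F E) L]

/-- The inclusion of the points over `F` in the points over `L`. -/
abbrev constPoint {K F : Type*} [Field K] [Field F] [Algebra K F] {E : WeierstrassCurve K}
    (L : Type*) [Field L] [Algebra K L] [Algebra F L] [IsScalarTower K F L] [DecidableEq F]
    [DecidableEq L] : (E.baseChange F).toAffine.Point →+ (E.baseChange L).toAffine.Point :=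
  Affine.Point.map (W' := E) (IsScalarTower.toAlgHom K F L)

/-- The coordinate function `x`. -/
def genX : L := algebraMap (CoordRing F E) L (AdjoinRoot.of _ X)

/-- The coordinate function `y`. -/
def genY : L := algebraMap (CoordRing F E) L (AdjoinRoot.root _)

theorem algebraMap_coordRing_of (p : F[X]) :
    algebraMap (CoordRing F E) L (AdjoinRoot.of _ p) = aeval (genX (F := F) E L) p := by
  have : (IsScalarTower.toAlgHom F (CoordRing F E) L).comp
      ((Algebra.ofId F[X] (CoordRing F E)).restrictScalars F) = aeval (genX (F := F) E L) := by
    ext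
    simp [genX]
  exact DFunLike.congr_fun this p

theorem algebraMap_coordRing_smul (p q : F[X]) :
    algebraMap (CoordRing F E) L (p • 1 + q • Affine.CoordinateRing.mk _ X) =
      aeval (genX (F := F) E L) p + aeval (genX (F := F) E L) q * genY (F := F) E L := by
  rw [map_add, Affine.CoordinateRing.smul, Affine.CoordinateRing.smul, mul_one, map_mul,
    ← algebraMap_coordRing_of, ← algebraMap_coordRing_of]
  rfl

theorem genX_transcendental : Transcendental F (genX (F := F) E L) := by
  rw [transcendental_iff_injective]
  have h : Function.Injective (algebraMap F[X] (CoordRing F E)) :=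
    FaithfulSMul.algebraMap_injective _ _
  intro p q hpq
  rw [← algebraMap_coordRing_of, ← algebraMap_coordRing_of] at hpq
  exact h (IsFractionRing.injective (CoordRing F E) L hpq)

theorem equation_gen :
    (E.baseChange L).toAffine.Equation (genX (F := F) E L) (genY (F := F) E L) := by
  have key : ∀ (q : F[X][X]) (r : CoordRing F E),
      q = (E.baseChange F).toAffine.polynomial → q.eval₂ (AdjoinRoot.of _) r =
        (E.baseChange F).toAffine.polynomial.eval₂ (AdjoinRoot.of _) r := by
    rintro q r rfl
    rfl
  have h := congrArg (algebraMap (CoordRing F E) L)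
    ((key (X ^ 2 + C (C (E.baseChange F).a₁ * X + C (E.baseChange F).a₃) * X -
      C (X ^ 3 + C (E.baseChange F).a₂ * X ^ 2 + C (E.baseChange F).a₄ * X +
        C (E.baseChange F).a₆)) (AdjoinRoot.root _) rfl).trans
      (AdjoinRoot.eval₂_root (E.baseChange F).toAffine.polynomial))
  rw [map_zero] at h
  simp only [eval₂_add, eval₂_sub, eval₂_mul, eval₂_pow, eval₂_C, eval₂_X, map_add, map_sub,
    map_mul, map_pow] at h
  change genY (F := F) E L ^ 2 + _ * genY (F := F) E L - _ = 0 at h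
  have hx : algebraMap (CoordRing F E) L (AdjoinRoot.of _ X) = genX (F := F) E L := rfl
  have hC (c : F) : algebraMap (CoordRing F E) L (AdjoinRoot.of _ (C c)) = algebraMap F L c := by
    rw [algebraMap_coordRing_of, aeval_C]
  erw [hC, hC, hC, hC, hC, hx] at h
  rw [Affine.equation_iff]
  simp only [WeierstrassCurve.baseChange, WeierstrassCurve.map_a₁, map_a₂, map_a₃, map_a₄, map_a₆,
    ← IsScalarTower.algebraMap_apply] at h ⊢
  linear_combination h

/-- The universal property of the function field. -/
theorem exists_ringHom_of_equation {Ω : Type*} [Field Ω] (σ : F →+* Ω) {u v : Ω}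
    (h : ((E.baseChange F).map σ).toAffine.Equation u v) (hu : ∀ p : F[X], p.eval₂ σ u = 0 → p = 0) :
    ∃ f : L →+* Ω, f.comp (algebraMap F L) = σ ∧ f (genX (F := F) E L) = u ∧
      f (genY (F := F) E L) = v := by
  have h0 : (E.baseChange F).toAffine.polynomial.eval₂ (eval₂RingHom σ u) v = 0 := by
    rw [Affine.equation_iff] at h
    simp only [WeierstrassCurve.map_a₁, map_a₂, map_a₃, map_a₄, map_a₆] at h
    simp only [Affine.polynomial, eval₂_add, eval₂_sub, eval₂_mul, eval₂_pow, eval₂_C, eval₂_X,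
      map_add, map_mul, map_pow, coe_eval₂RingHom]
    linear_combination h
  let g : CoordRing F E →+* Ω := AdjoinRoot.lift (eval₂RingHom σ u) v h0
  have hg : Function.Injective g := by
    rw [injective_iff_map_eq_zero]
    intro a ha
    by_contra hne
    have hk : RingHom.ker g ≠ ⊥ := fun h => hne (by
      rw [← Ideal.mem_bot, ← h]; exact ha)
    -- The coordinate ring is integral over F[X], so a nonzero kernel would meet F[X]; injectivity
    -- is thus tested on polynomials in x.
    refine hk (Ideal.eq_bot_of_comap_eq_bot (R := F[X]) ?_)
    rw [eq_bot_iff]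
    intro p hp
    refine hu p ?_
    have : g (AdjoinRoot.of _ p) = 0 := hp
    simpa [g] using this
  have hunit : ∀ y : nonZeroDivisors (CoordRing F E), IsUnit (g y) := fun y =>
    IsUnit.mk0 _ ((map_ne_zero_iff g hg).mpr (nonZeroDivisors.ne_zero y.2))
  refine ⟨IsLocalization.lift hunit, ?_, ?_, ?_⟩
  · ext c
    rw [RingHom.comp_apply, IsScalarTower.algebraMap_apply F (CoordRing F E) L,
      IsLocalization.lift_eq]
    change g (AdjoinRoot.of _ (C c)) = _
    simp [g]
  · rw [genX, IsLocalization.lift_eq]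
    simp [g]
  · rw [genY, IsLocalization.lift_eq]
    simp [g]

theorem ringHom_ext {Ω : Type*} [Field Ω] {f g : L →+* Ω}
    (h : f.comp (algebraMap F L) = g.comp (algebraMap F L))
    (hx : f (genX (F := F) E L) = g (genX (F := F) E L))
    (hy : f (genY (F := F) E L) = g (genY (F := F) E L)) : f = g := by
  refine IsLocalization.ringHom_ext (nonZeroDivisors (CoordRing F E)) ?_
  refine AdjoinRoot.ringHom_ext ?_ hy
  refine Polynomial.ringHom_ext (fun c => ?_) hx
  have := congrArg (fun e : F →+* Ω => e c) h
  simp only [RingHom.comp_apply, IsScalarTower.algebraMap_apply F (CoordRing F E) L] at this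
  exact this

/-- The norm of p + qy to F[X] has degree max(2 deg p, 2 deg q + 3). For a unit it has degree 0,
which forces q = 0 and p constant. -/
theorem isUnit_coordRing_eq (z : (CoordRing F E)ˣ) :
    ∃ c : F, c ≠ 0 ∧ (z : CoordRing F E) = algebraMap F _ c := by
  obtain ⟨p, q, h⟩ := Affine.CoordinateRing.exists_smul_basis_eq (z : CoordRing F E)
  have hn : IsUnit (Algebra.norm F[X] (z : CoordRing F E)) := z.isUnit.map _
  have hd := degree_eq_zero_of_isUnit hn
  rw [← h, Affine.CoordinateRing.degree_norm_smul_basis] at hd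
  have hq : q = 0 := by
    by_contra hq
    have h1 : 2 • q.degree + 3 ≤ 0 := (le_max_right _ _).trans hd.le
    rw [degree_eq_natDegree hq] at h1
    have h2 : ((2 * q.natDegree + 3 : ℕ) : WithBot ℕ) ≤ (0 : ℕ) := by
      push_cast
      simpa [two_mul, two_smul] using h1
    have h3 : 2 * q.natDegree + 3 ≤ 0 := by exact_mod_cast h2
    omega
  have hp : p.degree ≤ 0 := by
    have h1 : 2 • p.degree ≤ 0 := (le_max_left _ _).trans hd.le
    by_cases hp : p = 0
    · simp [hp]
    rw [degree_eq_natDegree hp] at h1 ⊢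
    have h2 : ((2 * p.natDegree : ℕ) : WithBot ℕ) ≤ (0 : ℕ) := by
      push_cast
      simpa [two_mul, two_smul] using h1
    have h3 : 2 * p.natDegree ≤ 0 := by exact_mod_cast h2
    have : p.natDegree = 0 := by omega
    simp [this]
  rw [eq_C_of_degree_le_zero hp, hq, zero_smul, add_zero] at h
  have h' : (z : CoordRing F E) = algebraMap F _ (p.coeff 0) := by
    rw [← h, Algebra.smul_def, mul_one]
    rfl
  refine ⟨p.coeff 0, fun h0 => z.ne_zero ?_, h'⟩
  rw [h', h0, map_zero]

/-- The maximal ideal of a point, and the unit ideal for the point at infinity. -/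
def pointIdeal : (E.baseChange F).toAffine.Point → Ideal (CoordRing F E)
  | .zero => 1
  | .some x y _ => Affine.CoordinateRing.XYIdeal _ x (C y)

theorem XYIdeal_isMaximal {W : Affine F} {x y : F} (h : W.Equation x y) :
    (Affine.CoordinateRing.XYIdeal W x (C y)).IsMaximal := by
  have e := Affine.CoordinateRing.quotientXYIdealEquiv (W' := W) (x := x) (y := C y) h
  exact Ideal.Quotient.maximal_of_isField _ (e.toMulEquiv.isField (Field.toIsField F))

/-- Nullstellensatz: the residue field is finite over the algebraically closed F, hence equal to it,
and the images of x and y are the coordinates of the point. -/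
theorem exists_XYIdeal_eq [IsAlgClosed F] [E.IsElliptic] (M : Ideal (CoordRing F E))
    [hM : M.IsMaximal] : ∃ x y, (E.baseChange F).toAffine.Equation x y ∧
      M = Affine.CoordinateRing.XYIdeal _ x (C y) := by
  let := Ideal.Quotient.field M
  have hft : Algebra.FiniteType F (CoordRing F E) :=
    .trans (S := F[X]) inferInstance inferInstance
  have : Algebra.FiniteType F (CoordRing F E ⧸ M) :=
    .of_surjective (Ideal.Quotient.mkₐ F M) Ideal.Quotient.mk_surjective
  have : Module.Finite F (CoordRing F E ⧸ M) := finite_of_finite_type_of_isJacobsonRing _ _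
  have hs := (IsAlgClosed.algebraMap_bijective_of_isIntegral (k := F) (K := CoordRing F E ⧸ M)).2
  obtain ⟨x, hx⟩ := hs (Ideal.Quotient.mk M (AdjoinRoot.of _ X))
  obtain ⟨y, hy⟩ := hs (Ideal.Quotient.mk M (AdjoinRoot.root _))
  have hX : Affine.CoordinateRing.XClass (E.baseChange F).toAffine x ∈ M := by
    rw [← Ideal.Quotient.eq_zero_iff_mem]
    change Ideal.Quotient.mk M (AdjoinRoot.of _ (X - C x)) = 0
    rw [map_sub, map_sub, ← hx, sub_eq_zero]
    rfl
  have hY : Affine.CoordinateRing.YClass (E.baseChange F).toAffine (C y) ∈ M := by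
    rw [← Ideal.Quotient.eq_zero_iff_mem]
    change Ideal.Quotient.mk M (Affine.CoordinateRing.mk _ (X - C (C y))) = 0
    rw [map_sub, map_sub, sub_eq_zero]
    exact hy.symm
  have hle : Affine.CoordinateRing.XYIdeal _ x (C y) ≤ M := by
    rw [Affine.CoordinateRing.XYIdeal, Ideal.span_le]
    rintro _ (rfl | rfl)
    · exact hX
    · exact hY
  have heq : (E.baseChange F).toAffine.Equation x y := by
    let g : F[X] →+* CoordRing F E ⧸ M := (Ideal.Quotient.mk M).comp (AdjoinRoot.of _)
    have h0 : (E.baseChange F).toAffine.polynomial.eval₂ g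
        (Ideal.Quotient.mk M (AdjoinRoot.root _)) = 0 := by
      rw [← hom_eval₂]
      exact (congrArg _ (AdjoinRoot.eval₂_root _)).trans (map_zero _)
    have hg : g = (algebraMap F (CoordRing F E ⧸ M)).comp (evalRingHom x) := by
      refine Polynomial.ringHom_ext (fun c => ?_) ?_
      · simp only [RingHom.comp_apply, coe_evalRingHom, eval_C]
        rfl
      · simp only [RingHom.comp_apply, coe_evalRingHom, eval_X]
        exact hx.symm
    rw [hg, ← hy, ← eval₂_map, eval₂_at_apply] at h0
    have := (map_eq_zero_iff _ (algebraMap F (CoordRing F E ⧸ M)).injective).mp h0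
    rwa [map_evalRingHom_eval] at this
  exact ⟨x, y, heq, ((XYIdeal_isMaximal heq).eq_of_le hM.ne_top hle).symm⟩

instance : Ring.DimensionLEOne (CoordRing F E) :=
  .of_isIntegral F[X] _

/-- In a local domain, a factor of a nonzero principal ideal is principal. -/
theorem isPrincipal_of_mul_eq_span_singleton {A : Type*} [CommRing A] [IsDomain A] [IsLocalRing A]
    {I J : Ideal A} {a : A} (ha : a ≠ 0) (h : I * J = Ideal.span {a}) : I.IsPrincipal := by
  -- Otherwise every product ij would lie in a times the maximal ideal, and so would a, putting 1 in
  -- the maximal ideal.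
  obtain ⟨i, hi, j, hj, u, hu, hij⟩ : ∃ i ∈ I, ∃ j ∈ J, ∃ u, IsUnit u ∧ i * j = a * u := by
    by_contra! hcon
    have hle : I * J ≤ Ideal.span {a} * IsLocalRing.maximalIdeal A := by
      refine Ideal.mul_le.mpr fun i hi j hj => ?_
      have hm : i * j ∈ Ideal.span {a} := h ▸ Ideal.mul_mem_mul hi hj
      obtain ⟨u, hu⟩ := Ideal.mem_span_singleton'.mp hm
      rw [← hu, mul_comm u]
      refine Ideal.mul_mem_mul (Ideal.mem_span_singleton_self a) ?_
      rw [IsLocalRing.mem_maximalIdeal, mem_nonunits_iff]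
      exact fun hu' => hcon i hi j hj u hu' (by rw [← hu, mul_comm])
    have ha' : a ∈ Ideal.span {a} * IsLocalRing.maximalIdeal A :=
      hle (h ▸ Ideal.mem_span_singleton_self a)
    obtain ⟨z, hz, hza⟩ := Ideal.mem_span_singleton_mul.mp ha'
    have : z = 1 := mul_left_cancel₀ ha (by rw [hza, mul_one])
    exact (IsLocalRing.maximalIdeal.isMaximal A).ne_top
      ((Ideal.eq_top_iff_one _).mpr (this ▸ hz))
  have hj0 : j ≠ 0 := by
    rintro rfl
    rw [mul_zero, eq_comm, mul_eq_zero] at hij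
    exact hij.elim ha hu.ne_zero
  refine ⟨⟨i, le_antisymm (fun x hx => ?_) ((Ideal.span_singleton_le_iff_mem _).mpr hi)⟩⟩
  have hm : x * j ∈ Ideal.span {a} := h ▸ Ideal.mul_mem_mul hx hj
  obtain ⟨b, hb⟩ := Ideal.mem_span_singleton'.mp hm
  obtain ⟨v, hv⟩ := hu.exists_right_inv
  refine Ideal.mem_span_singleton'.mpr ⟨b * v, mul_right_cancel₀ hj0 ?_⟩
  linear_combination b * v * hij + b * a * hv + hb

/-- A nonzero prime is the ideal of a point P, and its product with the ideal of -P is generated by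
x - x(P). After localising, a factor of a principal ideal is principal, so the local ring is a
discrete valuation ring. -/
theorem isDedekindDomain_coordRing [IsAlgClosed F] [E.IsElliptic] :
    IsDedekindDomain (CoordRing F E) := by
  have : IsNoetherianRing (CoordRing F E) := IsNoetherianRing.of_finite F[X] _
  have : IsDedekindDomainDvr (CoordRing F E) := by
    refine { is_dvr_at_nonzero_prime := fun P hP hPrime => ?_ }
    have hmax : P.IsMaximal := hPrime.isMaximal hP
    obtain ⟨x, y, h, hM⟩ := exists_XYIdeal_eq E P
    have hns := ((E.baseChange F).toAffine.equation_iff_nonsingular).mp h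
    have : IsNoetherianRing (Localization.AtPrime P) :=
      IsLocalization.isNoetherianRing P.primeCompl _ inferInstance
    have hinj := IsLocalization.injective (Localization.AtPrime P) P.primeCompl_le_nonZeroDivisors
    have hpr : (IsLocalRing.maximalIdeal (Localization.AtPrime P)).IsPrincipal := by
      have hmul := congrArg (Ideal.map (algebraMap _ (Localization.AtPrime P)))
        (Affine.CoordinateRing.XYIdeal_neg_mul hns)
      rw [Ideal.map_mul, ← hM, mul_comm, Affine.CoordinateRing.XIdeal, Ideal.map_span,
        Set.image_singleton, Localization.AtPrime.map_eq_maximalIdeal] at hmul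
      refine isPrincipal_of_mul_eq_span_singleton ?_ hmul
      exact (map_ne_zero_iff _ hinj).mpr (Affine.CoordinateRing.XClass_ne_zero x)
    have hnf : ¬ IsField (Localization.AtPrime P) := by
      rw [IsLocalRing.isField_iff_maximalIdeal_eq, ← Localization.AtPrime.map_eq_maximalIdeal,
        Ideal.map_eq_bot_iff_of_injective hinj]
      exact hP
    exact ((IsDiscreteValuationRing.TFAE _ hnf).out 0 4).mpr hpr
  infer_instance

end FunctionField

/-! ### Divisors as fractional ideals. -/

section Divisor

open Polynomial
open scoped nonZeroDivisors

variable {K : Type*} (F : Type*) [Field K] [Field F] [Algebra K F] (E : WeierstrassCurve K)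
  (L : Type*) [Field L] [Algebra K L] [Algebra F L] [IsScalarTower K F L]
  [Algebra (CoordRing F E) L] [IsFractionRing (CoordRing F E) L]
  [IsScalarTower F (CoordRing F E) L] [IsAlgClosed F] [E.IsElliptic]

instance : IsDedekindDomain (CoordRing F E) := isDedekindDomain_coordRing E

/-- The generic point of `E`, with coordinates in the function field. -/
def genPoint : (E.baseChange L).toAffine.Point :=
  .some (genX (F := F) E L) (genY (F := F) E L)
    ((E.baseChange L).toAffine.equation_iff_nonsingular.mp (equation_gen E L))

/-- The divisor of a function on the affine part of `E`, as a fractional ideal. -/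
def dv : L →*₀ FractionalIdeal (CoordRing F E)⁰ L where
  toFun := FractionalIdeal.spanSingleton _
  map_zero' := FractionalIdeal.spanSingleton_zero
  map_one' := FractionalIdeal.spanSingleton_one
  map_mul' _ _ := (FractionalIdeal.spanSingleton_mul_spanSingleton ..).symm

variable {L}

theorem dv_algebraMap (z : CoordRing F E) :
    dv F E L (algebraMap (CoordRing F E) L z) =
      ((Ideal.span {z} : Ideal (CoordRing F E)) : FractionalIdeal (CoordRing F E)⁰ L) :=
  (FractionalIdeal.coeIdeal_span_singleton z).symm

theorem dv_ne_zero {f : L} (hf : f ≠ 0) : dv F E L f ≠ 0 := (_root_.map_ne_zero _).mpr hf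

theorem dv_const {c : F} (hc : c ≠ 0) : dv F E L (algebraMap F L c) = 1 := by
  rw [IsScalarTower.algebraMap_apply F (CoordRing F E) L, dv_algebraMap,
    Ideal.span_singleton_eq_top.mpr ((IsUnit.mk0 c hc).map _)]
  rfl

/-- Generators of one fractional ideal differ by a unit of the coordinate ring, hence by a constant;
no condition at infinity is needed. -/
theorem exists_const_of_dv_eq {f g : L} (h : dv F E L f = dv F E L g) :
    ∃ c : F, c ≠ 0 ∧ g = algebraMap F L c * f := by
  obtain ⟨z, hz⟩ := FractionalIdeal.spanSingleton_eq_spanSingleton.mp h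
  obtain ⟨c, hc, hzc⟩ := isUnit_coordRing_eq E z
  refine ⟨c, hc, ?_⟩
  rw [← hz, Units.smul_def, Algebra.smul_def, hzc, ← IsScalarTower.algebraMap_apply]

variable {F} {E} (L)

/-- The maximal ideal of a point, as a fractional ideal. -/
def pointDiv (A : (E.baseChange F).toAffine.Point) : FractionalIdeal (CoordRing F E)⁰ L :=
  (pointIdeal E A : Ideal (CoordRing F E))

theorem pointDiv_zero : pointDiv L (0 : (E.baseChange F).toAffine.Point) = 1 :=
  (congrArg (fun I : Ideal (CoordRing F E) => (I : FractionalIdeal (CoordRing F E)⁰ L))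
    ((rfl : pointIdeal E 0 = 1).trans Ideal.one_eq_top)).trans (FractionalIdeal.coeIdeal_top _)

theorem pointDiv_mul_neg {x y : F} (h : (E.baseChange F).toAffine.Nonsingular x y) :
    pointDiv L (.some x y h) * pointDiv L (-.some x y h) =
      dv F E L (genX (F := F) E L - algebraMap F L x) := by
  rw [mul_comm, Affine.Point.neg_some]
  have := congrArg (fun I : Ideal (CoordRing F E) => (I : FractionalIdeal (CoordRing F E)⁰ L))
    (Affine.CoordinateRing.XYIdeal_neg_mul h)
  simp only [FractionalIdeal.coeIdeal_mul] at this
  refine this.trans ?_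
  rw [Affine.CoordinateRing.XIdeal, ← dv_algebraMap]
  congr 1
  refine (algebraMap_coordRing_of E L (X - C x)).trans ?_
  simp

theorem genX_sub_ne_zero (x : F) : genX (F := F) E L - algebraMap F L x ≠ 0 := fun h =>
  genX_transcendental (F := F) E L (sub_eq_zero.mp h ▸ isAlgebraic_algebraMap x)

theorem pointDiv_ne_zero (A : (E.baseChange F).toAffine.Point) : pointDiv L A ≠ 0 := by
  rcases A with _ | ⟨x, y, h⟩
  · exact (pointDiv_zero L).trans_ne one_ne_zero
  · exact left_ne_zero_of_mul ((pointDiv_mul_neg L h).trans_ne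
      (dv_ne_zero F E (genX_sub_ne_zero L x)))

variable [DecidableEq F] [DecidableEq L]

/-- The ideal identities behind the group law, read as the divisor of a line over a vertical. The
origin leaves no trace, since `pointDiv` is 1 there. -/
theorem dv_miller_genPoint (A B : (E.baseChange F).toAffine.Point) :
    dv F E L (miller (constPoint L A) (constPoint L B) (genPoint F E L)) * pointDiv L (A + B) =
      pointDiv L A * pointDiv L B := by
  by_cases hA : A = 0
  · rw [hA, map_zero, miller_zero_left, map_one, zero_add, pointDiv_zero]
  by_cases hB : B = 0
  · rw [hB, map_zero, miller_zero_mid, map_one, add_zero, pointDiv_zero, mul_comm]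
  rcases A with _ | ⟨x₁, y₁, h₁⟩
  · exact absurd rfl hA
  rcases B with _ | ⟨x₂, y₂, h₂⟩
  · exact absurd rfl hB
  by_cases hxy : x₁ = x₂ ∧ y₁ = (E.baseChange F).toAffine.negY x₂ y₂
  · have hB : Affine.Point.some x₂ y₂ h₂ = -.some x₁ y₁ h₁ := by
      rw [Affine.Point.neg_some, Affine.Point.some.injEq]
      exact ⟨hxy.1.symm, by rw [hxy.1, hxy.2, Affine.negY_negY]⟩
    rw [hB, add_neg_cancel, pointDiv_zero, mul_one, pointDiv_mul_neg, map_neg]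
    congr 1
    exact miller_some_of_eq _ _ _ ⟨rfl, (Affine.negY_negY _ _).symm⟩
  · have hm : miller (constPoint L (.some x₁ y₁ h₁)) (constPoint L (.some x₂ y₂ h₂))
        (genPoint F E L) = (genY (F := F) E L - (algebraMap F L
          ((E.baseChange F).toAffine.slope x₁ x₂ y₁ y₂) * (genX (F := F) E L - algebraMap F L x₁) +
            algebraMap F L y₁)) / (genX (F := F) E L - algebraMap F L
            ((E.baseChange F).toAffine.addX x₁ x₂ ((E.baseChange F).toAffine.slope x₁ x₂ y₁ y₂))) := by
      refine (miller_some_of_ne _ _ _ fun h' => hxy ⟨(algebraMap F L).injective h'.1,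
        (algebraMap F L).injective ?_⟩).trans ?_
      · exact h'.2.trans (Affine.baseChange_negY (IsScalarTower.toAlgHom K F L) x₂ y₂)
      · have hs := Affine.baseChange_slope (R := K) (W' := E) (IsScalarTower.toAlgHom K F L) x₁ x₂ y₁ y₂
        have hx := Affine.baseChange_addX (R := K) (W' := E) (IsScalarTower.toAlgHom K F L) x₁ x₂
          ((E.baseChange F).toAffine.slope x₁ x₂ y₁ y₂)
        rw [← hs] at hx
        exact congrArg₂ (fun s t => (genY (F := F) E L - (s * (genX (F := F) E L -
          algebraMap F L x₁) + algebraMap F L y₁)) / (genX (F := F) E L - t)) hs hx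
    rw [hm, map_div₀, Affine.Point.add_some hxy, div_mul_eq_mul_div,
      div_eq_iff (dv_ne_zero F E (genX_sub_ne_zero L _)), mul_comm (pointDiv L _ * _)]
    have := congrArg (fun I : Ideal (CoordRing F E) => (I : FractionalIdeal (CoordRing F E)⁰ L))
      (Affine.CoordinateRing.XYIdeal_mul_XYIdeal h₁.1 h₂.1 hxy)
    simp only [FractionalIdeal.coeIdeal_mul] at this
    refine Eq.trans (congrArg (· * _) ?_) (this.symm.trans (congrArg (· * _) ?_))
    · rw [Affine.CoordinateRing.YIdeal, ← dv_algebraMap]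
      congr 1
      rw [Affine.CoordinateRing.YClass, map_sub, map_sub]
      refine congrArg₂ _ rfl ?_
      refine Eq.trans ?_ (algebraMap_coordRing_of E L _).symm
      simp [Affine.linePolynomial]
    · rw [Affine.CoordinateRing.XIdeal, ← dv_algebraMap]
      congr 1
      refine (algebraMap_coordRing_of E L (X - C _)).trans ?_
      simp

theorem eq_zero_of_dv_eq_pointDiv {T : (E.baseChange F).toAffine.Point} {h : CoordRing F E}
    (h0 : h ≠ 0) (hT : pointIdeal E T = Ideal.span {h}) : T = 0 := by
  rcases T with _ | ⟨x, y, hxy⟩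
  · rfl
  · exact (Affine.Point.toClass_eq_zero _).mp
      ((ClassGroup.mk_eq_one_of_coe_ideal (by rfl)).mpr ⟨h, h0, hT⟩)

/-- Unique factorisation reduces the equality of n-th powers to (h) being the ideal of T. The class
of T is then trivial, and a point is determined by its class. -/
theorem eq_zero_of_dv_pow_eq {T : (E.baseChange F).toAffine.Point} {h : L} {n : ℕ} (hn : n ≠ 0)
    (hT : dv F E L h ^ n = pointDiv L T ^ n) : T = 0 := by
  by_cases hT0 : T = 0
  · exact hT0
  have hpr : (pointIdeal E T).IsPrime := by
    rcases T with _ | ⟨x, y, hxy⟩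
    · exact absurd rfl hT0
    · exact (XYIdeal_isMaximal hxy.1).isPrime
  have hle : dv F E L (h ^ n) ≤ 1 := by
    rw [map_pow, hT, pointDiv, ← FractionalIdeal.coeIdeal_pow]
    exact FractionalIdeal.coeIdeal_le_one
  have hint : IsIntegral (CoordRing F E) (h ^ n) := by
    have := hle (FractionalIdeal.mem_spanSingleton_self _ _)
    obtain ⟨r, hr⟩ := (FractionalIdeal.mem_one_iff _).mp this
    rw [← hr]
    exact isIntegral_algebraMap
  obtain ⟨r, rfl⟩ := IsIntegrallyClosed.isIntegral_iff.mp (IsIntegral.of_pow (Nat.pos_of_ne_zero hn) hint)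
  rw [dv_algebraMap, pointDiv, ← FractionalIdeal.coeIdeal_pow, ← FractionalIdeal.coeIdeal_pow,
    FractionalIdeal.coeIdeal_inj] at hT
  have hr : r ∈ pointIdeal E T := by
    refine hpr.mem_of_pow_mem n (Ideal.pow_le_self hn (hT ▸ ?_))
    exact Ideal.pow_mem_pow (Ideal.mem_span_singleton_self r) n
  have hI0 : pointIdeal E T ≠ ⊥ := fun h => pointDiv_ne_zero L T (by
    rw [pointDiv, h, FractionalIdeal.coeIdeal_bot])
  obtain ⟨J, hJ⟩ := Ideal.dvd_iff_le.mpr ((Ideal.span_singleton_le_iff_mem _).mpr hr)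
  rw [hJ, mul_pow] at hT
  have hJ1 : J ^ n = 1 := mul_left_cancel₀ (pow_ne_zero n hI0) (hT.trans (mul_one _).symm)
  have : J = 1 := by
    rw [Ideal.one_eq_top, eq_top_iff, ← Ideal.one_eq_top, ← hJ1]
    exact Ideal.pow_le_self hn
  rw [this, mul_one] at hJ
  refine eq_zero_of_dv_eq_pointDiv (h := r) ?_ hJ.symm
  rintro rfl
  exact hI0 (by simpa using hJ.symm)

end Divisor

/-! ### Translations and multiplication by n on the function field. -/

section Translation

open Polynomial
open scoped nonZeroDivisors

theorem mem_range_algebraMap_of_isAlgebraic {F L : Type*} [Field F] [Field L] [Algebra F L]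
    [IsAlgClosed F] {x : L} (h : IsAlgebraic F x) : x ∈ Set.range (algebraMap F L) :=
  minpoly.mem_range_of_degree_eq_one F x
    (IsAlgClosed.degree_eq_one_of_irreducible F (minpoly.irreducible h.isIntegral))

variable {K F : Type*} [Field K] [Field F] [Algebra K F] {E : WeierstrassCurve K}
  {L : Type*} [Field L] [Algebra K L] [Algebra F L] [IsScalarTower K F L]
  [Algebra (CoordRing F E) L] [IsFractionRing (CoordRing F E) L]
  [IsScalarTower F (CoordRing F E) L] [IsAlgClosed F] [E.IsElliptic]
  [DecidableEq F] [DecidableEq L]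
  {Ω : Type*} [Field Ω] [Algebra K Ω] [Algebra F Ω] [IsScalarTower K F Ω] [DecidableEq Ω]

theorem transcendental_of_not_mem_range {x y : Ω} {h : (E.baseChange Ω).toAffine.Nonsingular x y}
    (hA : Affine.Point.some x y h ∉ Set.range (constPoint (E := E) (F := F) Ω)) :
    Transcendental F x := by
  intro hx
  refine hA ?_
  obtain ⟨u, rfl⟩ := mem_range_algebraMap_of_isAlgebraic hx
  have hy : IsAlgebraic F y := by
    have hne (p q : F) : X ^ 2 + C p * X - C q ≠ 0 := fun h0 => by
      have := congrArg (fun p => p.coeff 2) h0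
      simp at this
    refine ⟨X ^ 2 + C ((E.baseChange F).a₁ * u + (E.baseChange F).a₃) * X -
      C (u ^ 3 + (E.baseChange F).a₂ * u ^ 2 + (E.baseChange F).a₄ * u + (E.baseChange F).a₆),
      hne _ _, ?_⟩
    · have := (Affine.equation_iff _ _).mp h.1
      simp only [WeierstrassCurve.baseChange, WeierstrassCurve.map_a₁, map_a₂, map_a₃, map_a₄,
        map_a₆, map_sub, map_add, map_mul, map_pow, aeval_X, aeval_C,
        ← IsScalarTower.algebraMap_apply] at this ⊢
      linear_combination this
  obtain ⟨v, rfl⟩ := mem_range_algebraMap_of_isAlgebraic hy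
  exact ⟨.some u v ((Affine.baseChange_nonsingular E (IsScalarTower.toAlgHom K F Ω).injective ..).mp h),
    rfl⟩

/-- A point not defined over F has transcendental x-coordinate, so it is a specialisation of the
generic point. Together with `algHom_ext_genPoint`, embeddings of the function field correspond to
nonconstant points, and identities between embeddings are checked on the generic point. -/
theorem exists_algHom_of_not_mem_range {A : (E.baseChange Ω).toAffine.Point}
    (hA : A ∉ Set.range (constPoint (E := E) (F := F) Ω)) :
    ∃ f : L →ₐ[F] Ω, Affine.Point.map (W' := E) f (genPoint F E L) = A := by
  rcases A with _ | ⟨x, y, h⟩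
  · exact absurd ⟨0, rfl⟩ hA
  have hx := transcendental_of_not_mem_range hA
  have he : (E.baseChange F).map (algebraMap F Ω) = E.baseChange Ω := by
    simp only [WeierstrassCurve.baseChange, WeierstrassCurve.map_map]
    rw [← IsScalarTower.algebraMap_eq]
  obtain ⟨f, hf, hfx, hfy⟩ := exists_ringHom_of_equation (E := E) L (algebraMap F Ω) (u := x)
    (v := y) (he ▸ h.1) fun p hp => by
      by_contra hne
      exact hx ⟨p, hne, hp⟩
  refine ⟨{ f with commutes' := fun c => DFunLike.congr_fun hf c }, ?_⟩
  rw [genPoint, Affine.Point.map_some, Affine.Point.some.injEq]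
  exact ⟨hfx, hfy⟩

theorem algHom_ext_genPoint {f g : L →ₐ[F] Ω} (h : Affine.Point.map (W' := E) f (genPoint F E L) =
    Affine.Point.map (W' := E) g (genPoint F E L)) : f = g := by
  rw [genPoint, Affine.Point.map_some, Affine.Point.map_some, Affine.Point.some.injEq] at h
  have : (f : L →+* Ω) = g := ringHom_ext E L
    (by rw [AlgHom.comp_algebraMap, AlgHom.comp_algebraMap]) h.1 h.2
  exact AlgHom.coe_ringHom_injective this

theorem map_constPoint (f : L →ₐ[F] Ω) (A : (E.baseChange F).toAffine.Point) :
    Affine.Point.map (W' := E) f (constPoint L A) = constPoint Ω A := by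
  rcases A with _ | ⟨x, y, h⟩
  · rfl
  · simp only [constPoint, Affine.Point.map_some, Affine.Point.some.injEq]
    exact ⟨f.commutes x, f.commutes y⟩

theorem constPoint_injective : Function.Injective (constPoint (E := E) (F := F) Ω) :=
  Affine.Point.map_injective _

theorem hasXDegree_nsmul_genPoint {n : ℕ} (hn : n ≠ 0) :
    HasXDegree (F := F) (genX (F := F) E L) (n • genPoint F E L) (n ^ 2) := by
  have hb : ∀ a : K, algebraMap K L a = algebraMap F L (algebraMap K F a) :=
    fun a => IsScalarTower.algebraMap_apply K F L a
  have h₂ : (E.baseChange L).b₂ = algebraMap F L (E.baseChange F).b₂ := by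
    simp only [WeierstrassCurve.baseChange, map_b₂, hb]
  have h₄ : (E.baseChange L).b₄ = algebraMap F L (E.baseChange F).b₄ := by
    simp only [WeierstrassCurve.baseChange, map_b₄, hb]
  have h₆ : (E.baseChange L).b₆ = algebraMap F L (E.baseChange F).b₆ := by
    simp only [WeierstrassCurve.baseChange, map_b₆, hb]
  have h₈ : (E.baseChange L).b₈ = algebraMap F L (E.baseChange F).b₈ := by
    simp only [WeierstrassCurve.baseChange, map_b₈, hb]
  exact hasXDegree_nsmul (E.baseChange F) h₂ h₄ h₆ h₈ (genX_transcendental E L) _ hn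

/-- The x-coordinate of nη has degree n² > 0 in x, so it is not constant. -/
theorem nsmul_genPoint_not_mem_range {n : ℕ} (hn : n ≠ 0) :
    n • genPoint F E L ∉ Set.range (constPoint (E := E) (F := F) L) := by
  rintro ⟨A, hA⟩
  obtain ⟨a, b, hab, hb0, hdeg, y, h, hP⟩ := hasXDegree_nsmul_genPoint (E := E) (F := F) (L := L) hn
  rw [← hA] at hP
  rcases A with _ | ⟨u, v, huv⟩
  · exact absurd hP.symm (Affine.Point.some_ne_zero _)
  have hu : algebraMap F L u = aeval (genX (F := F) E L) a / aeval (genX (F := F) E L) b :=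
    (Affine.Point.some.inj hP).1
  have hinj := transcendental_iff_injective.mp (genX_transcendental (F := F) E L)
  have hbne : aeval (genX (F := F) E L) b ≠ 0 := (map_ne_zero_iff _ hinj).mpr hb0
  have hab' : a = C u * b := by
    apply hinj
    rw [map_mul, aeval_C, hu, div_mul_cancel₀ _ hbne]
  have hbu : IsUnit b := hab.isUnit_of_dvd' (hab' ▸ Dvd.intro_left _ rfl) dvd_rfl
  have h1 : b.natDegree = 0 := natDegree_eq_zero_of_isUnit hbu
  have h2 : a.natDegree ≤ 0 := hab' ▸ (natDegree_C_mul_le u b).trans h1.le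
  have : n ^ 2 = 0 := by omega
  exact hn (pow_eq_zero_iff two_ne_zero |>.mp this)

theorem genPoint_not_mem_range :
    genPoint F E L ∉ Set.range (constPoint (E := E) (F := F) L) := by
  simpa using nsmul_genPoint_not_mem_range (E := E) (F := F) (L := L) one_ne_zero

theorem add_constPoint_not_mem_range {X : (E.baseChange Ω).toAffine.Point}
    (hX : X ∉ Set.range (constPoint (E := E) (F := F) Ω)) (A : (E.baseChange F).toAffine.Point) :
    X + constPoint Ω A ∉ Set.range (constPoint (E := E) (F := F) Ω) := by
  rintro ⟨B, hB⟩
  exact hX ⟨B - A, by rw [map_sub, hB, add_sub_cancel_right]⟩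

theorem xNe_of_not_mem_range {X : (E.baseChange Ω).toAffine.Point}
    (hX : X ∉ Set.range (constPoint (E := E) (F := F) Ω)) (A : (E.baseChange F).toAffine.Point) :
    XNe X (constPoint Ω A) :=
  ⟨fun h => hX ⟨A, h.symm⟩, fun h => hX ⟨-A, by rw [h, map_neg]⟩⟩

theorem ne_zero_of_not_mem_range {X : (E.baseChange Ω).toAffine.Point}
    (hX : X ∉ Set.range (constPoint (E := E) (F := F) Ω)) : X ≠ 0 :=
  fun h => hX ⟨0, by rw [h, map_zero]⟩

variable (L) in
/-- The automorphism of the function field induced by translation by `A`. -/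
def translation (A : (E.baseChange F).toAffine.Point) : L →ₐ[F] L :=
  (exists_algHom_of_not_mem_range (E := E) (F := F) (L := L)
    (add_constPoint_not_mem_range genPoint_not_mem_range A)).choose

theorem map_translation (A : (E.baseChange F).toAffine.Point) :
    Affine.Point.map (W' := E) (translation L A) (genPoint F E L) =
      genPoint F E L + constPoint L A :=
  (exists_algHom_of_not_mem_range (E := E) (F := F) (L := L)
    (add_constPoint_not_mem_range genPoint_not_mem_range A)).choose_spec

variable (F E L) in
/-- The endomorphism of the function field induced by multiplication by `n`. -/
def mulPullback (n : ℕ) [NeZero n] : L →ₐ[F] L :=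
  (exists_algHom_of_not_mem_range (E := E) (F := F) (L := L)
    (nsmul_genPoint_not_mem_range (NeZero.ne n))).choose

theorem map_mulPullback (n : ℕ) [NeZero n] :
    Affine.Point.map (W' := E) (mulPullback F E L n) (genPoint F E L) = n • genPoint F E L :=
  (exists_algHom_of_not_mem_range (E := E) (F := F) (L := L)
    (nsmul_genPoint_not_mem_range (NeZero.ne n))).choose_spec

theorem translation_zero : translation L (0 : (E.baseChange F).toAffine.Point) = .id F L := by
  refine algHom_ext_genPoint (E := E) ?_
  rw [map_translation, map_zero, add_zero]
  exact (Affine.Point.map_id (W' := E) _).symm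

theorem translation_comp (A B : (E.baseChange F).toAffine.Point) :
    (translation L A).comp (translation L B) = translation L (A + B) := by
  refine algHom_ext_genPoint (E := E) ?_
  rw [← Affine.Point.map_map, map_translation, map_translation, map_add, map_translation,
    map_constPoint, map_add, add_assoc]

theorem translation_translation (A B : (E.baseChange F).toAffine.Point) (f : L) :
    translation L A (translation L B f) = translation L (A + B) f :=
  DFunLike.congr_fun (translation_comp A B) f

theorem translation_mulPullback (n : ℕ) [NeZero n] (A : (E.baseChange F).toAffine.Point) (f : L) :
    translation L A (mulPullback F E L n f) = mulPullback F E L n (translation L (n • A) f) := by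
  have : (translation L A).comp (mulPullback F E L n) =
      (mulPullback F E L n).comp (translation L (n • A)) := by
    refine algHom_ext_genPoint (E := E) ?_
    rw [← Affine.Point.map_map, ← Affine.Point.map_map, map_mulPullback, map_nsmul,
      map_translation, map_translation, map_add, map_mulPullback, map_constPoint, map_nsmul,
      nsmul_add]
  exact DFunLike.congr_fun this f

theorem infinite_point : Infinite (E.baseChange F).toAffine.Point := by
  have : Infinite F := IsAlgClosed.instInfinite
  let x : (E.baseChange F).toAffine.Point → F
    | .zero => 0
    | .some x _ _ => x
  refine Infinite.of_surjective x fun u => ?_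
  let p : F[X] := X ^ 2 + C ((E.baseChange F).a₁ * u + (E.baseChange F).a₃) * X -
      C (u ^ 3 + (E.baseChange F).a₂ * u ^ 2 + (E.baseChange F).a₄ * u + (E.baseChange F).a₆)
  have hp : p.degree = 2 := by
    simp only [p]
    generalize (E.baseChange F).a₁ * u + (E.baseChange F).a₃ = r
    generalize u ^ 3 + (E.baseChange F).a₂ * u ^ 2 + (E.baseChange F).a₄ * u +
      (E.baseChange F).a₆ = s
    compute_degree!
  obtain ⟨v, hv⟩ := IsAlgClosed.exists_root p (by rw [hp]; exact two_ne_zero)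
  have he : (E.baseChange F).toAffine.Equation u v := by
    rw [Affine.equation_iff]
    simp only [p, IsRoot.def, eval_sub, eval_add, eval_mul, eval_pow, eval_X, eval_C] at hv
    linear_combination hv
  exact ⟨.some u v ((E.baseChange F).toAffine.equation_iff_nonsingular.mp he), rfl⟩

end Translation

/-! ### Divisors and multiplicative relations of Miller functions. -/

section MillerFunction

open scoped nonZeroDivisors

variable {K F : Type*} [Field K] [Field F] [Algebra K F] {E : WeierstrassCurve K}
  {L : Type*} [Field L] [Algebra K L] [Algebra F L] [IsScalarTower K F L]
  [Algebra (CoordRing F E) L] [IsFractionRing (CoordRing F E) L]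
  [IsScalarTower F (CoordRing F E) L] [IsAlgClosed F] [E.IsElliptic]
  [DecidableEq F] [DecidableEq L]

theorem constPoint_xNe {A B : (E.baseChange F).toAffine.Point} (h : XNe A B) :
    XNe (constPoint L A) (constPoint L B) :=
  ⟨fun he => h.1 (constPoint_injective he),
    fun he => h.2 (constPoint_injective (he.trans (map_neg _ B).symm))⟩

theorem miller_constPoint (A B Z : (E.baseChange F).toAffine.Point) :
    miller (constPoint L A) (constPoint L B) (constPoint L Z) = algebraMap F L (miller A B Z) :=
  miller_map (IsScalarTower.toAlgHom K F L) A B Z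

variable (L) in
/-- The function with divisor `(A) + (B) - (A + B) - (0)`. -/
def millerFun (A B : (E.baseChange F).toAffine.Point) : L :=
  miller (constPoint L A) (constPoint L B) (genPoint F E L)

theorem millerFun_ne_zero (A B : (E.baseChange F).toAffine.Point) : millerFun L A B ≠ 0 := by
  refine miller_ne_zero (xNe_of_not_mem_range genPoint_not_mem_range A)
    (xNe_of_not_mem_range genPoint_not_mem_range B) ?_
  rw [← map_add]
  exact xNe_of_not_mem_range genPoint_not_mem_range (A + B)

theorem dv_millerFun (A B : (E.baseChange F).toAffine.Point) :
    dv F E L (millerFun L A B) = pointDiv L A * pointDiv L B / pointDiv L (A + B) :=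
  (eq_div_iff (pointDiv_ne_zero L _)).mpr (dv_miller_genPoint L A B)

theorem translation_millerFun (A B Z : (E.baseChange F).toAffine.Point) :
    translation L Z (millerFun L A B) =
      miller (constPoint L A) (constPoint L B) (genPoint F E L + constPoint L Z) := by
  rw [millerFun, ← miller_map (E := E) (translation L Z), map_constPoint, map_constPoint,
    map_translation]

theorem dv_of_sq_eq_one {ε : L} (h : ε ^ 2 = 1) : dv F E L ε = 1 := by
  rcases mul_self_eq_one_iff.mp ((sq ε).symm.trans h) with rfl | rfl
  · exact map_one _
  · have := dv_const F E (L := L) (c := (-1 : F)) (by simp)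
    simpa using this

/-- The line of `η` and `Y`, evaluated at `A`. -/
theorem dv_miller_genPoint_left {A Y : (E.baseChange F).toAffine.Point} (hY : Y ≠ 0)
    (hYA : XNe Y A) : dv F E L (miller (genPoint F E L) (constPoint L Y) (constPoint L A)) =
      pointDiv L A * pointDiv L (-Y) / pointDiv L (A - Y) := by
  have hg := genPoint_not_mem_range (E := E) (F := F) (L := L)
  obtain ⟨ε, hε, h⟩ := miller_comm_third (A := constPoint L A) (X := genPoint F E L)
    (Y := constPoint L Y) (ne_zero_of_not_mem_range hg)
    ((map_ne_zero_iff _ constPoint_injective).mpr hY) (xNe_of_not_mem_range hg Y)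
    (xNe_of_not_mem_range hg A) (constPoint_xNe hYA)
    (xNe_of_not_mem_range (add_constPoint_not_mem_range hg Y) A)
    (by rw [← map_sub]; exact xNe_of_not_mem_range hg (A - Y))
  rw [h, map_mul, dv_of_sq_eq_one hε, one_mul, ← map_neg, sub_eq_add_neg A Y]
  exact dv_millerFun A (-Y)

/-- Translation moves the origin and does not preserve the coordinate ring, so ideals cannot be
transported directly. Reciprocity for η and Y instead expresses f(η + Y) by f(η) and by Miller
values with η as first argument, whose divisors are known. -/
theorem dv_translation_millerFun_of_xNe {A B Y : (E.baseChange F).toAffine.Point} (hY : Y ≠ 0)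
    (hYA : XNe Y A) (hYB : XNe Y B) (hYAB : XNe Y (A + B)) :
    dv F E L (translation L Y (millerFun L A B)) =
      pointDiv L (A - Y) * pointDiv L (B - Y) / (pointDiv L (A + B - Y) * pointDiv L (-Y)) := by
  have hg := genPoint_not_mem_range (E := E) (F := F) (L := L)
  have hgY := add_constPoint_not_mem_range hg Y
  obtain ⟨ε, hε, h⟩ := miller_reciprocity (A := constPoint L A) (B := constPoint L B)
    (X := genPoint F E L) (Y := constPoint L Y) (ne_zero_of_not_mem_range hg)
    ((map_ne_zero_iff _ constPoint_injective).mpr hY) (ne_zero_of_not_mem_range hgY)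
    (xNe_of_not_mem_range hg A) (xNe_of_not_mem_range hg B)
    (by rw [← map_add]; exact xNe_of_not_mem_range hg (A + B))
    (constPoint_xNe hYA) (constPoint_xNe hYB) (by rw [← map_add]; exact constPoint_xNe hYAB)
    (xNe_of_not_mem_range hgY A) (xNe_of_not_mem_range hgY B)
    (by rw [← map_add]; exact xNe_of_not_mem_range hgY (A + B))
  rw [← translation_millerFun, ← map_add, miller_constPoint] at h
  have h := congrArg (dv F E L) h
  simp only [map_mul] at h
  rw [dv_of_sq_eq_one hε, dv_const F E (miller_ne_zero hYA hYB hYAB),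
    dv_miller_genPoint_left hY hYA, dv_miller_genPoint_left hY hYB,
    dv_miller_genPoint_left hY hYAB, ← millerFun, dv_millerFun, one_mul, mul_one] at h
  have h1 := pointDiv_ne_zero L (A - Y)
  have h2 := pointDiv_ne_zero L (B - Y)
  have h3 := pointDiv_ne_zero L (A + B - Y)
  have h4 := pointDiv_ne_zero L (-Y)
  have h5 := pointDiv_ne_zero L A
  have h6 := pointDiv_ne_zero L B
  have h7 := pointDiv_ne_zero L (A + B)
  field_simp at h ⊢
  exact h

theorem exists_generic (S : Finset (E.baseChange F).toAffine.Point)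
    (Z : (E.baseChange F).toAffine.Point) :
    ∃ W, ∀ A ∈ S, XNe W A ∧ XNe (Z + W) A := by
  have := infinite_point (E := E) (F := F)
  classical
  obtain ⟨W, hW⟩ := Infinite.exists_notMem_finset
    (S ∪ S.image (- ·) ∪ S.image (· - Z) ∪ S.image (- · - Z))
  simp only [Finset.mem_union, Finset.mem_image, not_or, not_exists, not_and] at hW
  exact ⟨W, fun A hA => ⟨⟨fun h => hW.1.1.1 (h ▸ hA), fun h => hW.1.1.2 A hA h.symm⟩,
    fun h => hW.1.2 A hA (by rw [← h, add_sub_cancel_left]),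
    fun h => hW.2 A hA (by rw [← h, add_sub_cancel_left])⟩⟩

/-- The function u is built to have the expected divisor. After a further translation by a generic
W, both u and f(· + Z) fall under the generic case and have equal divisors, so they differ by a
constant, which translation fixes. -/
theorem dv_translation_millerFun (A B Z : (E.baseChange F).toAffine.Point) :
    dv F E L (translation L Z (millerFun L A B)) =
      pointDiv L (A - Z) * pointDiv L (B - Z) / (pointDiv L (A + B - Z) * pointDiv L (-Z)) := by
  classical
  obtain ⟨W, hW⟩ := exists_generic {0, A, B, A + B, A - Z, B - Z, A - Z + (B - Z), A + B - Z, -Z,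
    A + B - Z + -Z} Z
  simp only [Finset.mem_insert, Finset.mem_singleton, forall_eq_or_imp, forall_eq] at hW
  obtain ⟨⟨w0, z0⟩, ⟨-, zA⟩, ⟨-, zB⟩, ⟨-, zAB⟩, ⟨wA, -⟩, ⟨wB, -⟩, ⟨wAB, -⟩, ⟨wC, -⟩, ⟨wZ, -⟩,
    ⟨wD, -⟩⟩ := hW
  set u : L := millerFun L (A - Z) (B - Z) / millerFun L (A + B - Z) (-Z) with hu
  have e1 : A - Z + (B - Z) = A + B - Z + -Z := by abel
  have hdu : dv F E L u = pointDiv L (A - Z) * pointDiv L (B - Z) /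
      (pointDiv L (A + B - Z) * pointDiv L (-Z)) := by
    have h7 := pointDiv_ne_zero L (A + B - Z + -Z)
    have h3 := pointDiv_ne_zero L (A + B - Z)
    have h4 := pointDiv_ne_zero L (-Z)
    rw [hu, map_div₀, dv_millerFun, dv_millerFun, e1]
    field_simp
  have key : dv F E L (translation L W u) =
      dv F E L (translation L W (translation L Z (millerFun L A B))) := by
    rw [translation_translation, add_comm W Z, dv_translation_millerFun_of_xNe z0.1 zA zB zAB,
      hu, map_div₀, map_div₀, dv_translation_millerFun_of_xNe w0.1 wA wB wAB,
      dv_translation_millerFun_of_xNe w0.1 wC wZ wD, e1, sub_sub A, sub_sub B, sub_sub (A + B),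
      ← neg_add']
    have h1 := pointDiv_ne_zero L (A + B - Z + -Z - W)
    have h2 := pointDiv_ne_zero L (-W)
    have h3 := pointDiv_ne_zero L (A + B - (Z + W))
    have h4 := pointDiv_ne_zero L (-(Z + W))
    field_simp
  obtain ⟨c, hc, h⟩ := exists_const_of_dv_eq F E key
  rw [← AlgHom.commutes (translation L W), ← map_mul] at h
  rw [(translation L W).injective h, map_mul, dv_const F E hc, one_mul, hdu]

/-- The function with divisor `n (T) - n (0)`, for an `n`-torsion point `T`. -/
def weilFun (n : ℕ) (T : (E.baseChange F).toAffine.Point) (Z : (E.baseChange L).toAffine.Point) : L :=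
  ∏ k ∈ Finset.range n, miller (constPoint L (k • T)) (constPoint L T) Z

theorem weilFun_genPoint (n : ℕ) (T : (E.baseChange F).toAffine.Point) :
    weilFun n T (genPoint F E L) = ∏ k ∈ Finset.range n, millerFun L (k • T) T := rfl

theorem weilFun_genPoint_ne_zero (n : ℕ) (T : (E.baseChange F).toAffine.Point) :
    weilFun n T (genPoint F E L) ≠ 0 :=
  Finset.prod_ne_zero_iff.mpr fun _ _ => millerFun_ne_zero _ _

/-- The divisors (kT) + (T) - ((k + 1)T) - (0) telescope over k < n, since nT = 0. -/
theorem dv_translation_weilFun {n : ℕ} {T : (E.baseChange F).toAffine.Point} (hT : n • T = 0)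
    (Z : (E.baseChange F).toAffine.Point) :
    dv F E L (translation L Z (weilFun n T (genPoint F E L))) =
      pointDiv L (T - Z) ^ n / pointDiv L (-Z) ^ n := by
  have h0 := pointDiv_ne_zero L (-Z)
  have key : ∀ m : ℕ, dv F E L (translation L Z (weilFun m T (genPoint F E L))) =
      pointDiv L (T - Z) ^ m * pointDiv L (-Z) / (pointDiv L (m • T - Z) * pointDiv L (-Z) ^ m) := by
    intro m
    induction m with
    | zero => simp [weilFun, div_self h0]
    | succ m ih =>
      have h1 := pointDiv_ne_zero L (m • T - Z)
      have h2 := pointDiv_ne_zero L (m • T + T - Z)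
      rw [weilFun_genPoint, Finset.prod_range_succ, map_mul, map_mul, ← weilFun_genPoint, ih,
        dv_translation_millerFun, succ_nsmul]
      field_simp
      ring
  rw [key, hT, zero_sub]
  field_simp

theorem dv_weilFun {n : ℕ} {T : (E.baseChange F).toAffine.Point} (hT : n • T = 0) :
    dv F E L (weilFun n T (genPoint F E L)) = pointDiv L T ^ n := by
  have := dv_translation_weilFun (L := L) hT 0
  rwa [translation_zero, sub_zero, neg_zero, pointDiv_zero, one_pow, div_one] at this

/-- The functions `f_P`, up to constants, multiply up to translation. -/
theorem exists_weilFun_mul {n : ℕ} {P Q : (E.baseChange F).toAffine.Point} (hP : n • P = 0)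
    (hQ : n • Q = 0) : ∃ c : F, c ≠ 0 ∧ weilFun n P (genPoint F E L) *
      translation L (-P) (weilFun n Q (genPoint F E L)) =
        algebraMap F L c * weilFun n (P + Q) (genPoint F E L) := by
  refine exists_const_of_dv_eq F E ?_
  rw [map_mul, dv_weilFun hP, dv_translation_weilFun hQ, dv_weilFun (by rw [nsmul_add, hP, hQ,
    add_zero]), neg_neg, sub_neg_eq_add, mul_div_cancel₀ _ (pow_ne_zero n (pointDiv_ne_zero L P)),
    add_comm]

/-- In the product over k < n of the reciprocity laws for (kT, T) and (X, η), the values at kT and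
at (k + 1)T cancel because nT = 0. With g the Miller function of X and η this leaves f_T(X + η)
g(T)^n = ± f_T(X) f_T(η): f_T is additive modulo n-th powers and signs. -/
theorem exists_weilFun_nsmul {n : ℕ} {T : (E.baseChange F).toAffine.Point} (hT : n • T = 0)
    (m : ℕ) : ∃ ε h : L, ε ^ 2 = 1 ∧
      weilFun n T ((m + 1) • genPoint F E L) =
        ε * weilFun n T (genPoint F E L) ^ (m + 1) * h ^ n := by
  have hg := genPoint_not_mem_range (E := E) (F := F) (L := L)
  have hmg (m : ℕ) := nsmul_genPoint_not_mem_range (E := E) (F := F) (L := L) (Nat.succ_ne_zero m)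
  induction m with
  | zero => exact ⟨1, 1, by simp⟩
  | succ m ih =>
    obtain ⟨ε, h, hε, ih⟩ := ih
    set X := (m + 1) • genPoint F E L with hX
    have hXr : X ∉ Set.range (constPoint (E := E) (F := F) L) := hmg m
    have hXY : X + genPoint F E L ∉ Set.range (constPoint (E := E) (F := F) L) := by
      rw [hX, ← succ_nsmul]
      exact hmg (m + 1)
    have step (k : ℕ) : ∃ ε : L, ε ^ 2 = 1 ∧
        miller (constPoint L (k • T)) (constPoint L T) (X + genPoint F E L) *
          miller X (genPoint F E L) (constPoint L (k • T)) *
          miller X (genPoint F E L) (constPoint L T) =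
        ε * (miller (constPoint L (k • T)) (constPoint L T) X *
          miller (constPoint L (k • T)) (constPoint L T) (genPoint F E L) *
          miller X (genPoint F E L) (constPoint L ((k + 1) • T))) := by
      rw [succ_nsmul, map_add]
      exact miller_reciprocity (ne_zero_of_not_mem_range hXr) (ne_zero_of_not_mem_range hg)
        (ne_zero_of_not_mem_range hXY) (xNe_of_not_mem_range hXr _) (xNe_of_not_mem_range hXr _)
        (by rw [← map_add]; exact xNe_of_not_mem_range hXr _)
        (xNe_of_not_mem_range hg _) (xNe_of_not_mem_range hg _)
        (by rw [← map_add]; exact xNe_of_not_mem_range hg _)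
        (xNe_of_not_mem_range hXY _) (xNe_of_not_mem_range hXY _)
        (by rw [← map_add]; exact xNe_of_not_mem_range hXY _)
    choose δ hδ hstep using step
    have hne (A : (E.baseChange F).toAffine.Point) :
        miller X (genPoint F E L) (constPoint L A) ≠ 0 :=
      miller_ne_zero (xNe_of_not_mem_range hXr A).symm (xNe_of_not_mem_range hg A).symm
        (xNe_of_not_mem_range hXY A).symm
    have hprod := Finset.prod_congr (rfl : Finset.range n = _) fun k _ => hstep k
    simp only [Finset.prod_mul_distrib, Finset.prod_const, Finset.card_range] at hprod
    have hshift : ∏ k ∈ Finset.range n, miller X (genPoint F E L) (constPoint L ((k + 1) • T)) =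
        ∏ k ∈ Finset.range n, miller X (genPoint F E L) (constPoint L (k • T)) := by
      have h1 := Finset.prod_range_succ
        (fun k => miller X (genPoint F E L) (constPoint L (k • T))) n
      have h2 := Finset.prod_range_succ'
        (fun k => miller X (genPoint F E L) (constPoint L (k • T))) n
      simp only [hT, zero_nsmul, map_zero, miller_zero_right, mul_one] at h1 h2
      rw [← h1, h2]
    rw [hshift] at hprod
    have hB0 : ∏ k ∈ Finset.range n, miller X (genPoint F E L) (constPoint L (k • T)) ≠ 0 :=
      Finset.prod_ne_zero_iff.mpr fun _ _ => hne _
    have hfin : weilFun n T (X + genPoint F E L) *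
        miller X (genPoint F E L) (constPoint L T) ^ n =
        (∏ k ∈ Finset.range n, δ k) * (weilFun n T X * weilFun n T (genPoint F E L)) := by
      refine mul_right_cancel₀ hB0 ?_
      simp only [weilFun]
      linear_combination hprod
    refine ⟨(∏ k ∈ Finset.range n, δ k) * ε, h / miller X (genPoint F E L) (constPoint L T),
      ?_, ?_⟩
    · rw [mul_pow, hε, mul_one, ← Finset.prod_pow]
      exact Finset.prod_eq_one fun k _ => hδ k
    · have ht := pow_ne_zero n (hne T)
      rw [succ_nsmul, ← hX, eq_div_of_mul_eq ht hfin, ih, div_pow, pow_succ]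
      ring

/-- At the multiple nη the previous factorisation is an n-th power up to a sign, and the sign has an
n-th root in F. -/
theorem exists_mulPullback_weilFun {n : ℕ} [NeZero n] {T : (E.baseChange F).toAffine.Point}
    (hT : n • T = 0) : ∃ g : L, mulPullback F E L n (weilFun n T (genPoint F E L)) = g ^ n := by
  obtain ⟨m, hm⟩ := Nat.exists_eq_succ_of_ne_zero (NeZero.ne n)
  obtain ⟨ε, h, hε, key⟩ := exists_weilFun_nsmul (L := L) hT m
  obtain ⟨c, hc⟩ : ∃ c : F, algebraMap F L c = ε := by
    rcases mul_self_eq_one_iff.mp ((sq ε).symm.trans hε) with rfl | rfl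
    · exact ⟨1, map_one _⟩
    · exact ⟨-1, by simp⟩
  obtain ⟨d, hd⟩ := IsAlgClosed.exists_pow_nat_eq c (NeZero.pos n)
  refine ⟨algebraMap F L d * weilFun n T (genPoint F E L) * h, ?_⟩
  rw [mul_pow, mul_pow, ← map_pow, hd, hc]
  rw [← Nat.succ_eq_add_one, ← hm] at key
  rw [← key, weilFun, weilFun, map_prod]
  refine Finset.prod_congr rfl fun k _ => ?_
  rw [← miller_map (E := E) (mulPullback F E L n), map_constPoint, map_constPoint,
    map_mulPullback]

theorem eq_zero_of_weilFun_eq {n : ℕ} (hn : n ≠ 0) {T : (E.baseChange F).toAffine.Point}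
    (hT : n • T = 0) {h : L} (hf : weilFun n T (genPoint F E L) = h ^ n) : T = 0 := by
  refine eq_zero_of_dv_pow_eq (L := L) (h := h) hn ?_
  rw [← map_pow, ← hf, dv_weilFun hT]

end MillerFunction

/-! ### Degree and separability of multiplication by n. -/

section Multiplication

open Polynomial IntermediateField

theorem finrank_adjoin_div_ratFunc {F : Type*} [Field F] {a b : F[X]} (hab : IsCoprime a b)
    (hb : b ≠ 0) : Module.finrank
      F⟮(algebraMap F[X] (RatFunc F) a / algebraMap F[X] (RatFunc F) b)⟯ (RatFunc F) =
        max a.natDegree b.natDegree := by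
  set f := algebraMap F[X] (RatFunc F) a / algebraMap F[X] (RatFunc F) b with hf
  have hb' : algebraMap F[X] (RatFunc F) b ≠ 0 :=
    (map_ne_zero_iff _ (IsFractionRing.injective F[X] (RatFunc F))).mpr hb
  have hd' : algebraMap F[X] (RatFunc F) f.denom ≠ 0 :=
    (map_ne_zero_iff _ (IsFractionRing.injective F[X] (RatFunc F))).mpr f.denom_ne_zero
  have h : a * f.denom = f.num * b := by
    apply IsFractionRing.injective F[X] (RatFunc F)
    rw [map_mul, map_mul, ← div_eq_div_iff hb' hd', RatFunc.num_div_denom]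
  have hc := f.isCoprime_num_denom
  have h1 : a.natDegree = f.num.natDegree := natDegree_eq_of_degree_eq
    (degree_eq_degree_of_associated (associated_of_dvd_dvd
      (hab.dvd_of_dvd_mul_right (Dvd.intro _ h)) (hc.dvd_of_dvd_mul_right (Dvd.intro _ h.symm))))
  have h2 : b.natDegree = f.denom.natDegree := natDegree_eq_of_degree_eq
    (degree_eq_degree_of_associated (associated_of_dvd_dvd
      (hab.symm.dvd_of_dvd_mul_left (Dvd.intro_left _ h.symm))
      (hc.symm.dvd_of_dvd_mul_left (Dvd.intro_left _ h))))
  rw [RatFunc.finrank_eq_max_natDegree, h1, h2]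

theorem relfinrank_adjoin_div {F L : Type*} [Field F] [Field L] [Algebra F L] {x : L}
    (hx : Transcendental F x) {a b : F[X]} (hab : IsCoprime a b) (hb : b ≠ 0) :
    F⟮aeval x a / aeval x b⟯ ≤ F⟮x⟯ ∧
      F⟮aeval x a / aeval x b⟯.relfinrank F⟮x⟯ = max a.natDegree b.natDegree := by
  let φ : RatFunc F →ₐ[F] L := F⟮x⟯.val.comp (RatFunc.algEquivOfTranscendental x hx).toAlgHom
  have hφ (p : F[X]) : φ (algebraMap F[X] (RatFunc F) p) = aeval x p := by
    change ((RatFunc.algEquivOfTranscendental x hx (algebraMap F[X] (RatFunc F) p) : F⟮x⟯) : L) = _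
    rw [RatFunc.algEquivOfTranscendental_algebraMap, ← IntermediateField.coe_val,
      ← aeval_algHom_apply]
    rfl
  have h1 : F⟮aeval x a / aeval x b⟯ = IntermediateField.map φ
      F⟮(algebraMap F[X] (RatFunc F) a / algebraMap F[X] (RatFunc F) b)⟯ := by
    rw [adjoin_map, Set.image_singleton, map_div₀, hφ, hφ]
  have h2 : F⟮x⟯ = IntermediateField.map φ ⊤ := by
    rw [← AlgHom.fieldRange_eq_map]
    ext z
    refine ⟨fun hz => ?_, ?_⟩
    · obtain ⟨r, hr⟩ := (RatFunc.algEquivOfTranscendental x hx).surjective ⟨z, hz⟩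
      exact ⟨r, congrArg Subtype.val hr⟩
    · rintro ⟨r, rfl⟩
      exact (RatFunc.algEquivOfTranscendental x hx r).2
  rw [h1, h2]
  refine ⟨IntermediateField.map_mono φ le_top, ?_⟩
  rw [relfinrank_map_map, relfinrank_top_right, finrank_adjoin_div_ratFunc hab hb]

variable {K F : Type*} [Field K] [Field F] [Algebra K F] {E : WeierstrassCurve K}
  {L : Type*} [Field L] [Algebra K L] [Algebra F L] [IsScalarTower K F L]
  [Algebra (CoordRing F E) L] [IsFractionRing (CoordRing F E) L]
  [IsScalarTower F (CoordRing F E) L]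

theorem exists_eq_div (z : L) : ∃ p q r s : F[X],
    z = (aeval (genX (F := F) E L) p + aeval (genX (F := F) E L) q * genY (F := F) E L) /
      (aeval (genX (F := F) E L) r + aeval (genX (F := F) E L) s * genY (F := F) E L) := by
  obtain ⟨u, v, -, rfl⟩ := IsFractionRing.div_surjective (A := CoordRing F E) z
  obtain ⟨p, q, h⟩ := Affine.CoordinateRing.exists_smul_basis_eq u
  obtain ⟨r, s, h'⟩ := Affine.CoordinateRing.exists_smul_basis_eq v
  refine ⟨p, q, r, s, ?_⟩
  rw [← algebraMap_coordRing_smul, ← algebraMap_coordRing_smul, h, h']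

theorem isIntegral_genY : IsIntegral F⟮genX (F := F) E L⟯ (genY (F := F) E L) := by
  have := (Affine.equation_iff _ _).mp (equation_gen (F := F) E L)
  let x := AdjoinSimple.gen F (genX (F := F) E L)
  let c : F → F⟮genX (F := F) E L⟯ := algebraMap F _
  refine ⟨X ^ 2 + C (c (E.baseChange F).a₁ * x + c (E.baseChange F).a₃) * X -
    C (x ^ 3 + c (E.baseChange F).a₂ * x ^ 2 + c (E.baseChange F).a₄ * x + c (E.baseChange F).a₆),
    ?_, ?_⟩
  · generalize c (E.baseChange F).a₁ * x + c (E.baseChange F).a₃ = r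
    generalize x ^ 3 + c (E.baseChange F).a₂ * x ^ 2 + c (E.baseChange F).a₄ * x +
      c (E.baseChange F).a₆ = s
    monicity!
  · have hx : algebraMap F⟮genX (F := F) E L⟯ L x = genX (F := F) E L := rfl
    have hc (a : F) : algebraMap F⟮genX (F := F) E L⟯ L (c a) = algebraMap F L a := rfl
    simp only [eval₂_sub, eval₂_add, eval₂_mul, eval₂_pow, eval₂_X, eval₂_C, map_add, map_mul,
      map_pow, hx, hc]
    simp only [WeierstrassCurve.baseChange, WeierstrassCurve.map_a₁, map_a₂, map_a₃, map_a₄,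
      map_a₆, ← IsScalarTower.algebraMap_apply] at this ⊢
    linear_combination this

theorem finiteDimensional_adjoin_genX : FiniteDimensional F⟮genX (F := F) E L⟯ L := by
  have := adjoin.finiteDimensional (isIntegral_genY (E := E) (F := F) (L := L))
  have htop : F⟮genX (F := F) E L⟯⟮genY (F := F) E L⟯ = ⊤ := by
    rw [eq_top_iff]
    intro z _
    obtain ⟨p, q, r, s, rfl⟩ := exists_eq_div (E := E) (F := F) z
    have hp (p : F[X]) : aeval (genX (F := F) E L) p ∈
        F⟮genX (F := F) E L⟯⟮genY (F := F) E L⟯ := by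
      have h1 : aeval (genX (F := F) E L) p ∈ F⟮genX (F := F) E L⟯ :=
        algebra_adjoin_le_adjoin F _ (aeval_mem_adjoin_singleton F _)
      exact _root_.algebraMap_mem _ (⟨_, h1⟩ : F⟮genX (F := F) E L⟯)
    have hy := mem_adjoin_simple_self F⟮genX (F := F) E L⟯ (genY (F := F) E L)
    exact div_mem (add_mem (hp p) (mul_mem (hp q) hy)) (add_mem (hp r) (mul_mem (hp s) hy))
  rw [htop] at this
  exact Module.Finite.equiv (topEquiv (F := F⟮genX (F := F) E L⟯) (E := L)).toLinearEquiv

variable [IsAlgClosed F] [E.IsElliptic] [DecidableEq F] [DecidableEq L]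

/-- The degree of L over F(x ∘ [n]) is computed through F(x) and through [n]^*L. Since L / F(x) and
its image under [n]^* have the same finite degree, [L : [n]^*L] = [F(x) : F(x ∘ [n])] = n². -/
theorem finrank_mulPullback (n : ℕ) [NeZero n] :
    Module.finrank (mulPullback F E L n).fieldRange L = n ^ 2 := by
  obtain ⟨a, b, hab, hb, hdeg, y, h, hP⟩ :=
    hasXDegree_nsmul_genPoint (E := E) (F := F) (L := L) (NeZero.ne n)
  rw [← map_mulPullback, genPoint, Affine.Point.map_some, Affine.Point.some.injEq] at hP
  have hx := genX_transcendental (F := F) E L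
  obtain ⟨hle, hrel⟩ := relfinrank_adjoin_div hx hab hb
  rw [← hP.1, hdeg] at hrel
  rw [← hP.1] at hle
  have hmap : IntermediateField.map (mulPullback F E L n) F⟮genX (F := F) E L⟯ =
      F⟮mulPullback F E L n (genX (F := F) E L)⟯ := by
    rw [adjoin_map, Set.image_singleton]
  have h1 := relfinrank_map_map F⟮genX (F := F) E L⟯ ⊤ (mulPullback F E L n)
  rw [hmap, ← AlgHom.fieldRange_eq_map, relfinrank_top_right] at h1
  have hle' : F⟮mulPullback F E L n (genX (F := F) E L)⟯ ≤ (mulPullback F E L n).fieldRange := by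
    rw [← hmap, AlgHom.fieldRange_eq_map]
    exact IntermediateField.map_mono _ le_top
  have h2 := relfinrank_mul_finrank_top hle'
  have h3 := relfinrank_mul_finrank_top hle
  have := finiteDimensional_adjoin_genX (E := E) (F := F) (L := L)
  have hpos : 0 < Module.finrank F⟮genX (F := F) E L⟯ L := Module.finrank_pos
  rw [h1, ← h3] at h2
  refine Nat.eq_of_mul_eq_mul_left hpos (h2.trans ?_)
  rw [mul_comm]
  exact congrArg _ hrel

theorem finiteDimensional_mulPullback (n : ℕ) [NeZero n] :
    FiniteDimensional (mulPullback F E L n).fieldRange L :=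
  Module.finite_of_finrank_pos (by
    rw [finrank_mulPullback]
    exact pow_pos (NeZero.pos n) 2)

/-- D kills the coordinates of nη, so its value t on the invariant differential at η satisfies nt =
0. Hence t = 0, and D kills x and y. -/
theorem derivation_eq_zero (n : ℕ) [NeZero n] (hn : (n : F) ≠ 0)
    (D : Derivation (mulPullback F E L n).fieldRange L L) : D = 0 := by
  have hM (z : L) : D (mulPullback F E L n z) = 0 :=
    D.map_algebraMap (⟨_, z, rfl⟩ : (mulPullback F E L n).fieldRange)
  have hF (c : F) : D (algebraMap F L c) = 0 := by
    rw [← AlgHom.commutes (mulPullback F E L n), hM]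
  have hK (c : K) : D (algebraMap K L c) = 0 := by
    rw [IsScalarTower.algebraMap_apply K F L, hF]
  let D' : Derivation ℤ L L := D.restrictScalars ℤ
  have h₁ : D' (E.baseChange L).a₁ = 0 := hK _
  have h₂ : D' (E.baseChange L).a₂ = 0 := hK _
  have h₃ : D' (E.baseChange L).a₃ = 0 := hK _
  have h₄ : D' (E.baseChange L).a₄ = 0 := hK _
  have h₆ : D' (E.baseChange L).a₆ = 0 := hK _
  obtain ⟨t, ht⟩ := exists_logDeriv h₁ h₂ h₃ h₄ h₆ (genPoint F E L)
  have hnt := LogDeriv.nsmul h₁ h₂ h₃ h₄ ht n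
  have hn0 : LogDeriv D' (n • genPoint F E L) 0 := by
    rw [← map_mulPullback, genPoint, Affine.Point.map_some]
    exact ⟨(hM _).trans (zero_mul _).symm, (hM _).trans (zero_mul _).symm⟩
  have hnL : (n : L) ≠ 0 := by
    rw [← map_natCast (algebraMap F L)]
    exact (_root_.map_ne_zero _).mpr hn
  obtain rfl : t = 0 := (mul_eq_zero.mp (hnt.unique hn0)).resolve_left hnL
  have hx : D (genX (F := F) E L) = 0 := ht.1.trans (zero_mul _)
  have hy : D (genY (F := F) E L) = 0 := ht.2.trans (zero_mul _)
  have hp (p : F[X]) : D (aeval (genX (F := F) E L) p) = 0 := by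
    induction p using Polynomial.induction_on' with
    | add p q hp hq => rw [map_add, map_add, hp, hq, add_zero]
    | monomial k c =>
      rw [aeval_monomial, D.leibniz, D.leibniz_pow, hx, hF]
      simp
  ext z
  obtain ⟨p, q, r, s, rfl⟩ := exists_eq_div (E := E) (F := F) z
  rw [D.leibniz_div, map_add, map_add, D.leibniz, D.leibniz]
  simp [hp, hy]

theorem isSeparable_mulPullback (n : ℕ) [NeZero n] (hn : (n : F) ≠ 0) :
    Algebra.IsSeparable (mulPullback F E L n).fieldRange L := by
  have := finiteDimensional_mulPullback (E := E) (F := F) (L := L) n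
  rw [← Algebra.FormallyUnramified.iff_isSeparable]
  refine ⟨⟨fun u v => ?_⟩⟩
  rw [← sub_eq_zero, ← Module.forall_dual_apply_eq_zero_iff L]
  intro φ
  have h0 : φ = 0 := (KaehlerDifferential.linearMapEquivDerivation _ L (M := L)).injective
    ((derivation_eq_zero n hn _).trans (map_zero _).symm)
  rw [h0, LinearMap.zero_apply]

end Multiplication

/-! ### The Galois group of multiplication by n and the torsion points. -/

section Torsion

variable {K F : Type*} [Field K] [Field F] [Algebra K F] {E : WeierstrassCurve K}
  {L : Type*} [Field L] [Algebra K L] [Algebra F L] [IsScalarTower K F L]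
  [Algebra (CoordRing F E) L] [IsFractionRing (CoordRing F E) L]
  [IsScalarTower F (CoordRing F E) L] [IsAlgClosed F] [E.IsElliptic]
  [DecidableEq F] [DecidableEq L]
  {Ω : Type*} [Field Ω] [Algebra K Ω] [Algebra F Ω] [IsScalarTower K F Ω] [DecidableEq Ω]

variable (L) in
include L in
-- A nonconstant A would be the image of η under an embedding, and then nη would be constant along
-- with nA.
theorem exists_constPoint_eq_of_nsmul_mem {n : ℕ} (hn : n ≠ 0) {A : (E.baseChange Ω).toAffine.Point}
    {Z : (E.baseChange F).toAffine.Point} (hA : n • A = constPoint Ω Z) :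
    ∃ B : (E.baseChange F).toAffine.Point, constPoint Ω B = A ∧ n • B = Z := by
  suffices h : A ∈ Set.range (constPoint (E := E) (F := F) Ω) by
    obtain ⟨B, rfl⟩ := h
    exact ⟨B, rfl, constPoint_injective ((map_nsmul (constPoint Ω) n B).trans hA)⟩
  by_contra h
  obtain ⟨f, rfl⟩ := exists_algHom_of_not_mem_range (L := L) h
  refine nsmul_genPoint_not_mem_range (E := E) (F := F) (L := L) hn ⟨Z, ?_⟩
  refine Affine.Point.map_injective f ?_
  rw [map_constPoint, map_nsmul, hA]

/-- Two homomorphisms on the function field that agree on the image of `mulPullback` differ by a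
translation by a torsion point. -/
theorem exists_eq_comp_translation {n : ℕ} [NeZero n] {f g : L →ₐ[F] Ω}
    (h : ∀ z, f (mulPullback F E L n z) = g (mulPullback F E L n z)) :
    ∃ B : (E.baseChange F).toAffine.Point, n • B = 0 ∧ f = g.comp (translation L B) := by
  have h' : f.comp (mulPullback F E L n) = g.comp (mulPullback F E L n) := AlgHom.ext h
  have hz : n • (Affine.Point.map (W' := E) f (genPoint F E L) -
      Affine.Point.map (W' := E) g (genPoint F E L)) =
        constPoint (E := E) (F := F) Ω 0 := by
    rw [nsmul_sub, ← map_nsmul, ← map_nsmul, ← map_mulPullback (L := L), Affine.Point.map_map,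
      Affine.Point.map_map, h', sub_self, map_zero (constPoint Ω)]
  obtain ⟨B, hB, hB0⟩ := exists_constPoint_eq_of_nsmul_mem L (NeZero.ne n) hz
  refine ⟨B, hB0, algHom_ext_genPoint (E := E) ?_⟩
  rw [← Affine.Point.map_map, map_translation, map_add, map_constPoint, hB, add_sub_cancel]

theorem translation_mulPullback_of_nsmul_eq_zero {n : ℕ} [NeZero n]
    {B : (E.baseChange F).toAffine.Point} (hB : n • B = 0) (z : L) :
    translation L B (mulPullback F E L n z) = mulPullback F E L n z := by
  rw [translation_mulPullback, hB, translation_zero, AlgHom.id_apply]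

theorem translation_injective : Function.Injective (translation (E := E) (F := F) L) := by
  intro A B h
  have := map_translation (L := L) A
  rw [h, map_translation] at this
  exact (constPoint_injective (add_left_cancel this)).symm

variable (L) in
/-- Translation by a torsion point, as an endomorphism over the image of `mulPullback`. -/
def torsionTranslation (n : ℕ) [NeZero n] {B : (E.baseChange F).toAffine.Point} (hB : n • B = 0) :
    L →ₐ[(mulPullback F E L n).fieldRange] L :=
  { translation L B with
    commutes' := by
      rintro ⟨_, z, rfl⟩
      exact translation_mulPullback_of_nsmul_eq_zero hB z }

/-- Every embedding of L over [n]^*L into an algebraic closure is a torsion translation, hence maps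
L to itself. -/
theorem isGalois_mulPullback (n : ℕ) [NeZero n] (hn : (n : F) ≠ 0) :
    IsGalois (mulPullback F E L n).fieldRange L := by
  classical
  have hfin := finiteDimensional_mulPullback (E := E) (F := F) (L := L) n
  have hsep := isSeparable_mulPullback (E := E) (L := L) n hn
  refine IsGalois.of_card_aut_eq_finrank _ _ (le_antisymm ?_ ?_)
  · have := AlgEquiv.card_le (F := (mulPullback F E L n).fieldRange) (K := L)
    rwa [← Nat.card_eq_fintype_card] at this
  · rw [← (Field.finSepDegree_eq_finrank_iff _ L).mpr hsep, Field.finSepDegree,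
      Nat.card_congr (algEquivEquivAlgHom (mulPullback F E L n).fieldRange L).toEquiv]
    let ι : L →ₐ[(mulPullback F E L n).fieldRange] AlgebraicClosure L := IsScalarTower.toAlgHom _ _ _
    have key (f : Field.Emb (mulPullback F E L n).fieldRange L) :
        ∃ g : L →ₐ[(mulPullback F E L n).fieldRange] L, f = ι.comp g := by
      obtain ⟨B, hB, h⟩ := exists_eq_comp_translation (n := n) (f := f.restrictScalars F)
        (g := ι.restrictScalars F) (fun z =>
          (f.commutes (⟨_, z, rfl⟩ : (mulPullback F E L n).fieldRange)).trans
            (ι.commutes (⟨_, z, rfl⟩ : (mulPullback F E L n).fieldRange)).symm)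
      exact ⟨torsionTranslation L n hB, AlgHom.ext fun z => DFunLike.congr_fun h z⟩
    choose g hg using key
    exact Nat.card_le_card_of_injective g fun f₁ f₂ h => by rw [hg f₁, hg f₂, h]

/-- A function invariant under translation by all `n`-torsion points is a pullback under
multiplication by `n`. -/
theorem exists_mulPullback_eq {n : ℕ} [NeZero n] (hn : (n : F) ≠ 0) {g : L}
    (hg : ∀ B : (E.baseChange F).toAffine.Point, n • B = 0 → translation L B g = g) :
    ∃ h, mulPullback F E L n h = g := by
  have hfin := finiteDimensional_mulPullback (E := E) (F := F) (L := L) n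
  have hgal := isGalois_mulPullback (E := E) (L := L) n hn
  have : g ∈ (⊥ : IntermediateField (mulPullback F E L n).fieldRange L) := by
    rw [IsGalois.mem_bot_iff_fixed]
    intro f
    obtain ⟨B, hB, h⟩ := exists_eq_comp_translation (n := n)
      (f := (f : L →ₐ[(mulPullback F E L n).fieldRange] L).restrictScalars F) (g := .id F L)
      (fun z => f.commutes (⟨_, z, rfl⟩ : (mulPullback F E L n).fieldRange))
    exact (DFunLike.congr_fun h g).trans (hg B hB)
  obtain ⟨⟨_, h, rfl⟩, hh⟩ := IntermediateField.mem_bot.mp this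
  exact ⟨h, hh⟩

variable (L) in
include L in
-- The Galois group of L over [n]^*L consists of the torsion translations, and its order is the
-- degree n².
theorem card_torsion (n : ℕ) [NeZero n] (hn : (n : F) ≠ 0) :
    Nat.card {B : (E.baseChange F).toAffine.Point // n • B = 0} = n ^ 2 := by
  have hfin := finiteDimensional_mulPullback (E := E) (F := F) (L := L) n
  have hgal := isGalois_mulPullback (E := E) (L := L) n hn
  rw [← finrank_mulPullback (E := E) (F := F) (L := L) n, ← IsGalois.card_aut_eq_finrank,
    Nat.card_congr (algEquivEquivAlgHom (mulPullback F E L n).fieldRange L).toEquiv]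
  refine Nat.card_congr (Equiv.ofBijective (fun B => torsionTranslation L n B.2) ⟨?_, ?_⟩)
  · intro A B h
    exact Subtype.ext (translation_injective (L := L) (AlgHom.ext fun z => DFunLike.congr_fun h z))
  · intro f
    obtain ⟨B, hB, h⟩ := exists_eq_comp_translation (n := n) (f := f.restrictScalars F)
      (g := .id F L) (fun z => f.commutes (⟨_, z, rfl⟩ : (mulPullback F E L n).fieldRange))
    exact ⟨⟨B, hB⟩, AlgHom.ext fun z => (DFunLike.congr_fun h z).symm⟩

theorem exists_lift_of_isIntegral {k l Ω : Type*} [Field k] [Field l] [Field Ω] [IsAlgClosed Ω]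
    (i : k →+* l) (hi : i.IsIntegral) (g : k →+* Ω) : ∃ ρ : l →+* Ω, ρ.comp i = g := by
  let := i.toAlgebra
  let := g.toAlgebra
  have : Algebra.IsIntegral k l := ⟨hi⟩
  exact ⟨(IsAlgClosed.lift (M := Ω) (R := k) (S := l)).toRingHom, AlgHom.comp_algebraMap _⟩

variable (L) in
include L in
-- L is algebraic over [n]^*L, so an embedding into the algebraic closure can be lifted to produce R
-- with nR = nη + Z. Then R - η is constant, and n(R - η) = Z.
theorem nsmul_surjective {n : ℕ} (hn : n ≠ 0) :
    Function.Surjective fun A : (E.baseChange F).toAffine.Point => n • A := by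
  classical
  intro Z
  have : NeZero n := ⟨hn⟩
  have hfin := finiteDimensional_mulPullback (E := E) (F := F) (L := L) n
  let r : L →+* (mulPullback F E L n).fieldRange :=
    (mulPullback F E L n).toRingHom.codRestrict _ fun z => ⟨z, rfl⟩
  have hr : Function.Surjective r := fun ⟨_, z, hz⟩ => ⟨z, Subtype.ext hz⟩
  have hint : (mulPullback F E L n).toRingHom.IsIntegral :=
    (r.isIntegral_of_surjective hr).trans r (algebraMap (mulPullback F E L n).fieldRange L)
      Algebra.IsIntegral.isIntegral
  let ι : L →ₐ[F] AlgebraicClosure L := IsScalarTower.toAlgHom _ _ _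
  obtain ⟨ρ, hρ⟩ := exists_lift_of_isIntegral (mulPullback F E L n).toRingHom hint
    (ι.comp ((mulPullback F E L n).comp (translation L Z))).toRingHom
  let ρ' : L →ₐ[F] AlgebraicClosure L :=
    { ρ with
      commutes' := fun c => by
        have := DFunLike.congr_fun hρ (algebraMap F L c)
        simpa using this }
  have hρ' : ρ'.comp (mulPullback F E L n) =
      ι.comp ((mulPullback F E L n).comp (translation L Z)) :=
    AlgHom.ext fun z => DFunLike.congr_fun hρ z
  have hz : n • (Affine.Point.map (W' := E) ρ' (genPoint F E L) -
      Affine.Point.map (W' := E) ι (genPoint F E L)) = constPoint (AlgebraicClosure L) Z := by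
    rw [nsmul_sub, ← map_nsmul, ← map_nsmul, ← map_mulPullback, Affine.Point.map_map, hρ',
      ← Affine.Point.map_map, ← Affine.Point.map_map, map_translation, map_add, map_add,
      map_constPoint, map_constPoint, add_sub_cancel_left]
  obtain ⟨B, -, hB⟩ := exists_constPoint_eq_of_nsmul_mem L hn hz
  exact ⟨B, hB⟩

end Torsion

/-! ### The Weil pairing as a commutator pairing. -/

section Pairing

/-- Multiply the cocycle identities at (P, Q, R) and (R, P, Q) and divide by the one at (P, R, Q).
This is the bilinearity of the commutator in a central extension of an abelian group. -/
theorem cocycle_div_add_left {G M : Type*} [AddCommGroup G] [CommGroup M] (c : G → G → M)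
    (h : ∀ P Q R, c P Q * c (P + Q) R = c Q R * c P (Q + R)) (P Q R : G) :
    c (P + Q) R / c R (P + Q) = c P R / c R P * (c Q R / c R Q) := by
  have h1 := h P Q R
  have h2 := h R P Q
  have h3 := h P R Q
  rw [add_comm R P] at h2
  rw [add_comm R Q] at h3
  rw [div_mul_div_comm, div_eq_div_iff_mul_eq_mul]
  have e : (c P Q * c (P + Q) R) * (c R P * c (P + R) Q) * (c P R * c (P + R) Q)⁻¹ *
      (c P Q)⁻¹ = (c Q R * c P (Q + R)) * (c P Q * c R (P + Q)) * (c R Q * c P (Q + R))⁻¹ *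
        (c P Q)⁻¹ := by
    rw [h1, h2, h3]
  have e1 : (c P Q * c (P + Q) R) * (c R P * c (P + R) Q) * (c P R * c (P + R) Q)⁻¹ *
      (c P Q)⁻¹ = c (P + Q) R * c R P * (c P R)⁻¹ := by
    simp only [mul_inv]
    calc _ = c (P + Q) R * c R P * (c P R)⁻¹ * (c P Q * (c P Q)⁻¹) *
          (c (P + R) Q * (c (P + R) Q)⁻¹) := by ac_rfl
      _ = _ := by simp
  have e2 : (c Q R * c P (Q + R)) * (c P Q * c R (P + Q)) * (c R Q * c P (Q + R))⁻¹ *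
        (c P Q)⁻¹ = c Q R * c R (P + Q) * (c R Q)⁻¹ := by
    simp only [mul_inv]
    calc _ = c Q R * c R (P + Q) * (c R Q)⁻¹ * (c P Q * (c P Q)⁻¹) *
          (c P (Q + R) * (c P (Q + R))⁻¹) := by ac_rfl
      _ = _ := by simp
  rw [e1, e2] at e
  calc c (P + Q) R * (c R P * c R Q) = (c (P + Q) R * c R P * (c P R)⁻¹) * (c P R * c R Q) := by
        rw [mul_assoc _ _ (c P R * _), inv_mul_cancel_left, mul_assoc]
    _ = (c Q R * c R (P + Q) * (c R Q)⁻¹) * (c R Q * c P R) := by rw [e, mul_comm (c P R)]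
    _ = _ := by
        rw [mul_assoc _ _ (c R Q * _), inv_mul_cancel_left]
        ac_rfl

/-- The `n`-torsion points over `F`. -/
abbrev TorsionPoint {K : Type*} (F : Type*) [Field K] [Field F] [Algebra K F] [DecidableEq F]
    (E : WeierstrassCurve K) (n : ℕ) :=
  AddSubgroup.torsionBy (E.baseChange F).toAffine.Point (n : ℤ)

variable {K F : Type*} [Field K] [Field F] [Algebra K F] {E : WeierstrassCurve K}
  (L : Type*) [Field L] [Algebra K L] [Algebra F L] [IsScalarTower K F L]
  [Algebra (CoordRing F E) L] [IsFractionRing (CoordRing F E) L]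
  [IsScalarTower F (CoordRing F E) L] [IsAlgClosed F] [E.IsElliptic]
  [DecidableEq F] [DecidableEq L] {n : ℕ}

theorem nsmul_coe_torsion (P : TorsionPoint F E n) : n • (P : (E.baseChange F).toAffine.Point) = 0 := by
  rw [← natCast_zsmul]
  exact P.2

/-- The constants by which products of Miller functions deviate from Miller functions. -/
def weilConst (P Q : TorsionPoint F E n) : Fˣ :=
  Units.mk0 (exists_weilFun_mul (L := L) (nsmul_coe_torsion P) (nsmul_coe_torsion Q)).choose
    (exists_weilFun_mul (L := L) (nsmul_coe_torsion P) (nsmul_coe_torsion Q)).choose_spec.1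

theorem weilFun_mul (P Q : TorsionPoint F E n) : weilFun n P.1 (genPoint F E L) *
    translation L (-P.1) (weilFun n Q.1 (genPoint F E L)) =
      algebraMap F L (weilConst L P Q) * weilFun n (P + Q).1 (genPoint F E L) :=
  (exists_weilFun_mul (L := L) (nsmul_coe_torsion P) (nsmul_coe_torsion Q)).choose_spec.2

/-- Associativity: f_P(X) f_Q(X - P) f_R(X - P - Q) is computed in two ways. -/
theorem weilConst_cocycle (P Q R : TorsionPoint F E n) :
    weilConst L P Q * weilConst L (P + Q) R = weilConst L Q R * weilConst L P (Q + R) := by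
  have h1 := weilFun_mul L P Q
  have h2 := weilFun_mul L (P + Q) R
  have h3 := weilFun_mul L Q R
  have h4 := weilFun_mul L P (Q + R)
  have h3' := congrArg (translation L (-P.1)) h3
  rw [map_mul, map_mul, AlgHom.commutes, translation_translation] at h3'
  rw [AddSubgroup.coe_add, neg_add] at h2
  rw [← add_assoc] at h4
  refine Units.ext ((algebraMap F L).injective ?_)
  refine mul_right_cancel₀ (weilFun_genPoint_ne_zero (L := L) n (P + Q + R).1) ?_
  simp only [Units.val_mul, map_mul]
  linear_combination
    (-translation L (-P.1 + -Q.1) (weilFun n R.1 (genPoint F E L))) * h1 -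
      algebraMap F L (weilConst L P Q) * h2 + algebraMap F L (weilConst L Q R) * h4 +
        weilFun n P.1 (genPoint F E L) * h3'

/-- The Weil pairing. -/
def weilPairing (P Q : TorsionPoint F E n) : Fˣ := weilConst L P Q / weilConst L Q P

theorem weilPairing_self (P : TorsionPoint F E n) : weilPairing L P P = 1 := div_self' _

theorem weilPairing_swap (P Q : TorsionPoint F E n) : weilPairing L Q P = (weilPairing L P Q)⁻¹ :=
  (inv_div _ _).symm

theorem weilPairing_add_left (P Q R : TorsionPoint F E n) :
    weilPairing L (P + Q) R = weilPairing L P R * weilPairing L Q R :=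
  cocycle_div_add_left _ (weilConst_cocycle L) P Q R

theorem weilPairing_add_right (P Q R : TorsionPoint F E n) :
    weilPairing L P (Q + R) = weilPairing L P Q * weilPairing L P R := by
  rw [weilPairing_swap, weilPairing_add_left, mul_inv, ← weilPairing_swap, ← weilPairing_swap]

theorem weilPairing_nsmul_left (m : ℕ) (P Q : TorsionPoint F E n) :
    weilPairing L (m • P) Q = weilPairing L P Q ^ m := by
  induction m with
  | zero =>
    have := weilPairing_add_left L 0 0 Q
    rw [add_zero, left_eq_mul] at this
    rw [zero_nsmul, pow_zero, this]
  | succ m ih => rw [succ_nsmul, weilPairing_add_left, ih, pow_succ]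

theorem weilPairing_nsmul_right (m : ℕ) (P Q : TorsionPoint F E n) :
    weilPairing L P (m • Q) = weilPairing L P Q ^ m := by
  rw [weilPairing_swap, weilPairing_nsmul_left, ← inv_pow, ← weilPairing_swap]

theorem nsmul_torsion (P : TorsionPoint F E n) : n • P = 0 :=
  Subtype.ext (nsmul_coe_torsion P)

theorem weilPairing_pow (P Q : TorsionPoint F E n) : weilPairing L P Q ^ n = 1 := by
  rw [← weilPairing_nsmul_left, nsmul_torsion]
  have := weilPairing_add_left L 0 0 Q
  rwa [add_zero, left_eq_mul] at this

/-! ### Nondegeneracy of the pairing. -/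

section Nondegenerate

variable {L}

/-- The i-th factor has divisor n((i + 1)Q) - n(iQ), and the sum telescopes because nQ = 0. -/
theorem dv_prod_translation_weilFun {Q : (E.baseChange F).toAffine.Point} (hQ : n • Q = 0) :
    dv F E L (∏ i ∈ Finset.range n, translation L (-(i • Q)) (weilFun n Q (genPoint F E L))) =
      1 := by
  have key (m : ℕ) : dv F E L (∏ i ∈ Finset.range m,
      translation L (-(i • Q)) (weilFun n Q (genPoint F E L))) = pointDiv L (m • Q) ^ n := by
    induction m with
    | zero => simp [pointDiv_zero]
    | succ m ih =>
      rw [Finset.prod_range_succ, map_mul, ih, dv_translation_weilFun hQ, neg_neg,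
        sub_neg_eq_add, succ_nsmul', mul_div_cancel₀ _ (pow_ne_zero n (pointDiv_ne_zero L _))]
  rw [key, hQ, pointDiv_zero, one_pow]

theorem mem_range_algebraMap_of_pow_eq {x : L} {c : F} {m : ℕ} (hm : m ≠ 0)
    (h : x ^ m = algebraMap F L c) : x ∈ Set.range (algebraMap F L) :=
  mem_range_algebraMap_of_isAlgebraic
    (IsAlgebraic.of_pow (Nat.pos_of_ne_zero hm) (h ▸ isAlgebraic_algebraMap c))

/-- Write P = nP', Q = nQ' and f_Q ∘ [n] = b^n. Triviality of the pairing gives g(X) b(X - P') = ε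
b(X) g(X - Q') with ε^n = 1. Multiplying the translates by -iQ' over i < n removes ε and turns b
into a constant Γ; the rest telescopes to g(X) = g(X - nQ'). -/
theorem translation_eq_self_of_weilPairing_eq_one [NeZero n] {P Q : TorsionPoint F E n}
    (h : weilPairing L P Q = 1) {g : L}
    (hg : mulPullback F E L n (weilFun n P.1 (genPoint F E L)) = g ^ n) :
    translation L (-(Q : (E.baseChange F).toAffine.Point)) g = g := by
  have hn : n ≠ 0 := NeZero.ne n
  obtain ⟨P', hP'⟩ : ∃ P', n • P' = P.1 := nsmul_surjective (E := E) (F := F) L hn P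
  obtain ⟨Q', hQ'⟩ : ∃ Q', n • Q' = Q.1 := nsmul_surjective (E := E) (F := F) L hn Q
  obtain ⟨b, hb⟩ := exists_mulPullback_weilFun (L := L) (nsmul_coe_torsion Q)
  have hg0 : g ≠ 0 := by
    rintro rfl
    rw [zero_pow hn, map_eq_zero] at hg
    exact weilFun_genPoint_ne_zero _ _ hg
  have hb0 : b ≠ 0 := by
    rintro rfl
    rw [zero_pow hn, map_eq_zero] at hb
    exact weilFun_genPoint_ne_zero _ _ hb
  have hPQ : (g * translation L (-P') b) ^ n = (b * translation L (-Q') g) ^ n := by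
    have h1 := weilFun_mul L P Q
    have h2 := weilFun_mul L Q P
    rw [add_comm Q P, ← div_eq_one.mp h, ← h1] at h2
    have h3 := congrArg (mulPullback F E L n) h2
    rw [map_mul, map_mul, hg, hb, ← hP', ← hQ', ← smul_neg, ← smul_neg,
      ← translation_mulPullback, ← translation_mulPullback] at h3
    rw [hP', hQ', hg, hb, map_pow, map_pow, ← mul_pow, ← mul_pow] at h3
    exact h3.symm
  have hne (A : (E.baseChange F).toAffine.Point) {z : L} (hz : z ≠ 0) : translation L A z ≠ 0 :=
    (map_ne_zero _).mpr hz
  obtain ⟨ε, hε, hrel⟩ : ∃ ε : F, algebraMap F L ε ^ n = 1 ∧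
      g * translation L (-P') b = algebraMap F L ε * (b * translation L (-Q') g) := by
    have hz := mul_ne_zero hb0 (hne (-Q') hg0)
    have hu : (g * translation L (-P') b / (b * translation L (-Q') g)) ^ n = 1 := by
      rw [div_pow, hPQ, div_self (pow_ne_zero n hz)]
    obtain ⟨ε, hε⟩ := mem_range_algebraMap_of_pow_eq (F := F) hn (hu.trans (map_one _).symm)
    exact ⟨ε, by rw [hε, hu], by rw [hε, div_mul_cancel₀ _ hz]⟩
  set Γ : L := ∏ i ∈ Finset.range n, translation L (-(i • Q')) b with hΓ
  have hΓ0 : Γ ≠ 0 := Finset.prod_ne_zero_iff.mpr fun i _ => hne _ hb0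
  -- Γ^n is the pullback under [n] of the product of the f_Q(X - iQ), which has trivial divisor; so
  -- Γ is algebraic over F, hence constant.
  obtain ⟨γ, hγ⟩ : Γ ∈ Set.range (algebraMap F L) := by
    obtain ⟨c, -, hc⟩ := exists_const_of_dv_eq F E (f := 1)
      ((map_one _).trans (dv_prod_translation_weilFun (L := L) (nsmul_coe_torsion Q)).symm)
    refine mem_range_algebraMap_of_pow_eq (c := c) hn ?_
    have := congrArg (mulPullback F E L n) hc
    rw [map_prod, mul_one, AlgHom.commutes] at this
    rw [← this, hΓ, ← Finset.prod_pow]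
    refine Finset.prod_congr rfl fun i _ => ?_
    rw [← map_pow, ← hb, translation_mulPullback, smul_neg, smul_comm, hQ']
  have hprod : (∏ i ∈ Finset.range n, translation L (-(i • Q')) g) * translation L (-P') Γ =
      Γ * ∏ i ∈ Finset.range n, translation L (-((i + 1) • Q')) g := by
    have hεp : ∏ i ∈ Finset.range n, algebraMap F L ε = 1 := by
      rw [Finset.prod_const, Finset.card_range, hε]
    rw [hΓ, map_prod, ← Finset.prod_mul_distrib, ← Finset.prod_mul_distrib]
    conv_rhs => rw [← one_mul (∏ i ∈ Finset.range n, _), ← hεp, ← Finset.prod_mul_distrib]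
    refine Finset.prod_congr rfl fun i _ => ?_
    have := congrArg (translation L (-(i • Q'))) hrel
    simp only [map_mul, AlgHom.commutes, translation_translation] at this
    rw [translation_translation, add_comm (-P'), this, succ_nsmul, neg_add]
  rw [← hγ, AlgHom.commutes, hγ, mul_comm] at hprod
  have hprod := mul_left_cancel₀ hΓ0 hprod
  have s1 := Finset.prod_range_succ (fun i => translation L (-(i • Q')) g) n
  have s2 := Finset.prod_range_succ' (fun i => translation L (-(i • Q')) g) n
  rw [s1, ← hprod] at s2
  have := mul_left_cancel₀ (Finset.prod_ne_zero_iff.mpr fun i _ => hne _ hg0) s2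
  simpa [hQ', translation_zero] using this

/-- The n-th root of f_P ∘ [n] is invariant under E[n], hence equals z ∘ [n]. Then f_P = z^n, which
forces P = 0. -/
theorem eq_zero_of_weilPairing_eq_one (hn : (n : F) ≠ 0) {P : TorsionPoint F E n}
    (h : ∀ Q, weilPairing L P Q = 1) : P = 0 := by
  have : NeZero n := ⟨by rintro rfl; exact hn Nat.cast_zero⟩
  obtain ⟨g, hg⟩ := exists_mulPullback_weilFun (L := L) (nsmul_coe_torsion P)
  obtain ⟨z, rfl⟩ := exists_mulPullback_eq (E := E) hn (g := g) fun B hB => by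
    have := translation_eq_self_of_weilPairing_eq_one
      (h ⟨-B, by
        change (n : ℤ) • (-B) = 0
        rw [natCast_zsmul, smul_neg, hB, neg_zero]⟩) hg
    simpa using this
  rw [← map_pow] at hg
  exact Subtype.ext (eq_zero_of_weilFun_eq (NeZero.ne n) (nsmul_coe_torsion P)
    ((mulPullback F E L n).injective hg))

end Nondegenerate

/-! ### Galois equivariance of the pairing. -/

section Galois

variable (E)

/-- The Weierstrass equation has coefficients in K, so σ may act on the coefficients of functions
while x and y stay fixed. -/
theorem exists_semilinear (σ : F →ₐ[K] F) : ∃ f : L →ₐ[K] L,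
    (∀ c, f (algebraMap F L c) = algebraMap F L (σ c)) ∧
      Affine.Point.map (W' := E) f (genPoint F E L) = genPoint F E L := by
  have he : (E.baseChange F).map ((algebraMap F L).comp σ.toRingHom) = E.baseChange L := by
    simp only [WeierstrassCurve.baseChange, WeierstrassCurve.map_map]
    congr 1
    ext c
    simp [← IsScalarTower.algebraMap_apply]
  obtain ⟨f, hf, hfx, hfy⟩ := exists_ringHom_of_equation (E := E) L
    ((algebraMap F L).comp σ.toRingHom) (he ▸ equation_gen (F := F) E L) fun p hp => by
      rw [← Polynomial.eval₂_map] at hp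
      have := (transcendental_iff.mp (genX_transcendental (F := F) E L)) (p.map σ.toRingHom) hp
      exact (Polynomial.map_eq_zero_iff σ.injective).mp this
  have hf' (c : F) : f (algebraMap F L c) = algebraMap F L (σ c) := DFunLike.congr_fun hf c
  refine ⟨{ f with
    commutes' := fun c => ?_ }, hf', ?_⟩
  · have := hf' (algebraMap K F c)
    rwa [AlgHom.commutes, ← IsScalarTower.algebraMap_apply] at this
  · rw [genPoint, Affine.Point.map_some, Affine.Point.some.injEq]
    exact ⟨hfx, hfy⟩

variable {E L}
variable {σ : F →ₐ[K] F} {f : L →ₐ[K] L} (hf : ∀ c, f (algebraMap F L c) = algebraMap F L (σ c))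
  (hf' : Affine.Point.map (W' := E) f (genPoint F E L) = genPoint F E L)

include hf in
theorem map_constPoint_semilinear (A : (E.baseChange F).toAffine.Point) :
    Affine.Point.map (W' := E) f (constPoint L A) =
      constPoint L (Affine.Point.map (W' := E) σ A) := by
  rcases A with _ | ⟨x, y, h⟩
  · rfl
  · simp only [constPoint, Affine.Point.map_some, Affine.Point.some.injEq]
    exact ⟨hf x, hf y⟩

include hf hf' in
theorem semilinear_weilFun (T : (E.baseChange F).toAffine.Point) :
    f (weilFun n T (genPoint F E L)) =
      weilFun n (Affine.Point.map (W' := E) σ T) (genPoint F E L) := by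
  rw [weilFun, weilFun, map_prod]
  refine Finset.prod_congr rfl fun k _ => ?_
  rw [← miller_map (E := E) f, hf', map_constPoint_semilinear hf, map_constPoint_semilinear hf,
    map_nsmul]

include hf hf' in
theorem semilinear_translation (A : (E.baseChange F).toAffine.Point) (z : L) :
    f (translation L A z) = translation L (Affine.Point.map (W' := E) σ A) (f z) := by
  let f₁ : L →ₐ[K] L := f.comp ((translation L A).restrictScalars K)
  let f₂ : L →ₐ[K] L :=
    ((translation L (Affine.Point.map (W' := E) σ A)).restrictScalars K).comp f
  have h₁ : Affine.Point.map (W' := E) f₁ (genPoint F E L) =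
      genPoint F E L + constPoint L (Affine.Point.map (W' := E) σ A) := by
    rw [← map_constPoint_semilinear hf]
    nth_rw 2 [← hf']
    rw [← map_add, ← map_translation, ← Affine.Point.map_map]
    rfl
  have h₂ : Affine.Point.map (W' := E) f₂ (genPoint F E L) =
      genPoint F E L + constPoint L (Affine.Point.map (W' := E) σ A) := by
    rw [← map_translation, ← Affine.Point.map_map, hf']
    rfl
  have h := h₁.trans h₂.symm
  rw [genPoint, Affine.Point.map_some, Affine.Point.map_some, Affine.Point.some.injEq] at h
  have : (f₁ : L →+* L) = f₂ := by
    refine ringHom_ext E L (RingHom.ext fun c => ?_) h.1 h.2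
    change f (translation L A (algebraMap F L c)) = translation L _ (f (algebraMap F L c))
    rw [AlgHom.commutes, hf, AlgHom.commutes]
  exact DFunLike.congr_fun this z

end Galois

/-- The action on coefficients sends f_T to f_{σT} exactly, without a constant factor, because these
functions are given by formulas; so the defining relation is carried to itself. -/
theorem weilConst_map (σ : F →ₐ[K] F) {P Q P' Q' : TorsionPoint F E n}
    (hP : (P' : (E.baseChange F).toAffine.Point) = Affine.Point.map (W' := E) σ P)
    (hQ : (Q' : (E.baseChange F).toAffine.Point) = Affine.Point.map (W' := E) σ Q) :
    (weilConst L P' Q' : F) = σ (weilConst L P Q) := by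
  obtain ⟨f, hf, hf'⟩ := exists_semilinear E L σ
  have h := congrArg f (weilFun_mul L P Q)
  rw [map_mul, map_mul, semilinear_translation hf hf', semilinear_weilFun hf hf',
    semilinear_weilFun hf hf', semilinear_weilFun hf hf', hf, map_neg, AddSubgroup.coe_add,
    map_add, ← hP, ← hQ, weilFun_mul] at h
  exact (algebraMap F L).injective (mul_right_cancel₀ (weilFun_genPoint_ne_zero (L := L) n _) h)

theorem weilPairing_map (σ : F →ₐ[K] F) {P Q P' Q' : TorsionPoint F E n}
    (hP : (P' : (E.baseChange F).toAffine.Point) = Affine.Point.map (W' := E) σ P)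
    (hQ : (Q' : (E.baseChange F).toAffine.Point) = Affine.Point.map (W' := E) σ Q) :
    (weilPairing L P' Q' : F) = σ (weilPairing L P Q) := by
  simp only [weilPairing, Units.val_div_eq_div_val, map_div₀, weilConst_map L σ hP hQ,
    weilConst_map L σ hQ hP]

end Pairing

/-! ### Bases of the torsion and determinants. -/

section Determinant

variable {K F : Type*} [Field K] [Field F] [Algebra K F] {E : WeierstrassCurve K}
  (L : Type*) [Field L] [Algebra K L] [Algebra F L] [IsScalarTower K F L]
  [Algebra (CoordRing F E) L] [IsFractionRing (CoordRing F E) L]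
  [IsScalarTower F (CoordRing F E) L] [IsAlgClosed F] [E.IsElliptic]
  [DecidableEq F] [DecidableEq L] {n : ℕ} [NeZero n]

include L in
theorem card_torsionPoint (hn : (n : F) ≠ 0) : Nat.card (TorsionPoint F E n) = n ^ 2 := by
  rw [← card_torsion (E := E) L n hn]
  refine Nat.card_congr (Equiv.subtypeEquivRight fun B => ?_)
  rw [← natCast_zsmul]
  rfl

include L in
theorem finite_torsionPoint (hn : (n : F) ≠ 0) : Finite (TorsionPoint F E n) :=
  Nat.finite_of_card_ne_zero (by
    rw [card_torsionPoint L hn]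
    exact pow_ne_zero 2 (NeZero.ne n))

include L in
-- If e is the exponent of E[n], then E[n] lies in E[e], so n² ≤ e² and e = n; a finite abelian
-- group attains its exponent.
theorem exists_addOrderOf_eq (hn : (n : F) ≠ 0) : ∃ P : TorsionPoint F E n, addOrderOf P = n := by
  have := finite_torsionPoint (E := E) L hn
  obtain ⟨P, hP⟩ := AddMonoid.exists_addOrderOf_eq_exponent
    (AddMonoid.ExponentExists.of_finite (G := TorsionPoint F E n))
  have hdvd : AddMonoid.exponent (TorsionPoint F E n) ∣ n :=
    AddMonoid.exponent_dvd_of_forall_nsmul_eq_zero nsmul_torsion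
  set e := AddMonoid.exponent (TorsionPoint F E n) with he
  have he0 : e ≠ 0 := ne_zero_of_dvd_ne_zero (NeZero.ne n) hdvd
  have : NeZero e := ⟨he0⟩
  have heF : (e : F) ≠ 0 := by
    obtain ⟨k, hk⟩ := hdvd
    intro h0
    exact hn (by rw [hk, Nat.cast_mul, h0, zero_mul])
  refine ⟨P, hP.trans (Nat.dvd_antisymm hdvd ?_)⟩
  have hfin := finite_torsionPoint (E := E) L heF
  have hmem (Q : TorsionPoint F E n) : (Q : (E.baseChange F).toAffine.Point) ∈
      TorsionPoint F E e := by
    change (e : ℤ) • (Q : (E.baseChange F).toAffine.Point) = 0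
    rw [natCast_zsmul, ← AddSubgroup.coe_nsmul, AddMonoid.exponent_nsmul_eq_zero,
      AddSubgroup.coe_zero]
  have hle := Nat.card_le_card_of_injective
    (fun Q : TorsionPoint F E n => (⟨Q, hmem Q⟩ : TorsionPoint F E e))
    fun P Q h => Subtype.ext (congrArg (fun R : TorsionPoint F E e =>
      (R : (E.baseChange F).toAffine.Point)) h)
  rw [card_torsionPoint L hn, card_torsionPoint L heF] at hle
  have := (Nat.pow_le_pow_iff_left two_ne_zero).mp hle
  exact (le_antisymm this (Nat.le_of_dvd (NeZero.pos n) hdvd)).dvd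

theorem dvd_of_weilPairing_pow_eq_one (hn : (n : F) ≠ 0) {P : TorsionPoint F E n} {d : ℕ}
    (h : ∀ Q, weilPairing L P Q ^ d = 1) : addOrderOf P ∣ d := by
  rw [addOrderOf_dvd_iff_nsmul_eq_zero]
  exact eq_zero_of_weilPairing_eq_one (L := L) hn fun Q => by rw [weilPairing_nsmul_left, h]

/-- For P of order n, let d be the exponent of the group of values e(P, ·), attained at some Q. Then
dP pairs trivially with everything, so n divides d. -/
theorem exists_orderOf_weilPairing_eq (hn : (n : F) ≠ 0) :
    ∃ P Q : TorsionPoint F E n, orderOf (weilPairing L P Q) = n := by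
  obtain ⟨P, hP⟩ := exists_addOrderOf_eq (E := E) L hn
  have := finite_torsionPoint (E := E) L hn
  let e : Multiplicative (TorsionPoint F E n) →* Fˣ :=
    MonoidHom.mk' (fun Q => weilPairing L P Q.toAdd) fun Q R => weilPairing_add_right L P _ _
  have hfin : Finite e.range := Set.finite_range e
  obtain ⟨⟨_, Q, rfl⟩, hQ⟩ := Monoid.exists_orderOf_eq_exponent
    (Monoid.ExponentExists.of_finite (G := e.range))
  refine ⟨P, Q.toAdd, Nat.dvd_antisymm (orderOf_dvd_of_pow_eq_one (weilPairing_pow L _ _)) ?_⟩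
  have h : orderOf (weilPairing L P Q.toAdd) = Monoid.exponent e.range := by
    rw [← hQ, ← Subgroup.orderOf_coe]
    rfl
  have hd := dvd_of_weilPairing_pow_eq_one L hn (P := P) (d := orderOf (weilPairing L P Q.toAdd))
    fun R => by
      rw [h]
      exact congrArg Subtype.val (Monoid.pow_exponent_eq_one (⟨e (.ofAdd R), _, rfl⟩ : e.range))
  rwa [hP] at hd

variable [Module (ZMod n) (TorsionPoint F E n)]

theorem zmod_smul_eq (a : ZMod n) (P : TorsionPoint F E n) : a • P = a.val • P := by
  conv_lhs => rw [← ZMod.natCast_zmod_val a]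
  exact Nat.cast_smul_eq_nsmul _ _ _

theorem weilPairing_smul_left (a : ZMod n) (P Q : TorsionPoint F E n) :
    weilPairing L (a • P) Q = weilPairing L P Q ^ a.val := by
  rw [zmod_smul_eq, weilPairing_nsmul_left]

theorem weilPairing_smul_right (a : ZMod n) (P Q : TorsionPoint F E n) :
    weilPairing L P (a • Q) = weilPairing L P Q ^ a.val := by
  rw [zmod_smul_eq, weilPairing_nsmul_right]

theorem eq_zero_of_pow_val_eq_one {ζ : Fˣ} (hζ : orderOf ζ = n) {a : ZMod n}
    (h : ζ ^ a.val = 1) : a = 0 := by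
  have hd := orderOf_dvd_of_pow_eq_one h
  rw [hζ] at hd
  rw [← ZMod.natCast_zmod_val a]
  exact (ZMod.natCast_eq_zero_iff _ _).mpr hd

include L in
-- Pairing a relation between P and Q with Q and with P kills both coefficients, since e(P, Q) has
-- order n; independence suffices because there are n² points.
theorem nonempty_basis (hn : (n : F) ≠ 0) :
    Nonempty (Module.Basis (Fin 2) (ZMod n) (TorsionPoint F E n)) := by
  obtain ⟨P, Q, hPQ⟩ := exists_orderOf_weilPairing_eq (E := E) L hn
  have hfin := finite_torsionPoint (E := E) L hn
  let f : (Fin 2 → ZMod n) →ₗ[ZMod n] TorsionPoint F E n :=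
    (LinearMap.proj 0).smulRight P + (LinearMap.proj 1).smulRight Q
  have hf (v : Fin 2 → ZMod n) : f v = v 0 • P + v 1 • Q := rfl
  have hinj : Function.Injective f := by
    rw [injective_iff_map_eq_zero]
    intro v hv
    rw [hf] at hv
    have hz (R : TorsionPoint F E n) : weilPairing L 0 R = 1 := by
      have := weilPairing_nsmul_left L 0 0 R
      rwa [zero_nsmul, pow_zero] at this
    have hz' (R : TorsionPoint F E n) : weilPairing L R 0 = 1 := by
      have := weilPairing_nsmul_right L 0 R 0
      rwa [zero_nsmul, pow_zero] at this
    have h0 : v 0 = 0 := by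
      refine eq_zero_of_pow_val_eq_one hPQ ?_
      have h := hz Q
      rwa [← hv, weilPairing_add_left, weilPairing_smul_left, weilPairing_smul_left,
        weilPairing_self, one_pow, mul_one] at h
    have h1 : v 1 = 0 := by
      refine eq_zero_of_pow_val_eq_one hPQ ?_
      have h := hz' P
      rwa [← hv, weilPairing_add_right, weilPairing_smul_right, weilPairing_smul_right,
        weilPairing_self, one_pow, one_mul] at h
    ext i
    fin_cases i
    · exact h0
    · exact h1
  have hbij : Function.Bijective f := by
    rw [Nat.bijective_iff_injective_and_card]
    refine ⟨hinj, ?_⟩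
    rw [card_torsionPoint L hn, Nat.card_fun, Nat.card_zmod, Nat.card_fin]
  exact ⟨.ofEquivFun (LinearEquiv.ofBijective f hbij).symm⟩

/-- Every e(b 0, ·) is a power of e(b 0, b 1), so by nondegeneracy the order n of b 0 divides the
order of e(b 0, b 1). -/
theorem orderOf_weilPairing_basis (hn : (n : F) ≠ 0)
    (b : Module.Basis (Fin 2) (ZMod n) (TorsionPoint F E n)) :
    orderOf (weilPairing L (b 0) (b 1)) = n := by
  refine Nat.dvd_antisymm (orderOf_dvd_of_pow_eq_one (weilPairing_pow L _ _)) ?_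
  have hd := dvd_of_weilPairing_pow_eq_one L hn (P := b 0)
    (d := orderOf (weilPairing L (b 0) (b 1))) fun Q => by
      rw [← b.sum_repr Q, Fin.sum_univ_two, weilPairing_add_right, weilPairing_smul_right,
        weilPairing_smul_right, weilPairing_self, one_pow, one_mul, ← pow_mul, mul_comm, pow_mul,
        pow_orderOf_eq_one, one_pow]
  refine dvd_trans ?_ hd
  have h0 := addOrderOf_nsmul_eq_zero (b 0)
  rw [← Nat.cast_smul_eq_nsmul (ZMod n)] at h0
  have h1 := congrArg (fun v => b.repr v 0) h0
  simp only [map_smul, Module.Basis.repr_self, Finsupp.smul_single, smul_eq_mul, mul_one,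
    Finsupp.single_eq_same, map_zero, Finsupp.coe_zero, Pi.zero_apply] at h1
  exact (ZMod.natCast_eq_zero_iff _ _).mp h1

/-- An endomorphism of the torsion points that transports the pairing along `ζ ↦ ζ ^ χ` has
determinant `χ`. -/
theorem det_eq_of_weilPairing (hn : (n : F) ≠ 0)
    (b : Module.Basis (Fin 2) (ZMod n) (TorsionPoint F E n))
    (f : TorsionPoint F E n →ₗ[ZMod n] TorsionPoint F E n) (χ : ZMod n)
    (h : weilPairing L (f (b 0)) (f (b 1)) = weilPairing L (b 0) (b 1) ^ χ.val) :
    (LinearMap.toMatrix b b f).det = χ := by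
  have hf (j : Fin 2) : f (b j) = LinearMap.toMatrix b b f 0 j • b 0 +
      LinearMap.toMatrix b b f 1 j • b 1 := by
    rw [← b.sum_repr (f (b j)), Fin.sum_univ_two]
    simp only [LinearMap.toMatrix_apply]
  set M := LinearMap.toMatrix b b f with hM
  rw [hf, hf] at h
  simp only [weilPairing_add_left, weilPairing_add_right, weilPairing_smul_left,
    weilPairing_smul_right, weilPairing_self, one_pow, one_mul, mul_one] at h
  -- The two cross terms combine to e(b 0, b 1) raised to the determinant, and exponents matter only
  -- modulo the order n of this root of unity.
  rw [weilPairing_swap L (b 0) (b 1), inv_pow, inv_pow, inv_mul_eq_iff_eq_mul, ← pow_mul,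
    ← pow_mul, ← pow_add, pow_eq_pow_iff_modEq, orderOf_weilPairing_basis L hn b,
    ← ZMod.natCast_eq_natCast_iff] at h
  push_cast [ZMod.natCast_zmod_val] at h
  rw [Matrix.det_fin_two]
  linear_combination h

end Determinant

/-! ### The cyclotomic character and complex conjugation. -/

section AbsoluteGalois

variable {K : Type*} [Field K] (N : ℕ) (E : WeierstrassCurve K) [E.IsElliptic]

theorem natCast_algebraicClosure_ne_zero (K : Type*) [Field K] [NeZero (N : K)] :
    (N : AlgebraicClosure K) ≠ 0 := by
  rw [← map_natCast (algebraMap K (AlgebraicClosure K))]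
  exact (map_ne_zero _).mpr (NeZero.ne _)

theorem apply_eq_pow_cycloChar [NeZero (N : K)] (σ : AbsGal K) {t : (AlgebraicClosure K)ˣ}
    (ht : t ^ N = 1) : σ t = ((t ^ (cycloChar K N σ : ZMod N).val : (AlgebraicClosure K)ˣ) :
      AlgebraicClosure K) := by
  have : NeZero N := .of_neZero_natCast K
  rw [Units.val_pow_eq_pow_val]
  exact modularCyclotomicCharacter.spec _ _ (MulSemiringAction.toRingAut (AbsGal K)
    (AlgebraicClosure K) σ) ht

theorem nonempty_basis_nTorsion [NeZero (N : K)] :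
    Nonempty (Module.Basis (Fin 2) (ZMod N) (NTorsion E N)) := by
  classical
  have : NeZero N := .of_neZero_natCast K
  exact nonempty_basis (FractionRing (CoordRing (AlgebraicClosure K) E))
    (natCast_algebraicClosure_ne_zero N K)

/-- Pairing values are N-th roots of unity, so e(σP, σQ) = σ e(P, Q) = e(P, Q)^χ(σ). -/
theorem det_modRepGL [NeZero (N : K)] (b : Module.Basis (Fin 2) (ZMod N) (NTorsion E N)) :
    Matrix.GeneralLinearGroup.det.comp (modRepGL E N b) = cycloChar K N := by
  classical
  have : NeZero N := .of_neZero_natCast K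
  let L := FractionRing (CoordRing (AlgebraicClosure K) E)
  ext σ
  refine det_eq_of_weilPairing L (natCast_algebraicClosure_ne_zero N K) b (galTorsion E N σ) _ ?_
  refine Units.ext ?_
  rw [← apply_eq_pow_cycloChar N σ (weilPairing_pow L _ _)]
  exact weilPairing_map L (σ : AlgebraicClosure K →ₐ[K] AlgebraicClosure K) rfl rfl

/-- A root of unity in ℂ has norm one, so its conjugate is its inverse; for a primitive N-th root
this reads χ(τ) + 1 = 0. -/
theorem cycloChar_eq_neg_one [NeZero (N : K)] {τ : AbsGal K} (hτ : IsComplexConj τ) :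
    cycloChar K N τ = -1 := by
  have : NeZero N := .of_neZero_natCast K
  obtain ⟨-, ι, -, hι⟩ := hτ
  have : NeZero (N : AlgebraicClosure K) := ⟨natCast_algebraicClosure_ne_zero N K⟩
  obtain ⟨ζ, hζ⟩ := HasEnoughRootsOfUnity.exists_primitiveRoot (AlgebraicClosure K) N
  obtain ⟨t, rfl⟩ := hζ.isUnit (NeZero.ne N)
  have ht : t ^ N = 1 := Units.ext (by simpa using hζ.pow_eq_one)
  have h1 : τ t * t = 1 := by
    apply ι.injective
    have hN : ‖ι t‖ = 1 := Complex.norm_eq_one_of_pow_eq_one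
      (by rw [← map_pow, hζ.pow_eq_one, map_one]) (NeZero.ne N)
    rw [map_mul, hι, map_one, mul_comm, Complex.mul_conj, Complex.normSq_eq_norm_sq, hN]
    simp
  rw [apply_eq_pow_cycloChar N τ ht, ← Units.val_mul, ← pow_succ] at h1
  have hd := hζ.dvd_of_pow_eq_one _ (by simpa using h1)
  have h2 := (ZMod.natCast_eq_zero_iff _ _).mpr hd
  rw [Nat.cast_add, ZMod.natCast_zmod_val, Nat.cast_one] at h2
  exact Units.ext (by simpa using eq_neg_of_add_eq_zero_left h2)

end AbsoluteGalois

end EllGalRep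

end

theorem mainTheorem4 :
    (∀ (K : Type*) [Field K] [PerfectField K] (N : ℕ) [NeZero (N : K)]
        (E : WeierstrassCurve K) [E.IsElliptic],
        Nonempty (Module.Basis (Fin 2) (ZMod N) (EllGalRep.NTorsion E N)) ∧
        ∀ b : Module.Basis (Fin 2) (ZMod N) (EllGalRep.NTorsion E N),
          Matrix.GeneralLinearGroup.det.comp (EllGalRep.modRepGL E N b) =
            EllGalRep.cycloChar K N) ∧
    (∀ (K : Type*) [Field K] [NumberField K] (N : ℕ) [NeZero N]
        (E : WeierstrassCurve K) [E.IsElliptic]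
        (b : Module.Basis (Fin 2) (ZMod N) (EllGalRep.NTorsion E N)),
        EllGalRep.IsOddRep (EllGalRep.modRepGL E N b)) := by
  refine ⟨fun K _ _ N _ E _ => ⟨EllGalRep.nonempty_basis_nTorsion N E,
    EllGalRep.det_modRepGL N E⟩, fun K _ _ N _ E _ b τ hτ => ?_⟩
  have : NeZero (N : K) := ⟨Nat.cast_ne_zero.mpr (NeZero.ne N)⟩
  rw [← EllGalRep.cycloChar_eq_neg_one N hτ, ← EllGalRep.det_modRepGL N E b]
  rfl
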